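/- **Cubes.** Let $A\subseteq\{0,1\}$. The cube category $\Box_A$ has as objects the posets $[1]^n$ ($n\ge 0$), and as morphisms the maps generated under composition by the faces $\partial_{i,\varepsilon}$ (insert the constant $\varepsilon\in\{0,1\}$ as $i$-th coordinate), the degeneracies $\sigma_i$ (omit the $i$-th coordinate) and, for $\varepsilon\in A$, the connections $\gamma_{i,\varepsilon}$ (replace the coordinates $x_i,x_{i+1}$ by $\max(x_i,x_{i+1})$ if $\varepsilon=0$ and by $\min(x_i,x_{i+1})$ if $\varepsilon=1$). A cubical set is a presheaf on $\Box_A$, with structure maps acting on the right; a cube is degenerate if it is in the image of some $\sigma_i$ or $\gamma_{i,\varepsilon}$. A marked cubical set is a cubical set with a set of marked cubes of positive dimension containing all degenerate cubes; morphisms preserve marked cubes. This gives a category $\mathsf{cSet}_A^+$. Let $\Box_A^n$ be the representable cubical set with only its degenerate cubes marked, and $\partial\Box_A^n\subseteq\Box_A^n$ the union of its faces $\partial_{i,\varepsilon}$, with the markings of $\Box^n_A$. **Comical maps.** For $n\ge1$, $1\le i\le n$, $\varepsilon\in\{0,1\}$, a monomorphism $\delta\colon[1]^m\to[1]^n$,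 written as $\partial_{c_1,\varepsilon_1}\cdots\partial_{c_r,\varepsilon_r}$ with $c_1>\dots>c_r$, is critical with respect to $\partial_{i,\varepsilon}$ if this expression contains neither $\partial_{i,0}$ nor $\partial_{i,1}$; for no $j>i$ contains $\partial_{j,\varepsilon}$ together with $\partial_{k,1-\varepsilon}$ for all $i<k<j$; and for no $j<i$ contains $\partial_{j,\varepsilon}$ together with $\partial_{k,1-\varepsilon}$ for all $j<k<i$. The comical cube $\Box^n_{A,i,\varepsilon}$ is $\Box_A^n$ with all critical faces of positive dimension marked as well. The comical open box inclusion is the inclusion of the union of all faces $\partial_{j,\varepsilon'}$ with $(j,\varepsilon')\ne(i,\varepsilon)$, with the induced markings, into $\Box^n_{A,i,\varepsilon}$. For $n\ge2$, let $(\Box^n_{A,i,\varepsilon})'$ be $\Box^n_{A,i,\varepsilon}$ with all $(n-1)$-dimensional faces except $\partial_{i,\varepsilon}$ also marked, and $\tau_{n-2}\Box^n_{A,i,\varepsilon}$ be $\Box^n_{A,i,\varepsilon}$ with all cubes of dimension greater than $n-2$ and positive also marked; the comical marking extension is the map $(\Box^n_{A,i,\varepsilon})'\to\tau_{n-2}\Box^n_{A,i,\varepsilon}$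 which is the identity on cubes. A map of $\mathsf{cSet}_A^+$ is comical if it is in the saturation of the set of all comical open box inclusions and comical marking extensions (the smallest class of maps containing them and closed under pushouts, transfinite composition and retracts), and a comical fibration if it has the right lifting property with respect to them. **Connections.** Let $i^*\colon\mathsf{cSet}_A^+\to\mathsf{cSet}_\varnothing^+$ be the functor that restricts the structure maps along $\Box_\varnothing\subseteq\Box_A$ and keeps the marked cubes. It has a left adjoint $i_!$; let $\eta\colon X\to i^*i_!X$ be the unit. A weak connection structure on a map $f\colon X\to Y$ in $\mathsf{cSet}_\varnothing^+$ is a map $\Gamma_f\colon i^*i_!X\to Y$ with $\Gamma_f\,\eta_X=f$. For $g\colon Y\to Z$ and $k\colon W\to X$ it induces the weak connection structures $g\,\Gamma_f$ on $gf$ and $\Gamma_f\circ i^*i_!k$ on $fk$. **Proposition.** Let $A\subseteq\{0,1\}$ and $n\ge0$. 1. The inclusion $\Box_\varnothing^n\cup_{\partial\Box_\varnothing^n}i^*\partial\Box_A^n\hookrightarrow i^*\Box_A^n$, whose domain is the pushout of $\Box_\varnothing^n\leftarrow\partial\Box_\varnothing^n\to i^*\partial\Box_A^n$ in $\mathsf{cSet}_\varnothing^+$,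 is comical. 2. Weak connection structures on $n$-cubes lift along comical fibrations, relative to the boundary. That is, let $f\colon X\to Y$ be a comical fibration in $\mathsf{cSet}_\varnothing^+$, let $x\colon\Box_\varnothing^n\to X$ with $\partial x=x|_{\partial\Box_\varnothing^n}$, and let $\Gamma_{\partial x}$ and $\Gamma_{fx}$ be weak connection structures on $\partial x$ and on $fx$ such that $\Gamma_{fx}$ restricts to $f\,\Gamma_{\partial x}$ on $\partial\Box_\varnothing^n$. Then there is a weak connection structure $\Gamma_x$ on $x$ which restricts to $\Gamma_{\partial x}$ and satisfies $f\,\Gamma_x=\Gamma_{fx}$. -/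

import Mathlib

open CategoryTheory CategoryTheory.Limits Opposite

attribute [local instance 2000] CategoryTheory.CategoryStruct.toQuiver

/-! ### Cube categories -/

/-- The face map `∂_{i,ε} : [1]^n → [1]^{n+1}`, inserting the constant `ε` at position `i`.
Vertices of `[1]^n` are functions `Fin n → Bool`, with `false` for `0` and `true` for `1`;
coordinates are numbered from `0`. -/
def cubeFace {n : ℕ} (i : Fin (n + 1)) (ε : Bool) (x : Fin n → Bool) : Fin (n + 1) → Bool :=
  i.insertNth (α := fun _ => Bool) ε x

/-- The degeneracy map `σ_i : [1]^{n+1} → [1]^n`, forgetting the coordinate `i`. -/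
def cubeDegen {n : ℕ} (i : Fin (n + 1)) (x : Fin (n + 1) → Bool) : Fin n → Bool :=
  fun j => x (i.succAbove j)

/-- The connection map `γ_{i,ε} : [1]^{n+2} → [1]^{n+1}`, replacing the two coordinates
`i, i + 1` by their maximum if `ε = 0`, and by their minimum if `ε = 1`. -/
def cubeConn {n : ℕ} (i : Fin (n + 1)) (ε : Bool) (x : Fin (n + 2) → Bool) :
    Fin (n + 1) → Bool :=
  fun j =>
    if j < i then x j.castSucc
    else if j = i then
      (if ε then min (x i.castSucc) (x i.succ) else max (x i.castSucc) (x i.succ))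
    else x j.succ

/-- The maps `[1]^m → [1]^n` generated under composition by faces, degeneracies, and the
connections `γ_{i,ε}` with `ε ∈ A`. -/
inductive IsCubeMap (A : Set Bool) : ∀ {m n : ℕ}, ((Fin m → Bool) → (Fin n → Bool)) → Prop
  | id (n : ℕ) : IsCubeMap A (fun x : Fin n → Bool => x)
  | face {n : ℕ} (i : Fin (n + 1)) (ε : Bool) : IsCubeMap A (cubeFace i ε)
  | degen {n : ℕ} (i : Fin (n + 1)) : IsCubeMap A (cubeDegen i)
  | conn {n : ℕ} (i : Fin (n + 1)) (ε : Bool) (hε : ε ∈ A) : IsCubeMap A (cubeConn i ε)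
  | comp {k m n : ℕ} {f : (Fin k → Bool) → (Fin m → Bool)} {g : (Fin m → Bool) → (Fin n → Bool)} :
      IsCubeMap A f → IsCubeMap A g → IsCubeMap A (fun x => g (f x))

theorem IsCubeMap.mono {A B : Set Bool} (h : A ⊆ B) {m n : ℕ}
    {f : (Fin m → Bool) → (Fin n → Bool)} (hf : IsCubeMap A f) : IsCubeMap B f := by
  induction hf with
  | id n => exact .id n
  | face i ε => exact .face i ε
  | degen i => exact .degen i
  | conn i ε hε => exact .conn i ε (h hε)
  | comp _ _ h₁ h₂ => exact .comp h₁ h₂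

/-- The cube category `□_A`; the object `⟨n⟩` is `[1]^n`. -/
structure CubeCat (A : Set Bool) where
  /-- the dimension of the cube -/
  dim : ℕ

namespace CubeCat

variable {A : Set Bool}

instance : Category (CubeCat A) where
  Hom c d := {f : (Fin c.dim → Bool) → (Fin d.dim → Bool) // IsCubeMap A f}
  id c := ⟨fun x => x, .id _⟩
  comp f g := ⟨fun x => g.1 (f.1 x), f.2.comp g.2⟩

/-- The face map as a morphism of `□_A`. -/
def face {n : ℕ} (i : Fin (n + 1)) (ε : Bool) : (⟨n⟩ : CubeCat A) ⟶ ⟨n + 1⟩ :=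
  ⟨cubeFace i ε, .face i ε⟩

/-- The degeneracy map as a morphism of `□_A`. -/
def degen {n : ℕ} (i : Fin (n + 1)) : (⟨n + 1⟩ : CubeCat A) ⟶ ⟨n⟩ :=
  ⟨cubeDegen i, .degen i⟩

/-- The connection map as a morphism of `□_A`, for `ε ∈ A`. -/
def conn {n : ℕ} (i : Fin (n + 1)) (ε : Bool) (hε : ε ∈ A) :
    (⟨n + 2⟩ : CubeCat A) ⟶ ⟨n + 1⟩ :=
  ⟨cubeConn i ε, .conn i ε hε⟩

/-- The inclusion `i : □_A ⥤ □_B` for `A ⊆ B`. -/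
def incl {A B : Set Bool} (h : A ⊆ B) : CubeCat A ⥤ CubeCat B where
  obj c := ⟨c.dim⟩
  map f := ⟨f.1, f.2.mono h⟩

/-- `IsFace j ε φ` says that `φ` is the face map `∂_{j,ε}`. -/
inductive IsFace {n : ℕ} (j : Fin (n + 1)) (ε : Bool) :
    ∀ {c : CubeCat A}, (c ⟶ ⟨n + 1⟩) → Prop
  | intro : IsFace j ε (face j ε)

/-- The `j`-th coordinate of `δ` is constant with value `ε`. If `δ` is a monomorphism, i.e. a
composite `∂_{c₁,ε₁} ⋯ ∂_{c_r,ε_r}` with `c₁ > ⋯ > c_r` (its standard form), this says exactly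
that the face map `∂_{j,ε}` occurs in the standard form of `δ`: as the indices decrease, the
constant inserted by `∂_{c_s,ε_s}` ends up at position `c_s`. -/
def HasFace {c d : CubeCat A} (δ : c ⟶ d) (j : Fin d.dim) (ε : Bool) : Prop :=
  ∀ x, δ.1 x j = ε

/-- `δ` defines a critical face of the `n`-cube with respect to the face `∂_{i,ε}`. -/
structure IsCritical {c d : CubeCat A} (i : Fin d.dim) (ε : Bool) (δ : c ⟶ d) : Prop where
  mono : Mono δ
  middle : ¬ (HasFace δ i ε ∨ HasFace δ i (!ε))
  high : ¬ ∃ j, i < j ∧ HasFace δ j ε ∧ ∀ k, i < k → k < j → HasFace δ k (!ε)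
  low : ¬ ∃ j, j < i ∧ HasFace δ j ε ∧ ∀ k, j < k → k < i → HasFace δ k (!ε)

end CubeCat

/-! ### Marked cubical sets -/

/-- Cubical sets: presheaves on `□_A`. -/
abbrev CubicalSet (A : Set Bool) := (CubeCat A)ᵒᵖ ⥤ Type

/-- A cube is degenerate if it is in the image of a degeneracy or of a connection. -/
inductive CubicalSet.IsDegenerate {A : Set Bool} (X : CubicalSet A) :
    ∀ {c : CubeCat A}, X.obj (op c) → Prop
  | degen {n : ℕ} (i : Fin (n + 1)) (y : X.obj (op ⟨n⟩)) :
      IsDegenerate X (X.map (CubeCat.degen i).op y)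
  | conn {n : ℕ} (i : Fin (n + 1)) (ε : Bool) (hε : ε ∈ A) (y : X.obj (op ⟨n + 1⟩)) :
      IsDegenerate X (X.map (CubeCat.conn i ε hε).op y)

theorem CubicalSet.IsDegenerate.pos {A : Set Bool} {X : CubicalSet A} {c : CubeCat A}
    {x : X.obj (op c)} (h : X.IsDegenerate x) : 0 < c.dim := by
  cases h <;> exact Nat.succ_pos _

theorem CubicalSet.IsDegenerate.app {A : Set Bool} {X Y : CubicalSet A} (f : X ⟶ Y)
    {c : CubeCat A} {x : X.obj (op c)} (h : X.IsDegenerate x) :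
    Y.IsDegenerate (f.app (op c) x) := by
  cases h with
  | degen i y => rw [NatTrans.naturality_apply]; exact .degen i _
  | conn i ε hε y => rw [NatTrans.naturality_apply]; exact .conn i ε hε _

/-- A marked cubical set: a cubical set with a set of marked cubes of positive dimension which
contains all degenerate cubes. -/
structure MarkedCubicalSet (A : Set Bool) where
  /-- the underlying cubical set -/
  cubes : CubicalSet A
  /-- the marked cubes -/
  marked : ∀ c : CubeCat A, Set (cubes.obj (op c))
  pos : ∀ {c : CubeCat A} {x : cubes.obj (op c)}, x ∈ marked c → 0 < c.dim
  degenerate : ∀ {c : CubeCat A} {x : cubes.obj (op c)}, cubes.IsDegenerate x → x ∈ marked c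

namespace MarkedCubicalSet

variable {A B : Set Bool}

/-- Morphisms of marked cubical sets: maps of cubical sets preserving marked cubes. -/
@[ext]
structure Hom (X Y : MarkedCubicalSet A) where
  /-- the underlying map of cubical sets -/
  map : X.cubes ⟶ Y.cubes
  marked : ∀ {c : CubeCat A} {x : X.cubes.obj (op c)},
    x ∈ X.marked c → map.app (op c) x ∈ Y.marked c

instance : Category (MarkedCubicalSet A) where
  Hom := Hom
  id X := ⟨𝟙 _, fun h => by simpa using h⟩
  comp f g := ⟨f.map ≫ g.map, fun h => by simpa using g.marked (f.marked h)⟩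

@[ext]
theorem hom_ext {X Y : MarkedCubicalSet A} {f g : X ⟶ Y} (h : f.map = g.map) : f = g :=
  Hom.ext h

@[simp] theorem id_map (X : MarkedCubicalSet A) : Hom.map (𝟙 X) = 𝟙 X.cubes := rfl

@[simp] theorem comp_map {X Y Z : MarkedCubicalSet A} (f : X ⟶ Y) (g : Y ⟶ Z) :
    Hom.map (f ≫ g) = f.map ≫ g.map := rfl

/-- The marked cubical set on `X` whose marked cubes are the degenerate ones and those in `S`
which have positive dimension. -/
def ofMarks (X : CubicalSet A) (S : ∀ c : CubeCat A, Set (X.obj (op c))) :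
    MarkedCubicalSet A where
  cubes := X
  marked c := {x | X.IsDegenerate x ∨ (0 < c.dim ∧ x ∈ S c)}
  pos h := h.elim (fun h => h.pos) (fun h => h.1)
  degenerate h := Or.inl h

/-- The regular subcomplex of `X` on a family of cubes closed under the structure maps: a cube
is marked in it iff it is marked in `X`. -/
def regular (X : MarkedCubicalSet A) (S : Subfunctor X.cubes) : MarkedCubicalSet A where
  cubes := S.toFunctor
  marked c := {x | x.1 ∈ X.marked c}
  pos h := X.pos h
  degenerate h := X.degenerate (h.app S.ι)

/-- The regular subcomplex inclusion. -/
def regularι (X : MarkedCubicalSet A) (S : Subfunctor X.cubes) : X.regular S ⟶ X where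
  map := S.ι
  marked h := h

/-- The entire map which adds marked cubes. -/
def entire (X : CubicalSet A) {S T : ∀ c : CubeCat A, Set (X.obj (op c))}
    (h : ∀ c, S c ⊆ T c) : ofMarks X S ⟶ ofMarks X T where
  map := 𝟙 X
  marked {c _} hx := Or.imp id (fun hx => ⟨hx.1, h c hx.2⟩) hx

/-! ### Standard cubes, boundaries, comical open boxes and marking extensions -/

/-- The standard cube `□^n_A`: the representable cubical set, with only the degenerate cubes
marked. -/
def stdCube (A : Set Bool) (n : ℕ) : MarkedCubicalSet A :=
  ofMarks (yoneda.obj ⟨n⟩) (fun _ => ∅)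

/-- The subcomplex of the `n`-cube consisting of all cubes of those faces `∂_{j,ε}` for which
`P j ε` holds. -/
def faceUnion (A : Set Bool) : ∀ (n : ℕ) (_ : Fin n → Bool → Prop),
    Subfunctor (yoneda.obj (⟨n⟩ : CubeCat A))
  | 0, _ => ⊥
  | n + 1, P =>
    { obj c := {φ | ∃ (j : Fin (n + 1)) (ε : Bool) (ψ : c.unop ⟶ (⟨n⟩ : CubeCat A)),
        P j ε ∧ φ = ψ ≫ CubeCat.face j ε}
      map := by
        rintro c d f φ ⟨j, ε, ψ, hP, rfl⟩
        exact ⟨j, ε, f.unop ≫ ψ, hP, by simp⟩ }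

/-- The boundary `∂□^n_A`. -/
def boundary (A : Set Bool) (n : ℕ) : MarkedCubicalSet A :=
  (stdCube A n).regular (faceUnion A n fun _ _ => True)

/-- The boundary inclusion `∂□^n_A ↪ □^n_A`. -/
def boundaryι (A : Set Bool) (n : ℕ) : boundary A n ⟶ stdCube A n :=
  regularι _ _

/-- The critical faces of the `n`-cube with respect to `∂_{i,ε}`. -/
def criticalFaces (A : Set Bool) (n : ℕ) (i : Fin n) (ε : Bool) (c : CubeCat A) :
    Set ((yoneda.obj (⟨n⟩ : CubeCat A)).obj (op c)) :=
  {δ : c ⟶ ⟨n⟩ | CubeCat.IsCritical i ε δ}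

/-- The `(i,ε)`-comical cube `□^n_{A,i,ε}`. -/
def comicalCube (A : Set Bool) (n : ℕ) (i : Fin n) (ε : Bool) : MarkedCubicalSet A :=
  ofMarks (yoneda.obj ⟨n⟩) (criticalFaces A n i ε)

/-- The `(i,ε)`-comical open box: the regular subcomplex of the comical cube formed by all faces
other than the interior and `∂_{i,ε}`. -/
def comicalBox (A : Set Bool) (n : ℕ) (i : Fin n) (ε : Bool) : MarkedCubicalSet A :=
  (comicalCube A n i ε).regular (faceUnion A n fun j ε' => (j, ε') ≠ (i, ε))

/-- The `(i,ε)`-comical open box inclusion. -/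
def comicalBoxι (A : Set Bool) (n : ℕ) (i : Fin n) (ε : Bool) :
    comicalBox A n i ε ⟶ comicalCube A n i ε :=
  regularι _ _

/-- The critical faces of the `(n+1)`-cube with respect to `∂_{i,ε}`, and its `n`-dimensional
faces other than `∂_{i,ε}`. -/
def criticalAndOtherFaces (A : Set Bool) (n : ℕ) (i : Fin (n + 1)) (ε : Bool) (c : CubeCat A) :
    Set ((yoneda.obj (⟨n + 1⟩ : CubeCat A)).obj (op c)) :=
  criticalFaces A (n + 1) i ε c ∪
    {δ : c ⟶ ⟨n + 1⟩ | ∃ j ε', (j, ε') ≠ (i, ε) ∧ CubeCat.IsFace j ε' δ}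

/-- The critical faces of the `(n+1)`-cube with respect to `∂_{i,ε}`, and all cubes of dimension
at least `n`. -/
def criticalAndHighCubes (A : Set Bool) (n : ℕ) (i : Fin (n + 1)) (ε : Bool) (c : CubeCat A) :
    Set ((yoneda.obj (⟨n + 1⟩ : CubeCat A)).obj (op c)) :=
  criticalFaces A (n + 1) i ε c ∪ {_δ : c ⟶ ⟨n + 1⟩ | n ≤ c.dim}

theorem criticalAndOtherFaces_subset (A : Set Bool) (n : ℕ) (i : Fin (n + 1)) (ε : Bool)
    (c : CubeCat A) : criticalAndOtherFaces A n i ε c ⊆ criticalAndHighCubes A n i ε c := by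
  rintro δ (h | ⟨j, ε', -, h⟩)
  · exact Or.inl h
  · refine Or.inr ?_
    cases h
    exact le_refl n

/-- The `(i,ε)`-comical marking extension `(□^{n+2}_{A,i,ε})' ⟶ τ_n □^{n+2}_{A,i,ε}`. In its
domain all critical faces and all codimension one faces except `∂_{i,ε}` are marked; in its
codomain, the `n`-trivialization, all cubes of dimension greater than `n` are marked too. -/
def comicalMarkingExt (A : Set Bool) (n : ℕ) (i : Fin (n + 2)) (ε : Bool) :
    ofMarks (yoneda.obj ⟨n + 2⟩) (criticalAndOtherFaces A (n + 1) i ε) ⟶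
      ofMarks (yoneda.obj ⟨n + 2⟩) (criticalAndHighCubes A (n + 1) i ε) :=
  entire _ (criticalAndOtherFaces_subset A (n + 1) i ε)

/-! ### Comical maps and comical fibrations -/

/-- The comical open box inclusions, in all dimensions `n + 1 ≥ 1`, and the comical marking
extensions, in all dimensions `n + 2 ≥ 2`. -/
def comicalGenerators (A : Set Bool) : MorphismProperty (MarkedCubicalSet A) :=
  MorphismProperty.ofHoms
      (fun p : (n : ℕ) × Fin (n + 1) × Bool => comicalBoxι A (p.1 + 1) p.2.1 p.2.2) ⊔
    MorphismProperty.ofHoms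
      (fun p : (n : ℕ) × Fin (n + 2) × Bool => comicalMarkingExt A p.1 p.2.1 p.2.2)

/-- The saturation of a class of maps: the smallest class containing it and closed under
pushouts, transfinite composition and retracts. -/
def saturation {C : Type 1} [Category.{0} C] (I : MorphismProperty C) : MorphismProperty C :=
  fun _ _ f => ∀ W : MorphismProperty C, I ≤ W → W.IsStableUnderCobaseChange →
    MorphismProperty.IsStableUnderTransfiniteComposition.{0} W → W.IsStableUnderRetracts → W f

/-- Comical maps. -/
def comical (A : Set Bool) : MorphismProperty (MarkedCubicalSet A) :=
  saturation (comicalGenerators A)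

/-- Comical fibrations: the maps with the right lifting property with respect to all comical open
box inclusions and comical marking extensions. -/
def comicalFibration (A : Set Bool) : MorphismProperty (MarkedCubicalSet A) :=
  (comicalGenerators A).rlp

/-! ### The adjunction `i_! ⊣ i^*` -/

/-- The functor `i^*`, which forgets the connections not in `A`. -/
def iStar (h : A ⊆ B) : MarkedCubicalSet B ⥤ MarkedCubicalSet A where
  obj X :=
    { cubes := (CubeCat.incl h).op ⋙ X.cubes
      marked c := X.marked ((CubeCat.incl h).obj c)
      pos hx := X.pos hx
      degenerate {c x} hx := by
        apply X.degenerate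
        cases hx with
        | degen i y => exact .degen (X := X.cubes) i y
        | conn i ε hε y => exact .conn (X := X.cubes) i ε (h hε) y }
  map f :=
    { map := Functor.whiskerLeft (CubeCat.incl h).op f.map
      marked hx := f.marked hx }

/-- On objects, `i_!` is the left Kan extension of the underlying cubical set; its marked cubes
are the degenerate ones and those coming from the marked cubes of `X`. -/
noncomputable def iShriekObj (h : A ⊆ B) (X : MarkedCubicalSet A) : MarkedCubicalSet B :=
  ofMarks ((CubeCat.incl h).op.lan.obj X.cubes) (fun c =>
    {y | ∃ x ∈ X.marked ⟨c.dim⟩,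
      ((CubeCat.incl h).op.lanUnit.app X.cubes).app (op ⟨c.dim⟩) x = y})

theorem lan_homEquiv (h : A ⊆ B) (X : CubicalSet A) (Y : CubicalSet B)
    (f : (CubeCat.incl h).op.lan.obj X ⟶ Y) :
    ((CubeCat.incl h).op.lanAdjunction Type).homEquiv X Y f =
      (CubeCat.incl h).op.lanUnit.app X ≫ Functor.whiskerLeft (CubeCat.incl h).op f := by
  rw [Adjunction.homEquiv_unit, Functor.lanAdjunction_unit]
  rfl

/-- The bijection between maps `i_! X ⟶ Y` and maps `X ⟶ i^* Y`. -/
noncomputable def iShriekEquiv (h : A ⊆ B) (X : MarkedCubicalSet A) (Y : MarkedCubicalSet B) :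
    (iShriekObj h X ⟶ Y) ≃ (X ⟶ (iStar h).obj Y) where
  toFun f :=
    { map := ((CubeCat.incl h).op.lanAdjunction Type).homEquiv _ _ f.map
      marked {c x} hx := by
        have key := f.marked (c := (CubeCat.incl h).obj c)
          (x := ((CubeCat.incl h).op.lanUnit.app X.cubes).app (op c) x)
          (Or.inr ⟨X.pos hx, x, hx, rfl⟩)
        have e := lan_homEquiv h X.cubes Y.cubes f.map
        rw [e]
        exact key }
  invFun g :=
    { map := (((CubeCat.incl h).op.lanAdjunction Type).homEquiv _ _).symm g.map
      marked {c y} hy := by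
        rcases hy with hy | ⟨-, x, hx, rfl⟩
        · exact Y.degenerate (hy.app _)
        · have key := g.marked hx
          have e := (lan_homEquiv h X.cubes Y.cubes _).symm.trans
            ((((CubeCat.incl h).op.lanAdjunction Type).homEquiv
              X.cubes Y.cubes).apply_symm_apply g.map)
          rw [← e] at key
          exact key }
  left_inv f := by
    ext1
    exact Equiv.symm_apply_apply _ _
  right_inv g := by
    ext1
    exact Equiv.apply_symm_apply _ _

theorem iShriekEquiv_naturality (h : A ⊆ B) (X : MarkedCubicalSet A) (Y Y' : MarkedCubicalSet B)
    (g : Y ⟶ Y') (f : iShriekObj h X ⟶ Y) :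
    iShriekEquiv h X Y' (f ≫ g) = iShriekEquiv h X Y f ≫ (iStar h).map g := by
  ext1
  exact Adjunction.homEquiv_naturality_right _ _ _

/-- The functor `i_!`, which freely adds the connections of `□_B`. -/
noncomputable def iShriek (h : A ⊆ B) : MarkedCubicalSet A ⥤ MarkedCubicalSet B :=
  Adjunction.leftAdjointOfEquiv (iShriekEquiv h) (iShriekEquiv_naturality h)

/-- The adjunction `i_! ⊣ i^*`. -/
noncomputable def iAdj (h : A ⊆ B) : iShriek h ⊣ iStar h :=
  Adjunction.adjunctionOfEquivLeft (iShriekEquiv h) (iShriekEquiv_naturality h)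

/-- A weak connection structure (with respect to `□_B`) on a map `f : X ⟶ Y`: a map
`Γ : i^* i_! X ⟶ Y` whose composite with the unit `X ⟶ i^* i_! X` is `f`. -/
structure WeakConnectionStructure (h : A ⊆ B) {X Y : MarkedCubicalSet A} (f : X ⟶ Y) where
  /-- the underlying map -/
  Γ : (iStar h).obj ((iShriek h).obj X) ⟶ Y
  unit_comp : (iAdj h).unit.app X ≫ Γ = f

/-- The weak connection structure `Γ_f ∘ i^* i_! k` on `f k`, for `k : W ⟶ X`. -/
noncomputable def WeakConnectionStructure.precomp {h : A ⊆ B} {W X Y : MarkedCubicalSet A} {f : X ⟶ Y}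
    (G : WeakConnectionStructure h f) (k : W ⟶ X) : WeakConnectionStructure h (k ≫ f) where
  Γ := (iStar h).map ((iShriek h).map k) ≫ G.Γ
  unit_comp := by
    have e : (iAdj h).unit.app W ≫ (iStar h).map ((iShriek h).map k) =
        k ≫ (iAdj h).unit.app X := ((iAdj h).unit.naturality k).symm
    rw [← Category.assoc, e, Category.assoc, G.unit_comp]

/-- The weak connection structure `g Γ_f` on `g f`, for `g : Y ⟶ Z`. -/
noncomputable def WeakConnectionStructure.postcomp {h : A ⊆ B} {X Y Z : MarkedCubicalSet A} {f : X ⟶ Y}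
    (G : WeakConnectionStructure h f) (g : Y ⟶ Z) : WeakConnectionStructure h (f ≫ g) where
  Γ := G.Γ ≫ g
  unit_comp := by rw [← Category.assoc, G.unit_comp]

/-! ### Colimits of marked cubical sets -/

section Colimits

variable {J : Type} [Category.{0} J] (F : J ⥤ MarkedCubicalSet A)

/-- The functor to the underlying cubical sets. -/
def toCubical (A : Set Bool) : MarkedCubicalSet A ⥤ CubicalSet A where
  obj X := X.cubes
  map f := f.map

/-- The colimit cocone: a cube of the colimit is marked iff it is degenerate or comes from a
marked cube of the diagram. -/
noncomputable def colimitCocone : Cocone F where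
  pt := ofMarks (colimit (F ⋙ toCubical A)) (fun c =>
    {y | ∃ (j : J) (x : (F.obj j).cubes.obj (op c)), x ∈ (F.obj j).marked c ∧
      (colimit.ι (F ⋙ toCubical A) j).app (op c) x = y})
  ι :=
    { app j :=
        { map := colimit.ι (F ⋙ toCubical A) j
          marked {c x} hx := Or.inr ⟨(F.obj j).pos hx, j, x, hx, rfl⟩ }
      naturality j j' f := by
        ext1
        exact (colimit.w (F ⋙ toCubical A) f).trans (Category.comp_id _).symm }

/-- The colimit cocone is a colimit. -/
noncomputable def colimitCoconeIsColimit : IsColimit (colimitCocone F) where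
  desc s :=
    { map := colimit.desc (F ⋙ toCubical A) ((toCubical A).mapCocone s)
      marked {c y} hy := by
        rcases hy with hy | ⟨-, j, x, hx, rfl⟩
        · exact s.pt.degenerate (hy.app _)
        · have key := (s.ι.app j).marked hx
          have e : (s.ι.app j).map = colimit.ι (F ⋙ toCubical A) j ≫
              colimit.desc (F ⋙ toCubical A) ((toCubical A).mapCocone s) :=
            (colimit.ι_desc ((toCubical A).mapCocone s) j).symm
          rw [e] at key
          exact key }
  fac s j := by
    ext1
    exact colimit.ι_desc ((toCubical A).mapCocone s) j
  uniq s m hm := by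
    ext1
    refine colimit.hom_ext fun j => ?_
    exact (congrArg Hom.map (hm j)).trans (colimit.ι_desc ((toCubical A).mapCocone s) j).symm

instance : HasColimitsOfSize.{0, 0} (MarkedCubicalSet A) where
  has_colimits_of_shape _ _ := { has_colimit F := ⟨⟨⟨_, colimitCoconeIsColimit F⟩⟩⟩ }

end Colimits

/-! ### The inclusion `□_∅^n ∪_{∂□_∅^n} i^* ∂□_A^n ↪ i^* □_A^n` -/

theorem incl_mem_faceUnion (h : A ⊆ B) (n : ℕ) (P : Fin n → Bool → Prop) {c : CubeCat A}
    {φ : c ⟶ ⟨n⟩} (hφ : φ ∈ (faceUnion A n P).obj (op c)) :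
    (CubeCat.incl h).map φ ∈ (faceUnion B n P).obj (op ((CubeCat.incl h).obj c)) := by
  cases n with
  | zero => exact hφ.elim
  | succ n =>
    obtain ⟨j, ε, ψ, hP, rfl⟩ := hφ
    exact ⟨j, ε, (CubeCat.incl h).map ψ, hP, rfl⟩

/-- The natural inclusion `□_A^n ↪ i^* □_B^n`. -/
def cubeToIStar (h : A ⊆ B) (n : ℕ) : stdCube A n ⟶ (iStar h).obj (stdCube B n) where
  map := { app c := ↾fun φ => (CubeCat.incl h).map φ }
  marked {c φ} hφ := by
    rcases hφ with hφ | hφ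
    · exact ((iStar h).obj (stdCube B n)).degenerate (hφ.app _)
    · exact hφ.2.elim

/-- Its restriction `∂□_A^n ↪ i^* ∂□_B^n` to the boundaries. -/
def boundaryToIStar (h : A ⊆ B) (n : ℕ) : boundary A n ⟶ (iStar h).obj (boundary B n) where
  map := { app c := ↾fun φ => ⟨(CubeCat.incl h).map φ.1, incl_mem_faceUnion h n _ φ.2⟩ }
  marked {c φ} hφ := (cubeToIStar h n).marked hφ

theorem boundaryToIStar_comp (h : A ⊆ B) (n : ℕ) :
    boundaryToIStar h n ≫ (iStar h).map (boundaryι B n) = boundaryι A n ≫ cubeToIStar h n :=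
  rfl

/-- The inclusion `□_A^n ∪_{∂□_A^n} i^* ∂□_B^n ↪ i^* □_B^n` of the pushout. -/
noncomputable def cornerInclusion (h : A ⊆ B) (n : ℕ) :
    pushout (boundaryι A n) (boundaryToIStar h n) ⟶ (iStar h).obj (stdCube B n) :=
  pushout.desc (cubeToIStar h n) ((iStar h).map (boundaryι B n)) (boundaryToIStar_comp h n).symm

end MarkedCubicalSet

open MarkedCubicalSet

/-! The second claim follows from the first. Comparing universal properties, `i_!` takes `□_∅^n` and
its boundary to `□_A^n` and its boundary. So a weak connection structure on an `n`-cube is an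
extension of it along `□_∅^n → i^* □_A^n`, and the wanted structure is a lift of a square against
the corner inclusion (`exists_weakConnectionStructure`).

For the first claim, filter `i^* □_A^n`. Stage `K` (`cubeFiltration`) consists of the maps with a
constant coordinate and the maps whose coordinates from `K` on, counted from `0`, are constants or
projections. Stage `0` is the domain of the corner inclusion and stage `n` is everything. If `A` is
empty the two coincide; otherwise fix `ε ∈ A`. Since `γ_{k,ε} ∂_{k+1,ε} = id`, the step from `k` to
`k + 1` is a retract of an inclusion of complexes in a cube of one dimension more, where a cube is
marked if its composite with `γ_{k,ε}` is not injective (`cubeFiltrationRetract`).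

That inclusion is a composite of two (`isInsertionPair_unitSieve` at the coordinate `c = k`,
`isInsertionPair_elementaryFrom` at `c = k + 1`). In each, the new nondegenerate cubes come in
pairs: a map `x` whose coordinate `c` is a variable `p`, and its face `∂_{p,ε}`. The opposite face
is already present, because `!ε` is absorbing for the connection, and the remaining faces are
present or come from smaller cells. So `x` is attached along the open box missing `∂_{p,ε}`, with a
marking extension if that face is marked (`IsComicalCell.mem`, `IsInsertionPair.mem_property`).

Two facts about cube maps carry the combinatorics. Successive coordinates depend on disjoint,
increasing blocks of variables (`IsCubeMap.ordered`), so that a cell is determined by its missing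
face (`eq_of_insert`). A cube of `□_A^n` is degenerate iff it is not injective
(`IsCubeMap.isDegenerateMap_iff`), which makes the markings computable. -/

/-! ### Essential variables of maps between cubes -/

/-- The variable `s` is essential for `g` if the value of `g` depends on it. -/
def IsEssential {m : ℕ} {β : Type*} (g : (Fin m → Bool) → β) (s : Fin m) : Prop :=
  ∃ v b, g (Function.update v s b) ≠ g v

/-- A Boolean function is elementary if it is a constant or a coordinate projection. -/
def IsElementary {m : ℕ} (g : (Fin m → Bool) → Bool) : Prop :=
  (∃ b, ∀ v, g v = b) ∨ ∃ s, ∀ v, g v = v s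

/-- Pass from `w` to `v` one variable at a time: changing an inessential variable does not affect
the value, and at an essential one the two points already agree. -/
theorem eq_of_agree_on_essential {m : ℕ} {β : Type*} (g : (Fin m → Bool) → β)
    {v w : Fin m → Bool} (h : ∀ s, IsEssential g s → v s = w s) : g v = g w := by
  classical
  have key : ∀ F : Finset (Fin m), g (fun s => if s ∈ F then v s else w s) = g w := by
    intro F
    induction F using Finset.induction_on with
    | empty => simp
    | insert a F ha ih =>
      rw [← ih]
      have e : (fun s => if s ∈ insert a F then v s else w s) =
          Function.update (fun s => if s ∈ F then v s else w s) a (v a) := by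
        ext s
        by_cases hs : s = a
        · subst hs; simp
        · simp [hs]
      rw [e]
      by_cases hg : IsEssential g a
      · congr 1
        ext s
        by_cases hs : s = a
        · subst hs; simp [ha, h s hg]
        · simp [hs]
      · by_contra hne
        exact hg ⟨_, _, hne⟩
  simpa using key Finset.univ

/-- Otherwise a change of `s` alters only coordinates of `f` which `g` ignores. -/
theorem IsEssential.exists_of_comp {k m : ℕ} {β : Type*} {f : (Fin k → Bool) → (Fin m → Bool)}
    {g : (Fin m → Bool) → β} {s : Fin k} (h : IsEssential (fun x => g (f x)) s) :
    ∃ u, IsEssential g u ∧ IsEssential (fun x => f x u) s := by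
  by_contra! hc
  obtain ⟨v, b, hv⟩ := h
  refine hv (eq_of_agree_on_essential g fun u hu => ?_)
  by_contra hne
  exact hc u hu ⟨v, b, hne⟩

theorem isEssential_proj {m : ℕ} {a s : Fin m} :
    IsEssential (fun x : Fin m → Bool => x a) s ↔ s = a := by
  constructor
  · rintro ⟨v, b, h⟩
    by_contra hne
    exact h (Function.update_of_ne (Ne.symm hne) _ _)
  · rintro rfl
    exact ⟨fun _ => false, true, by simp⟩

theorem not_isEssential_const {m : ℕ} {β : Type*} {g : (Fin m → Bool) → β} {b : β}
    (h : ∀ v, g v = b) (s : Fin m) : ¬ IsEssential g s := by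
  rintro ⟨v, b, hv⟩
  exact hv (by rw [h, h])

theorem const_of_forall_not_isEssential {m : ℕ} {β : Type*} {g : (Fin m → Bool) → β}
    (h : ∀ s, ¬ IsEssential g s) (w : Fin m → Bool) (v : Fin m → Bool) : g v = g w :=
  eq_of_agree_on_essential g fun s hs => (h s hs).elim

theorem IsEssential.exists_coord {m n : ℕ} {φ : (Fin m → Bool) → (Fin n → Bool)} {s : Fin m}
    (h : IsEssential φ s) : ∃ j, IsEssential (fun v => φ v j) s := by
  obtain ⟨v, b, hv⟩ := h
  by_contra! hc
  refine hv (funext fun j => ?_)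
  by_contra hne
  exact hc j ⟨v, b, hne⟩

theorem IsEssential.of_coord {m n : ℕ} {φ : (Fin m → Bool) → (Fin n → Bool)} {s : Fin m}
    {j : Fin n} (h : IsEssential (fun v => φ v j) s) : IsEssential φ s := by
  obtain ⟨v, b, hv⟩ := h
  exact ⟨v, b, fun e => hv (congrFun e j)⟩

theorem not_injective_of_not_isEssential {m : ℕ} {β : Type*} {g : (Fin m → Bool) → β} {s : Fin m}
    (h : ¬ IsEssential g s) : ¬ Function.Injective g := by
  intro hg
  have e : g (Function.update (fun _ => false) s true) = g (fun _ => false) := by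
    by_contra hne
    exact h ⟨_, _, hne⟩
  have := congrFun (hg e) s
  simp at this

theorem IsElementary.comp {k m : ℕ} {f : (Fin k → Bool) → (Fin m → Bool)}
    {g : (Fin m → Bool) → Bool} (hg : IsElementary g) (hf : ∀ j, IsElementary fun x => f x j) :
    IsElementary fun x => g (f x) := by
  rcases hg with ⟨b, hb⟩ | ⟨s, hs⟩
  · exact Or.inl ⟨b, fun v => hb _⟩
  · have e : (fun x => g (f x)) = fun x => f x s := funext fun x => hs _
    rw [e]
    exact hf s

/-! ### Coordinates of the generating maps -/

@[simp] theorem cubeFace_same {n : ℕ} (i : Fin (n + 1)) (ε : Bool) (x : Fin n → Bool) :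
    cubeFace i ε x i = ε := by
  simp [cubeFace]

@[simp] theorem cubeFace_succAbove {n : ℕ} (i : Fin (n + 1)) (ε : Bool) (x : Fin n → Bool)
    (j : Fin n) : cubeFace i ε x (i.succAbove j) = x j := by
  simp [cubeFace]

@[simp] theorem cubeDegen_cubeFace {n : ℕ} (i : Fin (n + 1)) (ε : Bool) (x : Fin n → Bool) :
    cubeDegen i (cubeFace i ε x) = x := by
  ext j; simp [cubeDegen]

theorem cubeFace_cubeDegen {n : ℕ} (i : Fin (n + 1)) (ε : Bool) (x : Fin (n + 1) → Bool) :
    cubeFace i ε (cubeDegen i x) = Function.update x i ε := by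
  ext j
  rcases Fin.eq_self_or_eq_succAbove i j with rfl | ⟨j, rfl⟩
  · simp
  · simp [cubeDegen]

theorem cubeFace_cubeDegen_of_eq {n : ℕ} {i : Fin (n + 1)} {ε : Bool} {x : Fin (n + 1) → Bool}
    (h : x i = ε) : cubeFace i ε (cubeDegen i x) = x := by
  rw [cubeFace_cubeDegen, ← h, Function.update_eq_self]

/-- The binary operation of the connection `γ_{i,ε}`: minimum for `ε = 1`, maximum for `ε = 0`. -/
def connOp (ε a b : Bool) : Bool := if ε then min a b else max a b

@[simp] theorem connOp_unit_right (ε a : Bool) : connOp ε a ε = a := by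
  cases ε <;> cases a <;> rfl

@[simp] theorem connOp_unit_left (ε a : Bool) : connOp ε ε a = a := by
  cases ε <;> cases a <;> rfl

@[simp] theorem connOp_not_right (ε a : Bool) : connOp ε a (!ε) = !ε := by
  cases ε <;> cases a <;> rfl

@[simp] theorem connOp_not_left (ε a : Bool) : connOp ε (!ε) a = !ε := by
  cases ε <;> cases a <;> rfl

theorem cubeConn_same {n : ℕ} (i : Fin (n + 1)) (ε : Bool) (x : Fin (n + 2) → Bool) :
    cubeConn i ε x i = connOp ε (x i.castSucc) (x i.succ) := by
  simp [cubeConn, connOp]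

theorem cubeConn_lt {n : ℕ} {i j : Fin (n + 1)} (h : j < i) (ε : Bool) (x : Fin (n + 2) → Bool) :
    cubeConn i ε x j = x j.castSucc := by
  simp [cubeConn, h]

theorem cubeConn_gt {n : ℕ} {i j : Fin (n + 1)} (h : i < j) (ε : Bool) (x : Fin (n + 2) → Bool) :
    cubeConn i ε x j = x j.succ := by
  simp [cubeConn, h.not_gt, h.ne']

theorem connOp_mono (ε : Bool) {a b c d : Bool} (h : a ≤ c) (h' : b ≤ d) :
    connOp ε a b ≤ connOp ε c d := by
  revert a b c d ε; decide

theorem IsCubeMap.monotone {A : Set Bool} {m n : ℕ} {φ : (Fin m → Bool) → (Fin n → Bool)}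
    (h : IsCubeMap A φ) : Monotone φ := by
  induction h with
  | id n => exact fun _ _ h => h
  | face i ε =>
    intro v w h j
    rcases Fin.eq_self_or_eq_succAbove i j with rfl | ⟨j, rfl⟩
    · simp
    · simpa using h j
  | degen i => exact fun v w h j => h _
  | conn i ε hε =>
    intro v w h j
    rcases lt_trichotomy j i with hj | rfl | hj
    · rw [cubeConn_lt hj, cubeConn_lt hj]; exact h _
    · rw [cubeConn_same, cubeConn_same]; exact connOp_mono _ (h _) (h _)
    · rw [cubeConn_gt hj, cubeConn_gt hj]; exact h _
  | comp _ _ h₁ h₂ => exact h₂.comp h₁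

theorem isEssential_cubeConn {n : ℕ} {i j : Fin (n + 1)} {ε : Bool} {s : Fin (n + 2)}
    (h : IsEssential (fun x => cubeConn i ε x j) s) :
    (j < i ∧ s = j.castSucc) ∨ (j = i ∧ (s = i.castSucc ∨ s = i.succ)) ∨ (i < j ∧ s = j.succ) := by
  rcases lt_trichotomy j i with hj | rfl | hj
  · simp only [cubeConn_lt hj, isEssential_proj] at h
    exact Or.inl ⟨hj, h⟩
  · refine Or.inr (Or.inl ⟨rfl, ?_⟩)
    by_contra! hc
    obtain ⟨v, b, hv⟩ := h
    apply hv
    simp [cubeConn_same, Function.update_of_ne hc.1.symm, Function.update_of_ne hc.2.symm]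
  · simp only [cubeConn_gt hj, isEssential_proj] at h
    exact Or.inr (Or.inr ⟨hj, h⟩)

/-- Each generator uses its variables in increasing order and each in at most one coordinate, and
this survives composition. It is the main structural fact about cube maps used below. -/
theorem IsCubeMap.ordered {A : Set Bool} {m n : ℕ} {φ : (Fin m → Bool) → (Fin n → Bool)}
    (h : IsCubeMap A φ) : ∀ {j j' : Fin n} {s t : Fin m}, j < j' →
      IsEssential (fun v => φ v j) s → IsEssential (fun v => φ v j') t → s < t := by
  induction h with
  | id n =>
    intro j j' s t hj hs ht
    rw [isEssential_proj] at hs ht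
    rwa [hs, ht]
  | face i ε =>
    intro j j' s t hj hs ht
    rcases Fin.eq_self_or_eq_succAbove i j with rfl | ⟨j, rfl⟩
    · exact (not_isEssential_const (b := ε) (by simp) _ hs).elim
    rcases Fin.eq_self_or_eq_succAbove i j' with rfl | ⟨j', rfl⟩
    · exact (not_isEssential_const (b := ε) (by simp) _ ht).elim
    simp only [cubeFace_succAbove, isEssential_proj] at hs ht
    rw [hs, ht]
    exact (Fin.strictMono_succAbove i).lt_iff_lt.1 hj
  | degen i =>
    intro j j' s t hj hs ht
    simp only [cubeDegen, isEssential_proj] at hs ht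
    rw [hs, ht]
    exact Fin.strictMono_succAbove i hj
  | conn i ε hε =>
    intro j j' s t hj hs ht
    have hs := isEssential_cubeConn hs
    have ht := isEssential_cubeConn ht
    simp only [Fin.ext_iff, Fin.lt_def, Fin.val_castSucc, Fin.val_succ] at *
    omega
  | @comp _ _ _ f g _ _ h₁ h₂ =>
    intro j j' s t hj hs ht
    obtain ⟨u, hu, hs⟩ := IsEssential.exists_of_comp (f := f) (g := fun y => g y j) hs
    obtain ⟨u', hu', ht⟩ := IsEssential.exists_of_comp (f := f) (g := fun y => g y j') ht
    exact h₁ (h₂ hj hu hu') hs ht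

theorem IsCubeMap.eq_of_isEssential {A : Set Bool} {m n : ℕ}
    {φ : (Fin m → Bool) → (Fin n → Bool)} (h : IsCubeMap A φ) {j j' : Fin n} {s : Fin m}
    (hs : IsEssential (fun v => φ v j) s) (hs' : IsEssential (fun v => φ v j') s) : j = j' := by
  rcases lt_trichotomy j j' with hj | hj | hj
  · exact (lt_irrefl _ (h.ordered hj hs hs')).elim
  · exact hj
  · exact (lt_irrefl _ (h.ordered hj hs' hs)).elim

/-! ### Cube maps all of whose coordinates are elementary -/

theorem IsCubeMap.isElementary {m n : ℕ} {φ : (Fin m → Bool) → (Fin n → Bool)}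
    (h : IsCubeMap ∅ φ) : ∀ j, IsElementary fun v => φ v j := by
  induction h with
  | id n => exact fun j => Or.inr ⟨j, fun _ => rfl⟩
  | face i ε =>
    intro j
    rcases Fin.eq_self_or_eq_succAbove i j with rfl | ⟨j, rfl⟩
    · exact Or.inl ⟨ε, by simp⟩
    · exact Or.inr ⟨j, by simp⟩
  | degen i => exact fun j => Or.inr ⟨i.succAbove j, fun _ => rfl⟩
  | conn i ε hε => exact hε.elim
  | comp _ _ h₁ h₂ => exact fun j => (h₂ j).comp h₁

/-- Removing an inessential variable. -/
theorem eq_cubeFace_cubeDegen_of_not_isEssential {m : ℕ} {β : Type*} {g : (Fin (m + 1) → Bool) → β}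
    {s : Fin (m + 1)} (h : ¬ IsEssential g s) (ε : Bool) (v : Fin (m + 1) → Bool) :
    g (cubeFace s ε (cubeDegen s v)) = g v := by
  rw [cubeFace_cubeDegen]
  by_contra hne
  exact h ⟨_, _, hne⟩

/-- Split off a constant coordinate as a face and an inessential variable as a degeneracy. Once both
are exhausted, the map is given by a strictly increasing bijection of index sets, hence is the
identity. -/
theorem isCubeMap_empty_of_isElementary : ∀ {m n : ℕ} (φ : (Fin m → Bool) → (Fin n → Bool)),
    (∀ j, IsElementary fun v => φ v j) →
    (∀ (j j' : Fin n) (s t : Fin m), j < j' →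
      IsEssential (fun v => φ v j) s → IsEssential (fun v => φ v j') t → s < t) →
    IsCubeMap ∅ φ := by
  intro m n
  induction h : m + n using Nat.strong_induction_on generalizing m n with
  | _ N ih =>
  intro φ hφ ho
  subst h
  by_cases hc : ∃ j b, ∀ v, φ v j = b
  · obtain ⟨j, b, hj⟩ := hc
    obtain _ | n := n
    · exact j.elim0
    have h1 : IsCubeMap ∅ fun v => cubeDegen j (φ v) :=
      ih (m + n) (by omega) rfl _ (fun i => hφ _)
        fun i i' s t hi hs ht => ho _ _ s t (Fin.strictMono_succAbove j hi) hs ht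
    have e : φ = fun v => cubeFace j b (cubeDegen j (φ v)) :=
      funext fun v => (cubeFace_cubeDegen_of_eq (hj v)).symm
    rw [e]
    exact h1.comp (.face j b)
  by_cases hs : ∃ s, ¬ IsEssential φ s
  · obtain ⟨s, hs⟩ := hs
    obtain _ | m := m
    · exact s.elim0
    have hE : ∀ {g : (Fin (m + 1) → Bool) → Bool} {t : Fin m},
        IsEssential (fun v => g (cubeFace s false v)) t → IsEssential g (s.succAbove t) := by
      intro g t h
      obtain ⟨u, hu, hu'⟩ := h.exists_of_comp
      rcases Fin.eq_self_or_eq_succAbove s u with rfl | ⟨u, rfl⟩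
      · exact (not_isEssential_const (b := false) (by simp) _ hu').elim
      · simp only [cubeFace_succAbove, isEssential_proj] at hu'
        rwa [hu']
    have h1 : IsCubeMap ∅ fun v => φ (cubeFace s false v) :=
      ih (m + n) (by omega) rfl _
        (fun j => (hφ j).comp (IsCubeMap.face s false).isElementary)
        fun i i' t t' hi ht ht' => (Fin.strictMono_succAbove s).lt_iff_lt.1
          (ho i i' _ _ hi (hE (g := fun v => φ v i) ht) (hE (g := fun v => φ v i') ht'))
    have e : φ = fun v => φ (cubeFace s false (cubeDegen s v)) :=
      funext fun v => (eq_cubeFace_cubeDegen_of_not_isEssential hs _ v).symm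
    rw [e]
    exact (IsCubeMap.degen s).comp h1
  push Not at hs
  have hp : ∀ j, ∃ s, ∀ v, φ v j = v s := fun j => by
    rcases hφ j with ⟨b, hb⟩ | h
    · exact (hc ⟨j, b, hb⟩).elim
    · exact h
  choose σ hσ using hp
  have hmono : StrictMono σ := fun j j' hj =>
    ho j j' _ _ hj (by simp only [hσ, isEssential_proj]) (by simp only [hσ, isEssential_proj])
  have hsurj : Function.Surjective σ := fun s => by
    obtain ⟨j, hj⟩ := (hs s).exists_coord
    simp only [hσ, isEssential_proj] at hj
    exact ⟨j, hj.symm⟩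
  obtain rfl : m = n := by
    have h1 := Fintype.card_le_of_injective σ hmono.injective
    have h2 := Fintype.card_le_of_surjective σ hsurj
    simp at h1 h2
    omega
  have hid : σ = id := by
    apply (StrictMono.range_inj hmono strictMono_id).1
    rw [hsurj.range_eq, Set.range_id]
  have e : φ = fun v => v := by
    ext v j
    rw [hσ, hid]
    rfl
  rw [e]
  exact .id m

theorem IsCubeMap.of_isElementary {A : Set Bool} {m n : ℕ}
    {φ : (Fin m → Bool) → (Fin n → Bool)} (h : IsCubeMap A φ)
    (hφ : ∀ j, IsElementary fun v => φ v j) : IsCubeMap ∅ φ :=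
  isCubeMap_empty_of_isElementary φ hφ fun _ _ _ _ hj hs ht => h.ordered hj hs ht

/-! ### Insertion of a new variable -/

theorem Fin.exists_predAbove_eq {n : ℕ} (i c : Fin (n + 1)) :
    ∃ p : Fin (n + 2), i.predAbove p = c := by
  by_cases h : c ≤ i
  · exact ⟨c.castSucc, Fin.predAbove_castSucc_of_le _ _ h⟩
  · exact ⟨c.succ, Fin.predAbove_succ_of_le _ _ (not_le.1 h).le⟩

/-- Each generator can be shifted past a new variable, and in a composite the outer map tells where
the inner one has to receive it. This produces the cell of which a given cube is the missing face.
-/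
theorem IsCubeMap.exists_insert {A : Set Bool} {m n : ℕ} {φ : (Fin m → Bool) → (Fin n → Bool)}
    (h : IsCubeMap A φ) : ∀ c : Fin (n + 1), ∃ (p : Fin (m + 1))
      (x : (Fin (m + 1) → Bool) → (Fin (n + 1) → Bool)), IsCubeMap A x ∧ (∀ v, x v c = v p) ∧
        ∀ v, cubeDegen c (x v) = φ (cubeDegen p v) := by
  induction h with
  | id n => exact fun c => ⟨c, _, .id _, fun _ => rfl, fun _ => rfl⟩
  | face i ε =>
    intro c
    have e := Fin.succAbove_succAbove_predAbove c i
    refine ⟨i.predAbove c, _, .face (c.succAbove i) ε, fun v => ?_, fun v => ?_⟩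
    · have := cubeFace_succAbove (c.succAbove i) ε v (i.predAbove c)
      rwa [e] at this
    · ext j
      rcases Fin.eq_self_or_eq_succAbove i j with rfl | ⟨j, rfl⟩
      · simp [cubeDegen]
      · rw [cubeFace_succAbove, cubeDegen, ← Fin.succAbove_succAbove_succAbove_predAbove,
          cubeFace_succAbove, cubeDegen]
  | degen i =>
    intro c
    obtain ⟨p, rfl⟩ := Fin.exists_predAbove_eq i c
    refine ⟨p, _, .degen (p.succAbove i), fun v => ?_, fun v => ?_⟩
    · rw [cubeDegen, Fin.succAbove_succAbove_predAbove]
    · ext j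
      simp only [cubeDegen, Fin.succAbove_succAbove_succAbove_predAbove]
  | @conn n i ε hε =>
    intro c
    -- The new variable goes before or after the two variables merged by the connection; only in the
    -- first case does the index of the connection shift.
    by_cases hc : c ≤ i.castSucc
    · refine ⟨c.castSucc, _, .conn i.succ ε hε, fun v => ?_, fun v => ?_⟩
      · rw [cubeConn_lt (by
          simp only [Fin.lt_def, Fin.le_def, Fin.val_castSucc, Fin.val_succ] at *; omega)]
      · ext j
        simp only [cubeDegen, cubeConn, Fin.succAbove, Fin.lt_def, Fin.ext_iff, Fin.le_def,
          Fin.val_castSucc, Fin.val_succ] at *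
        split_ifs <;>
          first | (exfalso; simp only [Fin.val_castSucc, Fin.val_succ] at *; omega) | rfl
    · refine ⟨c.succ, _, .conn i.castSucc ε hε, fun v => ?_, fun v => ?_⟩
      · rw [cubeConn_gt (not_le.1 hc)]
      · ext j
        simp only [cubeDegen, cubeConn, Fin.succAbove, Fin.lt_def, Fin.ext_iff, Fin.le_def,
          Fin.val_castSucc, Fin.val_succ] at *
        split_ifs <;>
          first | (exfalso; simp only [Fin.val_castSucc, Fin.val_succ] at *; omega) | rfl
  | comp _ _ h₁ h₂ =>
    intro c
    obtain ⟨p', y, hy, hyc, hyd⟩ := h₂ c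
    obtain ⟨p, x, hx, hxc, hxd⟩ := h₁ p'
    exact ⟨p, _, hx.comp hy, fun v => by rw [hyc, hxc], fun v => by rw [hyd, hxd]⟩

/-! ### Degenerate cube maps -/

/-- The maps of `□_A` which factor through a degeneracy or a connection. -/
inductive IsDegenerateMap (A : Set Bool) :
    ∀ {m n : ℕ}, ((Fin m → Bool) → (Fin n → Bool)) → Prop
  | degen {m n : ℕ} (i : Fin (m + 1)) (ψ : (Fin m → Bool) → (Fin n → Bool))
      (hψ : IsCubeMap A ψ) : IsDegenerateMap A fun x => ψ (cubeDegen i x)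
  | conn {m n : ℕ} (i : Fin (m + 1)) (ε : Bool) (hε : ε ∈ A)
      (ψ : (Fin (m + 1) → Bool) → (Fin n → Bool)) (hψ : IsCubeMap A ψ) :
      IsDegenerateMap A fun x => ψ (cubeConn i ε x)

theorem IsDegenerateMap.comp {A : Set Bool} {k m n : ℕ} {f : (Fin k → Bool) → (Fin m → Bool)}
    {g : (Fin m → Bool) → (Fin n → Bool)} (hf : IsDegenerateMap A f) (hg : IsCubeMap A g) :
    IsDegenerateMap A fun x => g (f x) := by
  cases hf with
  | degen i ψ hψ => exact .degen i _ (hψ.comp hg)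
  | conn i ε hε ψ hψ => exact .conn i ε hε _ (hψ.comp hg)

theorem cubeDegen_not_injective {n : ℕ} (i : Fin (n + 1)) :
    ¬ Function.Injective (cubeDegen i) := by
  intro h
  have e : cubeFace i true (fun _ => false) = cubeFace i false (fun _ => false) :=
    h (by rw [cubeDegen_cubeFace, cubeDegen_cubeFace])
  simpa using congrFun e i

theorem cubeConn_not_injective {n : ℕ} (i : Fin (n + 1)) (ε : Bool) :
    ¬ Function.Injective (cubeConn i ε) := by
  intro h
  -- With variable `i` at the absorbing value `!ε`, variable `i + 1` no longer matters.
  have e : (fun _ => !ε) = Function.update (fun _ : Fin (n + 2) => !ε) i.succ ε := by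
    apply h
    ext j
    rcases lt_trichotomy j i with hj | rfl | hj
    · rw [cubeConn_lt hj, cubeConn_lt hj, Function.update_of_ne]
      simp only [Fin.lt_def, Fin.ext_iff, Fin.val_castSucc, Fin.val_succ, ne_eq] at *
      omega
    · rw [cubeConn_same, cubeConn_same, Function.update_of_ne (Fin.castSucc_lt_succ).ne]
      simp
    · rw [cubeConn_gt hj, cubeConn_gt hj, Function.update_of_ne]
      simpa using hj.ne'
  simpa using congrFun e i.succ

theorem IsDegenerateMap.not_injective {A : Set Bool} {m n : ℕ}
    {φ : (Fin m → Bool) → (Fin n → Bool)} (h : IsDegenerateMap A φ) :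
    ¬ Function.Injective φ := by
  cases h with
  | degen i ψ hψ =>
    exact fun h => cubeDegen_not_injective i (Function.Injective.of_comp (f := ψ) h)
  | conn i ε hε ψ hψ =>
    exact fun h => cubeConn_not_injective i ε (Function.Injective.of_comp (f := ψ) h)

theorem IsCubeMap.isDegenerateMap_of_not_isEssential {A : Set Bool} {m n : ℕ}
    {φ : (Fin m → Bool) → (Fin n → Bool)} (h : IsCubeMap A φ) {s : Fin m}
    (hs : ¬ IsEssential φ s) : IsDegenerateMap A φ := by
  obtain _ | m := m
  · exact s.elim0
  have e : φ = fun v => φ (cubeFace s false (cubeDegen s v)) :=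
    funext fun v => (eq_cubeFace_cubeDegen_of_not_isEssential hs _ v).symm
  rw [e]
  exact .degen s _ ((IsCubeMap.face s false).comp h)

/-- The variables `s < t` feeding the two merged coordinates are adjacent: a variable in between
would be used by a coordinate strictly between `i` and `i + 1`. Hence the connection can be moved to
the front: first merge `s` and `s + 1`, then insert the unit `ε` at `s + 1`. -/
theorem isDegenerateMap_cubeConn_comp {A : Set Bool} {m n : ℕ}
    {f : (Fin m → Bool) → (Fin (n + 2) → Bool)} (hf : IsCubeMap A f) (i : Fin (n + 1)) (ε : Bool)
    (hε : ε ∈ A) (hess : ∀ s, IsEssential f s) {s t : Fin m} (hs : ∀ v, f v i.castSucc = v s)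
    (ht : ∀ v, f v i.succ = v t) : IsDegenerateMap A fun v => cubeConn i ε (f v) := by
  have es : IsEssential (fun v => f v i.castSucc) s := by simp only [hs, isEssential_proj]
  have et : IsEssential (fun v => f v i.succ) t := by simp only [ht, isEssential_proj]
  have hst : s < t := hf.ordered (Fin.castSucc_lt_succ) es et
  have hadj : t.val = s.val + 1 := by
    by_contra hne
    have hlt : s.val + 1 < m := by omega
    have h1 : s < (⟨s.val + 1, hlt⟩ : Fin m) := by simp [Fin.lt_def]
    have h2 : (⟨s.val + 1, hlt⟩ : Fin m) < t := by simp only [Fin.lt_def] at *; omega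
    obtain ⟨j, hj⟩ := (hess ⟨s.val + 1, hlt⟩).exists_coord
    rcases lt_trichotomy j i.castSucc with h | h | h
    · exact lt_asymm h1 (hf.ordered h hj es)
    · subst h
      simp only [hs, isEssential_proj] at hj
      exact h1.ne' hj
    rcases lt_trichotomy j i.succ with h' | h' | h'
    · simp only [Fin.lt_def, Fin.val_castSucc, Fin.val_succ] at h h'; omega
    · subst h'
      simp only [ht, isEssential_proj] at hj
      exact h2.ne hj
    · exact lt_asymm h2 (hf.ordered h' et hj)
  obtain _ | _ | m := m
  · exact s.elim0
  · omega
  obtain ⟨s', rfl⟩ : ∃ s' : Fin (m + 1), s = s'.castSucc :=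
    ⟨⟨s.val, by omega⟩, rfl⟩
  obtain rfl : t = s'.succ := by ext; simpa using hadj
  -- Applying `γ_{s',ε}` and then `∂_{s'+1,ε}` changes only the variables `s'` and `s' + 1`, and
  -- preserves the value of the connection on them.
  have agree : ∀ v u, u ≠ s'.castSucc → u ≠ s'.succ →
      cubeFace s'.succ ε (cubeConn s' ε v) u = v u := by
    intro v u h1 h2
    obtain ⟨u, rfl⟩ := Fin.exists_succAbove_eq h2
    rw [cubeFace_succAbove]
    rcases lt_trichotomy u s' with h | h | h
    · rw [cubeConn_lt h, Fin.succAbove_of_castSucc_lt]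
      simp only [Fin.lt_def, Fin.ext_iff, Fin.val_castSucc, Fin.val_succ, ne_eq] at *; omega
    · subst h; exact (h1 (by simp [Fin.succAbove, Fin.lt_def])).elim
    · rw [cubeConn_gt h, Fin.succAbove_of_le_castSucc]
      simp only [Fin.lt_def, Fin.le_def, Fin.ext_iff, Fin.val_castSucc, Fin.val_succ, ne_eq] at *
      omega
  have at_s : ∀ v, cubeFace s'.succ ε (cubeConn s' ε v) s'.castSucc =
      connOp ε (v s'.castSucc) (v s'.succ) := by
    intro v
    have e : s'.castSucc = s'.succ.succAbove s' := by
      rw [Fin.succAbove_of_castSucc_lt _ _ (Fin.castSucc_lt_succ)]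
    conv_lhs => rw [e]
    rw [cubeFace_succAbove, cubeConn_same]
  have other : ∀ a v, a ≠ i.castSucc → a ≠ i.succ →
      f (cubeFace s'.succ ε (cubeConn s' ε v)) a = f v a := by
    intro a v h1 h2
    refine eq_of_agree_on_essential (fun v => f v a) fun u hu => agree v u ?_ ?_
    · rintro rfl; exact h1 (hf.eq_of_isEssential hu es)
    · rintro rfl; exact h2 (hf.eq_of_isEssential hu et)
  have e : (fun v => cubeConn i ε (f v)) = fun v =>
      cubeConn i ε (f (cubeFace s'.succ ε (cubeConn s' ε v))) := by
    ext v j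
    rcases lt_trichotomy j i with h | rfl | h
    · rw [cubeConn_lt h, cubeConn_lt h, other] <;>
        simp only [Fin.lt_def, Fin.ext_iff, Fin.val_castSucc, Fin.val_succ, ne_eq] at * <;> omega
    · rw [cubeConn_same, cubeConn_same, hs, ht, hs, ht, at_s, cubeFace_same, connOp_unit_right]
    · rw [cubeConn_gt h, cubeConn_gt h, other] <;>
        simp only [Fin.lt_def, Fin.ext_iff, Fin.val_castSucc, Fin.val_succ, ne_eq] at * <;> omega
  rw [e]
  exact .conn s' ε hε _ (((IsCubeMap.face s'.succ ε).comp hf).comp (.conn i ε hε))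

/-- The only critical generator is a connection applied to an elementary map using all its
variables. If a merged coordinate is constant, it is the unit or absorbing and the result stays
elementary; if both are projections, `isDegenerateMap_cubeConn_comp` applies. The prefix `f` is
there for the induction; for `f = id` every cube map is seen to be elementary or degenerate. -/
theorem isElementary_or_isDegenerateMap_comp {A : Set Bool} {m n : ℕ}
    {g : (Fin m → Bool) → (Fin n → Bool)} (hg : IsCubeMap A g) :
    ∀ {k : ℕ} {f : (Fin k → Bool) → (Fin m → Bool)}, IsCubeMap A f →
      ((∀ j, IsElementary fun v => f v j) ∨ IsDegenerateMap A f) →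
      ((∀ j, IsElementary fun v => g (f v) j) ∨ IsDegenerateMap A fun v => g (f v)) := by
  induction hg with
  | id n => exact fun _ h => h
  | face i ε =>
    rintro k f hf (h | h)
    · exact Or.inl fun j => ((IsCubeMap.face i ε).isElementary j).comp h
    · exact Or.inr (h.comp (.face i ε))
  | degen i =>
    rintro k f hf (h | h)
    · exact Or.inl fun j => ((IsCubeMap.degen i).isElementary j).comp h
    · exact Or.inr (h.comp (.degen i))
  | comp hg₁ hg₂ h₁ h₂ => exact fun hf h => h₂ (hf.comp hg₁) (h₁ hf h)
  | conn i ε hε =>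
    rintro k f hf (h | h)
    swap
    · exact Or.inr (h.comp (.conn i ε hε))
    by_cases hess : ∃ s, ¬ IsEssential f s
    · obtain ⟨s, hs⟩ := hess
      exact Or.inr ((hf.isDegenerateMap_of_not_isEssential hs).comp (.conn i ε hε))
    push Not at hess
    have key : (IsElementary fun v => connOp ε (f v i.castSucc) (f v i.succ)) →
        ∀ j, IsElementary fun v => cubeConn i ε (f v) j := by
      intro hi j
      rcases lt_trichotomy j i with hj | rfl | hj
      · simpa only [cubeConn_lt hj] using h _
      · simpa only [cubeConn_same] using hi
      · simpa only [cubeConn_gt hj] using h _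
    rcases h i.castSucc with ⟨b, hb⟩ | ⟨s, hs⟩
    · left
      apply key
      simp only [hb]
      rcases Bool.eq_or_eq_not b ε with rfl | rfl
      · simpa using h i.succ
      · exact Or.inl ⟨!ε, by simp⟩
    rcases h i.succ with ⟨b, hb⟩ | ⟨t, ht⟩
    · left
      apply key
      simp only [hb]
      rcases Bool.eq_or_eq_not b ε with rfl | rfl
      · simpa using h i.castSucc
      · exact Or.inl ⟨!ε, by simp⟩
    exact Or.inr (isDegenerateMap_cubeConn_comp hf i ε hε hess hs ht)

theorem IsElementary.eq_proj {m : ℕ} {g : (Fin m → Bool) → Bool} (h : IsElementary g) {s : Fin m}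
    (hs : IsEssential g s) : ∀ v, g v = v s := by
  rcases h with ⟨b, hb⟩ | ⟨t, ht⟩
  · exact (not_isEssential_const hb s hs).elim
  · have e : g = fun v => v t := funext ht
    rw [e, isEssential_proj] at hs
    rwa [hs]

/-- A nondegenerate map is elementary and uses all its variables, each of which appears as a
coordinate, so the argument can be read off from the value. The markings of `□_A^n` thus get a
description that does not mention `A`. -/
theorem IsCubeMap.isDegenerateMap_iff {A : Set Bool} {m n : ℕ}
    {φ : (Fin m → Bool) → (Fin n → Bool)} (h : IsCubeMap A φ) :
    IsDegenerateMap A φ ↔ ¬ Function.Injective φ := by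
  refine ⟨fun h => h.not_injective, fun hi => ?_⟩
  rcases isElementary_or_isDegenerateMap_comp h (.id m)
    (Or.inl fun j => Or.inr ⟨j, fun _ => rfl⟩) with he | hd
  · by_contra hd
    apply hi
    intro v w hvw
    ext s
    by_cases hs : IsEssential φ s
    · obtain ⟨j, hj⟩ := hs.exists_coord
      rw [← (he j).eq_proj hj v, ← (he j).eq_proj hj w, hvw]
    · exact (hd (h.isDegenerateMap_of_not_isEssential hs)).elim
  · exact hd

/-! ### Monotone Boolean functions -/

/-- The value depends on `v s` alone, and monotonicity excludes the negation. -/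
theorem isElementary_of_monotone {m : ℕ} {g : (Fin m → Bool) → Bool} (hg : Monotone g) (s : Fin m)
    (h : ∀ t, IsEssential g t → t = s) : IsElementary g := by
  have e : ∀ v, g v = g fun _ => v s := fun v =>
    eq_of_agree_on_essential g fun t ht => by rw [h t ht]
  have hle : g (fun _ => false) ≤ g (fun _ => true) := hg fun _ => Bool.false_le _
  rcases h0 : g (fun _ => false) with _ | _
  · rcases h1 : g (fun _ => true) with _ | _
    · refine Or.inl ⟨false, fun v => ?_⟩
      rw [e]; cases v s <;> assumption
    · refine Or.inr ⟨s, fun v => ?_⟩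
      rw [e]; cases v s <;> assumption
  · refine Or.inl ⟨true, fun v => ?_⟩
    rw [h0] at hle
    rw [e]; cases v s
    · exact h0
    · exact le_antisymm (Bool.le_true _) hle

theorem eq_of_monotone_of_const {m : ℕ} {g : (Fin m → Bool) → Bool} (hg : Monotone g) (b : Bool)
    {v : Fin m → Bool} (hv : g v = b) : g (fun _ => b) = b := by
  cases b
  · have : g (fun _ => false) ≤ g v := hg fun _ => Bool.false_le _
    rw [hv] at this
    exact le_antisymm this (Bool.false_le _)
  · have : g v ≤ g (fun _ => true) := hg fun _ => Bool.le_true _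
    rw [hv] at this
    exact le_antisymm (Bool.le_true _) this

/-! ### Cube maps using all their variables -/

/-- The range of `σ` is the set of essential variables of the composite, and a strictly increasing
map is determined by its range. -/
theorem eq_of_comp_eq_comp {d m : ℕ} {β : Type*} {ψ : (Fin m → Bool) → β}
    (hψ : ∀ s, IsEssential ψ s) {σ τ : Fin m → Fin d} (hσ : StrictMono σ) (hτ : StrictMono τ)
    (h : ∀ v : Fin d → Bool, ψ (fun j => v (σ j)) = ψ (fun j => v (τ j))) : σ = τ := by
  have key : ∀ {ρ : Fin m → Fin d}, StrictMono ρ →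
      Set.range ρ = {t | IsEssential (fun v : Fin d → Bool => ψ (fun j => v (ρ j))) t} := by
    intro ρ hρ
    ext t
    constructor
    · rintro ⟨u, rfl⟩
      obtain ⟨v, b, hv⟩ := hψ u
      refine ⟨Function.extend ρ v fun _ => false, b, fun e => hv ?_⟩
      have e1 : (fun j => Function.extend ρ v (fun _ => false) (ρ j)) = v :=
        funext fun j => hρ.injective.extend_apply _ _ _
      have e2 : (fun j => Function.update (Function.extend ρ v fun _ => false) (ρ u) b (ρ j)) =
          Function.update v u b := by
        ext j
        by_cases hj : j = u
        · subst hj; simp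
        · rw [Function.update_of_ne (hρ.injective.ne hj), Function.update_of_ne hj,
            hρ.injective.extend_apply]
      simpa only [e1, e2] using e
    · intro ht
      obtain ⟨u, -, hu⟩ := IsEssential.exists_of_comp (f := fun v j => v (ρ j)) (g := ψ) ht
      exact ⟨u, ((isEssential_proj (a := ρ u)).1 hu).symm⟩
  rw [← StrictMono.range_inj hσ hτ, key hσ, key hτ]
  simp only [h]

/-- Inessential variables are dropped one at a time by a degeneracy and put back as `0` by a face.
So every cube is a degeneracy, in `□_∅`, of one of its faces that uses all its variables. -/
theorem IsCubeMap.exists_isEssential_factorization {A : Set Bool} {m n : ℕ}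
    {ψ : (Fin m → Bool) → (Fin n → Bool)} (h : IsCubeMap A ψ) :
    ∃ (d : ℕ) (f : (Fin m → Bool) → (Fin d → Bool)) (g : (Fin d → Bool) → (Fin m → Bool)),
      IsCubeMap ∅ f ∧ IsCubeMap ∅ g ∧ (∀ s, IsEssential (fun v => ψ (g v)) s) ∧
        ∀ v, ψ (g (f v)) = ψ v := by
  induction m with
  | zero => exact ⟨0, _, _, .id _, .id _, fun s => s.elim0, fun _ => rfl⟩
  | succ m ih =>
    by_cases hs : ∀ s, IsEssential ψ s
    · exact ⟨_, _, _, .id _, .id _, hs, fun _ => rfl⟩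
    push Not at hs
    obtain ⟨s, hs⟩ := hs
    obtain ⟨d, f, g, hf, hg, he, hc⟩ := ih ((IsCubeMap.face s false).comp h)
    refine ⟨d, _, _, (IsCubeMap.degen s).comp hf, hg.comp (.face s false), he, fun v => ?_⟩
    rw [hc, eq_cubeFace_cubeDegen_of_not_isEssential hs]

theorem IsCubeMap.exists_coord_eq {m n : ℕ} {g : (Fin m → Bool) → (Fin n → Bool)}
    (h : IsCubeMap ∅ g) {s : Fin m} (hs : IsEssential g s) : ∃ j, ∀ v, g v j = v s := by
  obtain ⟨j, hj⟩ := hs.exists_coord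
  exact ⟨j, (h.isElementary j).eq_proj hj⟩

theorem IsCubeMap.le_of_isEssential {m n : ℕ} {g : (Fin m → Bool) → (Fin n → Bool)}
    (h : IsCubeMap ∅ g) (hs : ∀ s, IsEssential g s) : m ≤ n := by
  choose τ hτ using fun s => h.exists_coord_eq (hs s)
  have hinj : Function.Injective τ := by
    intro s t hst
    have := hτ t (Function.update (fun _ => false) s true)
    rw [← hst, hτ s, Function.update_self] at this
    by_contra hne
    rw [Function.update_of_ne (Ne.symm hne)] at this
    simp at this
  simpa using Fintype.card_le_of_injective τ hinj

theorem strictMono_of_proj {A : Set Bool} {m n : ℕ} {g : (Fin m → Bool) → (Fin n → Bool)}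
    (h : IsCubeMap A g) {σ : Fin n → Fin m} (hσ : ∀ v j, g v j = v (σ j)) : StrictMono σ :=
  fun j j' hj => h.ordered hj (by simp only [hσ, isEssential_proj])
    (by simp only [hσ, isEssential_proj])

theorem IsCubeMap.eq_id_of_proj {m : ℕ} {g : (Fin m → Bool) → (Fin m → Bool)}
    (h : IsCubeMap ∅ g) {σ : Fin m → Fin m} (hσ : ∀ v j, g v j = v (σ j)) : g = fun v => v := by
  have hm := strictMono_of_proj h hσ
  have : σ = _root_.id := by
    apply (StrictMono.range_inj hm strictMono_id).1
    rw [(Finite.surjective_of_injective hm.injective).range_eq, Set.range_id]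
  ext v j
  rw [hσ, this]
  rfl

theorem IsCubeMap.eq_id_of_isEssential {m : ℕ} {g : (Fin m → Bool) → (Fin m → Bool)}
    (h : IsCubeMap ∅ g) (hs : ∀ s, IsEssential g s) : g = fun v => v := by
  have hc : ∀ j, ∃ s, ∀ v, g v j = v s := by
    intro j
    rcases h.isElementary j with ⟨b, hb⟩ | hj
    · exfalso
      obtain _ | m := m
      · exact j.elim0
      -- Deleting a constant coordinate `j` would leave `m + 1` essential variables in `m`
      -- coordinates.
      have h1 := (h.comp (.degen j)).le_of_isEssential fun s => by
        obtain ⟨i, hi⟩ := (hs s).exists_coord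
        have hij : i ≠ j := by
          rintro rfl
          exact not_isEssential_const hb s hi
        obtain ⟨i, rfl⟩ := Fin.exists_succAbove_eq hij
        exact IsEssential.of_coord (j := i) hi
      omega
    · exact hj
  choose σ hσ using hc
  exact h.eq_id_of_proj fun v j => hσ j v

/-- By counting, the coordinates cannot be `m + 1` distinct variables, so one is constant; deleting
it leaves the identity. -/
theorem IsCubeMap.eq_face_of_isEssential {m : ℕ} {g : (Fin m → Bool) → (Fin (m + 1) → Bool)}
    (h : IsCubeMap ∅ g) (hs : ∀ s, IsEssential g s) : ∃ i ε, g = cubeFace i ε := by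
  have hc : ∃ j b, ∀ v, g v j = b := by
    by_contra! hc
    have hp : ∀ j, ∃ s, ∀ v, g v j = v s := fun j => by
      rcases h.isElementary j with ⟨b, hb⟩ | hj
      · obtain ⟨v, hv⟩ := hc j b
        exact (hv (hb v)).elim
      · exact hj
    choose σ hσ using hp
    have := Fintype.card_le_of_injective σ (strictMono_of_proj h fun v j => hσ j v).injective
    simp at this
  obtain ⟨j, b, hb⟩ := hc
  have e := (h.comp (.degen j)).eq_id_of_isEssential fun s => by
    obtain ⟨i, hi⟩ := (hs s).exists_coord
    have hij : i ≠ j := by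
      rintro rfl
      exact not_isEssential_const hb s hi
    obtain ⟨i, rfl⟩ := Fin.exists_succAbove_eq hij
    exact IsEssential.of_coord (j := i) hi
  refine ⟨j, b, funext fun v => ?_⟩
  rw [← cubeFace_cubeDegen_of_eq (hb v)]
  exact congrArg _ (congrFun e v)

/-! ### Uniqueness of inserted variables -/

/-- The variable `p` is used up by the coordinate `c`, so no other coordinate depends on it. -/
theorem cubeDegen_eq_of_insert {A : Set Bool} {m n : ℕ}
    {x : (Fin (m + 1) → Bool) → (Fin (n + 1) → Bool)} (hx : IsCubeMap A x) {c : Fin (n + 1)}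
    {p : Fin (m + 1)} (hc : ∀ v, x v c = v p) (b : Bool) (v : Fin (m + 1) → Bool) :
    cubeDegen c (x v) = cubeDegen c (x (cubeFace p b (cubeDegen p v))) := by
  ext j
  refine (eq_cubeFace_cubeDegen_of_not_isEssential (g := fun v => x v (c.succAbove j))
    (fun h => ?_) b v).symm
  exact Fin.succAbove_ne c j (hx.eq_of_isEssential h (by simp only [hc, isEssential_proj]))

/-- If `p < p'`, the variable number `p` of the common face is the variable `p + 1` of `x`, but the
variable `p` of `x'`. By the ordering of variables, a coordinate depending on it would lie at or
after `c` on account of `x`, and before `c` on account of `x'`. -/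
theorem insert_position_not_lt {A : Set Bool} {m n : ℕ}
    {x x' : (Fin (m + 1) → Bool) → (Fin (n + 1) → Bool)} (hx : IsCubeMap A x)
    (hx' : IsCubeMap A x') {c : Fin (n + 1)} {p p' : Fin (m + 1)} (hc : ∀ v, x v c = v p)
    (hc' : ∀ v, x' v c = v p') {b : Bool} (h : ∀ v, x (cubeFace p b v) = x' (cubeFace p' b v))
    (hy : ∀ s, IsEssential (fun v => x (cubeFace p b v)) s) : ¬ p < p' := by
  intro hlt
  have hess : ∀ {x : (Fin (m + 1) → Bool) → (Fin (n + 1) → Bool)} {p : Fin (m + 1)} {t : Fin m}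
      {j : Fin (n + 1)}, IsEssential (fun v => x (cubeFace p b v) j) t →
        IsEssential (fun v => x v j) (p.succAbove t) := by
    intro x p t j ht
    obtain ⟨u, hu, hu'⟩ := IsEssential.exists_of_comp (g := fun v => x v j) ht
    rcases Fin.eq_self_or_eq_succAbove p u with rfl | ⟨u, rfl⟩
    · exact (not_isEssential_const (b := b) (by simp) _ hu').elim
    · simp only [cubeFace_succAbove, isEssential_proj] at hu'
      rwa [hu']
  have hpm : p.val < m := by omega
  obtain ⟨j, hj⟩ := (hy ⟨p.val, hpm⟩).exists_coord
  have hj' := hj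
  simp only [h] at hj'
  have h1 := hess hj
  have h2 := hess hj'
  have ep : IsEssential (fun v => x v c) p := by simp only [hc, isEssential_proj]
  have ep' : IsEssential (fun v => x' v c) p' := by simp only [hc', isEssential_proj]
  rw [Fin.succAbove_of_le_castSucc _ _
    (by simp only [Fin.le_def, Fin.val_castSucc]; exact le_refl _)] at h1
  rw [Fin.succAbove_of_castSucc_lt _ _ (by exact hlt)] at h2
  rcases lt_trichotomy j c with hjc | rfl | hjc
  · have := hx.ordered hjc h1 ep
    simp only [Fin.lt_def, Fin.val_succ] at this
    omega
  · simp only [hc', isEssential_proj] at h2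
    rw [← h2] at hlt
    exact lt_irrefl _ hlt
  · have := hx'.ordered hjc ep' h2
    simp only [Fin.lt_def, Fin.val_castSucc] at this hlt
    omega

/-- The face determines the position of the inserted variable, and then all coordinates other than
`c`. Hence distinct cells have distinct missing faces. -/
theorem eq_of_insert {A : Set Bool} {m n : ℕ}
    {x x' : (Fin (m + 1) → Bool) → (Fin (n + 1) → Bool)} (hx : IsCubeMap A x)
    (hx' : IsCubeMap A x') {c : Fin (n + 1)} {p p' : Fin (m + 1)} (hc : ∀ v, x v c = v p)
    (hc' : ∀ v, x' v c = v p') {b : Bool} (h : ∀ v, x (cubeFace p b v) = x' (cubeFace p' b v))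
    (hy : ∀ s, IsEssential (fun v => x (cubeFace p b v)) s) : x = x' := by
  obtain rfl : p = p' := le_antisymm
    (not_lt.1 (insert_position_not_lt hx' hx hc' hc (fun v => (h v).symm)
      (by simpa only [h] using hy)))
    (not_lt.1 (insert_position_not_lt hx hx' hc hc' h hy))
  ext v j
  rcases Fin.eq_self_or_eq_succAbove c j with rfl | ⟨j, rfl⟩
  · rw [hc, hc']
  · have := cubeDegen_eq_of_insert hx hc b v
    rw [h, ← cubeDegen_eq_of_insert hx' hc' b v] at this
    exact congrFun this j

/-! ### Pushouts and unions of marked cubical sets -/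

namespace MarkedCubicalSet

variable {A : Set Bool}

theorem isPushout_of_isPushout_map {I P Q T : MarkedCubicalSet A} {t : I ⟶ P} {l : I ⟶ Q}
    {r : P ⟶ T} {b : Q ⟶ T} (h : IsPushout t.map l.map r.map b.map)
    (hmark : ∀ (c : CubeCat A) (x : T.cubes.obj (op c)), x ∈ T.marked c →
      T.cubes.IsDegenerate x ∨ (∃ y ∈ P.marked c, r.map.app (op c) y = x) ∨
        ∃ y ∈ Q.marked c, b.map.app (op c) y = x) :
    IsPushout t l r b where
  w := by ext1; exact h.w
  isColimit' := ⟨PushoutCocone.IsColimit.mk _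
    (fun s =>
      { map := h.desc s.inl.map s.inr.map (congrArg Hom.map s.condition)
        marked := by
          intro c x hx
          rcases hmark c x hx with hx | ⟨y, hy, rfl⟩ | ⟨y, hy, rfl⟩
          · exact s.pt.degenerate (hx.app _)
          · have := s.inl.marked hy
            rwa [← h.inl_desc s.inl.map s.inr.map (congrArg Hom.map s.condition)] at this
          · have := s.inr.marked hy
            rwa [← h.inr_desc s.inl.map s.inr.map (congrArg Hom.map s.condition)] at this })
    (fun s => by ext1; exact h.inl_desc _ _ _)
    (fun s => by ext1; exact h.inr_desc _ _ _)
    (fun s m h₁ h₂ => by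
      ext1
      exact h.hom_ext ((congrArg Hom.map h₁).trans (h.inl_desc _ _ _).symm)
        ((congrArg Hom.map h₂).trans (h.inr_desc _ _ _).symm))⟩

/-- In each dimension this is the gluing criterion for sets: a pullback square with `r` and `l`
injective, jointly covering `T`. Injectivity of `b` is asked for only outside the image of `l`,
since the attaching map of an open box need not be injective. -/
theorem isPushout_of_cover {I P Q T : MarkedCubicalSet A} {t : I ⟶ P} {l : I ⟶ Q}
    {r : P ⟶ T} {b : Q ⟶ T} (w : t ≫ r = l ≫ b)
    (hl : ∀ c, Function.Injective (l.map.app (op c)))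
    (hr : ∀ c, Function.Injective (r.map.app (op c)))
    (hcov : ∀ c (x : T.cubes.obj (op c)),
      (∃ y, r.map.app (op c) y = x) ∨ ∃ y, b.map.app (op c) y = x)
    (hpb : ∀ c y z, r.map.app (op c) y = b.map.app (op c) z → ∃ i, l.map.app (op c) i = z)
    (hinj : ∀ c y z, (¬ ∃ i, l.map.app (op c) i = y) → (¬ ∃ i, l.map.app (op c) i = z) →
      b.map.app (op c) y = b.map.app (op c) z → y = z)
    (hmark : ∀ (c : CubeCat A) (x : T.cubes.obj (op c)), x ∈ T.marked c →
      T.cubes.IsDegenerate x ∨ (∃ y ∈ P.marked c, r.map.app (op c) y = x) ∨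
        ∃ y ∈ Q.marked c, b.map.app (op c) y = x) :
    IsPushout t l r b := by
  refine isPushout_of_isPushout_map (IsPushout.of_forall_isPushout_app fun c => ?_) hmark
  have hw : ∀ i, r.map.app c (t.map.app c i) = b.map.app c (l.map.app c i) := fun i =>
    ConcreteCategory.congr_hom (congrArg (fun f : I ⟶ T => f.map.app c) w) i
  have : Mono (r.map.app c) := (mono_iff_injective _).2 (hr c.unop)
  refine Types.isPushout_of_isPullback_of_mono' ((Types.isPullback_iff _ _ _ _).2
    ⟨congrArg (fun f : I ⟶ T => f.map.app c) w, fun i j h => hl c.unop h.2, fun y z h => ?_⟩)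
    ?_ (hinj c.unop)
  · obtain ⟨i, hi⟩ := hpb c.unop y z h
    refine ⟨i, hr c.unop ?_, hi⟩
    rw [h, ← hi]
    exact hw i
  · ext x
    simpa using hcov c.unop x

/-- The inclusion of regular subcomplexes. -/
def regularHomOfLE (X : MarkedCubicalSet A) {S T : Subfunctor X.cubes} (h : S ≤ T) :
    X.regular S ⟶ X.regular T where
  map := Subfunctor.homOfLe h
  marked hx := hx

/-- A map of marked cubical sets which is bijective on cubes and on marked cubes is an
isomorphism. -/
theorem isIso_of_isIso_map {X Y : MarkedCubicalSet A} (f : X ⟶ Y) [IsIso f.map]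
    (h : ∀ (c : CubeCat A) (x : X.cubes.obj (op c)),
      f.map.app (op c) x ∈ Y.marked c → x ∈ X.marked c) : IsIso f := by
  refine ⟨⟨{ map := inv f.map, marked := fun {c y} hy => h c _ ?_ }, ?_, ?_⟩⟩
  · have e : f.map.app (op c) ((inv f.map).app (op c) y) = y :=
      ConcreteCategory.congr_hom (congr_app (IsIso.inv_hom_id f.map) (op c)) y
    rwa [e]
  · ext1; exact IsIso.hom_inv_id f.map
  · ext1; exact IsIso.inv_hom_id f.map

/-! ### Unions of increasing sequences of regular subcomplexes. -/

section Chain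

variable (X : MarkedCubicalSet A)

/-- Regular subcomplexes as a functor. -/
def regularFunctor : Subfunctor X.cubes ⥤ MarkedCubicalSet A where
  obj S := X.regular S
  map f := X.regularHomOfLE (leOfHom f)

variable {X} {F : ℕ → Subfunctor X.cubes} (hF : Monotone F) {T : Subfunctor X.cubes}
  (hT : T = ⨆ i, F i)

include hT in
theorem exists_mem_of_eq_iSup {c : (CubeCat A)ᵒᵖ} (x : T.toFunctor.obj c) :
    ∃ i, x.1 ∈ (F i).obj c := by
  have := hT.le c x.2
  rwa [Subfunctor.iSup_obj, Set.mem_iUnion] at this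

/-- The union of an increasing sequence of regular subcomplexes as a cocone. -/
def chainCocone : Cocone (hF.functor ⋙ X.regularFunctor) where
  pt := X.regular T
  ι :=
    { app i := X.regularHomOfLE (hT ▸ le_iSup F i)
      naturality _ _ _ := rfl }

theorem chain_app_eq (s : Cocone (hF.functor ⋙ X.regularFunctor)) {c : (CubeCat A)ᵒᵖ} {i j : ℕ}
    {x : X.cubes.obj c} (hi : x ∈ (F i).obj c) (hj : x ∈ (F j).obj c) :
    (s.ι.app i).map.app c ⟨x, hi⟩ = (s.ι.app j).map.app c ⟨x, hj⟩ := by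
  wlog h : i ≤ j
  · exact (this hF s hj hi (le_of_not_ge h)).symm
  rw [← s.w (homOfLE h)]
  rfl

/-- The union of an increasing sequence of regular subcomplexes is a colimit. -/
noncomputable def chainCoconeIsColimit : IsColimit (chainCocone hF hT) where
  desc s :=
    { map :=
        { app c := ↾fun x : T.toFunctor.obj c =>
            (s.ι.app (exists_mem_of_eq_iSup hT x).choose).map.app c
              ⟨x.1, (exists_mem_of_eq_iSup hT x).choose_spec⟩
          naturality c d f := by
            ext x
            have hx := (exists_mem_of_eq_iSup hT x).choose_spec
            exact (chain_app_eq hF s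
                (exists_mem_of_eq_iSup hT (T.toFunctor.map f x)).choose_spec
                ((F _).map f hx)).trans
              (NatTrans.naturality_apply (s.ι.app _).map f ⟨x.1, hx⟩) }
      marked := by
        intro c x hx
        exact (s.ι.app (exists_mem_of_eq_iSup hT x).choose).marked
          (x := ⟨x.1, (exists_mem_of_eq_iSup hT x).choose_spec⟩) hx }
  fac s i := by
    ext1
    ext c x
    exact chain_app_eq hF s _ _
  uniq s m hm := by
    ext1
    ext c x
    have hx := (exists_mem_of_eq_iSup hT x).choose_spec
    exact ConcreteCategory.congr_hom
      (congrArg (fun f => Hom.map f) (hm (exists_mem_of_eq_iSup hT x).choose) ▸ rfl :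
        ((chainCocone hF hT).ι.app _ ≫ m).map.app c = (s.ι.app _).map.app c)
      (⟨x.1, hx⟩ : (F _).toFunctor.obj c)

end Chain

theorem mem_of_chain (W : MorphismProperty (MarkedCubicalSet A))
    [MorphismProperty.IsStableUnderTransfiniteComposition.{0} W] {X : MarkedCubicalSet A}
    {F : ℕ → Subfunctor X.cubes} (hF : Monotone F) {T : Subfunctor X.cubes} (hT : T = ⨆ i, F i)
    (h : ∀ i, W (X.regularHomOfLE (hF (Nat.le_succ i)))) (h0 : F 0 ≤ T) :
    W (X.regularHomOfLE h0) := by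
  refine W.transfiniteCompositionsOfShape_le ℕ _
    ⟨{ F := hF.functor ⋙ X.regularFunctor
       isoBot := Iso.refl _
       incl := (chainCocone hF hT).ι
       isColimit := chainCoconeIsColimit hF hT
       fac := by ext1; rfl
       map_mem i _ := h i }⟩

/-! ### Cubes outside of an open box -/

theorem mem_faceUnion_of_coord {n : ℕ} {P : Fin n → Bool → Prop} {c : CubeCat A}
    {f : c ⟶ (⟨n⟩ : CubeCat A)} {j : Fin n} {ε : Bool} (hP : P j ε) (h : ∀ v, f.1 v j = ε) :
    f ∈ (faceUnion A n P).obj (op c) := by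
  obtain _ | n := n
  · exact j.elim0
  · exact ⟨j, ε, f ≫ CubeCat.degen j, hP,
      Subtype.ext (funext fun v => (cubeFace_cubeDegen_of_eq (h v)).symm)⟩

theorem mem_faceUnion_iff {n : ℕ} {P : Fin n → Bool → Prop} {c : CubeCat A}
    {f : c ⟶ (⟨n⟩ : CubeCat A)} :
    f ∈ (faceUnion A n P).obj (op c) ↔ ∃ j ε, P j ε ∧ ∀ v, f.1 v j = ε := by
  constructor
  · intro h
    obtain _ | n := n
    · exact h.elim
    · obtain ⟨j, ε, ψ, hP, rfl⟩ := h
      exact ⟨j, ε, hP, fun v => cubeFace_same _ _ _⟩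
  · rintro ⟨j, ε, hP, h⟩
    exact mem_faceUnion_of_coord hP h

end MarkedCubicalSet

/-- A map to the cube which does not factor through the open box `(p, b)` either forgets some
coordinates, or forgets some coordinates and then applies the face `∂_{p,b}`. -/
theorem IsCubeMap.eq_proj_or_face {d m : ℕ} {f : (Fin d → Bool) → (Fin (m + 1) → Bool)}
    (hf : IsCubeMap ∅ f) {p : Fin (m + 1)} {b : Bool}
    (h : ¬ ∃ j ε, (j, ε) ≠ (p, b) ∧ ∀ v, f v j = ε) :
    (∃ σ : Fin (m + 1) → Fin d, StrictMono σ ∧ ∀ v, f v = fun j => v (σ j)) ∨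
      ∃ σ : Fin m → Fin d, StrictMono σ ∧ ∀ v, f v = cubeFace p b fun j => v (σ j) := by
  have hne : ∀ j, j ≠ p → ∃ s, ∀ v, f v j = v s := fun j hj => by
    rcases hf.isElementary j with ⟨ε, hε⟩ | hs
    · exact (h ⟨j, ε, fun e => hj (congrArg Prod.fst e), hε⟩).elim
    · exact hs
  rcases hf.isElementary p with ⟨ε, hε⟩ | hp
  · right
    obtain rfl : ε = b := by
      by_contra hb
      exact h ⟨p, ε, fun e => hb (congrArg Prod.snd e), hε⟩
    choose σ hσ using fun j : Fin m => hne (p.succAbove j) (Fin.succAbove_ne p j)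
    refine ⟨σ, strictMono_of_proj (hf.comp (.degen p)) fun v j => hσ j v, fun v => ?_⟩
    rw [← cubeFace_cubeDegen_of_eq (hε v)]
    exact congrArg _ (funext fun j => hσ j v)
  · left
    choose σ hσ using fun j => (em (j = p)).elim (fun e => e ▸ hp) (hne j)
    exact ⟨σ, strictMono_of_proj hf fun v j => hσ j v, fun v => funext fun j => hσ j v⟩

theorem StrictMono.eq_id_of_surjective {m : ℕ} {σ : Fin m → Fin m} (h : StrictMono σ) :
    σ = _root_.id := by
  apply (StrictMono.range_inj h strictMono_id).1
  rw [(Finite.surjective_of_injective h.injective).range_eq, Set.range_id]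

theorem surjective_of_isEssential_proj {d m : ℕ} {σ : Fin m → Fin d}
    (h : ∀ s, IsEssential (fun (v : Fin d → Bool) j => v (σ j)) s) : Function.Surjective σ :=
  fun s => by
    obtain ⟨j, hj⟩ := (h s).exists_coord
    exact ⟨j, (isEssential_proj.1 hj).symm⟩

/-! ### Attaching a comical cube along an open box -/

namespace MarkedCubicalSet

/-- The underlying map of a cube of the standard cube. -/
def cubeFun {A : Set Bool} {c d : CubeCat A} (f : (yoneda.obj d).obj (op c)) :
    (Fin c.dim → Bool) → (Fin d.dim → Bool) :=
  Subtype.val (p := IsCubeMap A) f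

theorem isDegenerateMap_of_isDegenerate {A : Set Bool} {c d : CubeCat A}
    {f : (yoneda.obj d).obj (op c)} (h : CubicalSet.IsDegenerate (yoneda.obj d) f) :
    IsDegenerateMap A (cubeFun f) := by
  cases h with
  | degen i y => exact .degen i y.1 y.2
  | conn i ε hε y => exact .conn i ε hε y.1 y.2

theorem isDegenerate_iff_isDegenerateMap {A : Set Bool} {c d : CubeCat A} (f : c ⟶ d) :
    CubicalSet.IsDegenerate (yoneda.obj d) (c := c) f ↔ IsDegenerateMap A f.1 := by
  refine ⟨isDegenerateMap_of_isDegenerate, ?_⟩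
  obtain ⟨m⟩ := c
  obtain ⟨n⟩ := d
  obtain ⟨f, hf⟩ := f
  intro h
  cases h with
  | degen i ψ hψ =>
    exact .degen (X := yoneda.obj (⟨n⟩ : CubeCat A)) i (⟨ψ, hψ⟩ : (⟨_⟩ : CubeCat A) ⟶ ⟨n⟩)
  | conn i ε hε ψ hψ =>
    exact .conn (X := yoneda.obj (⟨n⟩ : CubeCat A)) i ε hε
      (⟨ψ, hψ⟩ : (⟨_⟩ : CubeCat A) ⟶ ⟨n⟩)

theorem isDegenerate_map {A : Set Bool} {X : CubicalSet A} {c d : CubeCat A} (f : c ⟶ d)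
    (h : IsDegenerateMap A f.1) (x : X.obj (op d)) :
    X.IsDegenerate (c := c) (X.map f.op x) := by
  have := ((isDegenerate_iff_isDegenerateMap f).2 h).app (yonedaEquiv.symm x)
  exact this

theorem isDegenerateMap_of_not_forall_isEssential {d n : ℕ}
    {f : (⟨d⟩ : CubeCat ∅) ⟶ ⟨n⟩} (h : ¬ IsDegenerateMap ∅ f.1) (s : Fin d) :
    IsEssential f.1 s := by
  by_contra hs
  exact h (f.2.isDegenerateMap_of_not_isEssential hs)

/-- The subcomplex of the `(m+1)`-cube underlying the open box `(p, b)`. -/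
abbrev boxSub (m : ℕ) (p : Fin (m + 1)) (b : Bool) :
    Subfunctor (yoneda.obj (⟨m + 1⟩ : CubeCat ∅)) :=
  faceUnion ∅ (m + 1) fun j ε' => (j, ε') ≠ (p, b)

/-- Outside of the open box, a cube of the standard cube is degenerate, the interior, or the
missing face. -/
theorem cases_of_not_mem_boxSub {m : ℕ} {p : Fin (m + 1)} {b : Bool} {d : ℕ}
    {f : (⟨d⟩ : CubeCat ∅) ⟶ ⟨m + 1⟩} (hf : f ∉ (boxSub m p b).obj (op ⟨d⟩))
    (hd : ¬ IsDegenerateMap ∅ f.1) :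
    (d = m + 1 ∧ ∀ v, HEq (f.1 v) v) ∨
      ∃ h : d = m, h ▸ f = (CubeCat.face p b : (⟨m⟩ : CubeCat ∅) ⟶ ⟨m + 1⟩) := by
  have hs := isDegenerateMap_of_not_forall_isEssential hd
  rw [mem_faceUnion_iff] at hf
  have hle := f.2.le_of_isEssential hs
  dsimp at hle
  rcases f.2.eq_proj_or_face hf with ⟨σ, hσ, h⟩ | ⟨σ, hσ, h⟩
  · left
    have h1 := Fintype.card_le_of_injective σ hσ.injective
    simp at h1
    obtain rfl : d = m + 1 := le_antisymm hle h1
    refine ⟨rfl, fun v => heq_of_eq ?_⟩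
    rw [h, hσ.eq_id_of_surjective]
    rfl
  · right
    have h1 := Fintype.card_le_of_injective σ hσ.injective
    have hsurj : Function.Surjective σ := surjective_of_isEssential_proj fun s => by
      have : IsEssential (fun v => cubeFace p b fun j => v (σ j)) s := by
        simpa only [← h] using hs s
      exact ((IsEssential.exists_of_comp (f := fun v j => v (σ j)) (g := cubeFace p b) this).elim
        fun u hu => IsEssential.of_coord (φ := fun (v : Fin d → Bool) j => v (σ j)) hu.2)
    have h2 := Fintype.card_le_of_surjective σ hsurj
    simp at h1 h2
    obtain rfl : d = m := le_antisymm h2 h1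
    refine ⟨rfl, Subtype.ext (funext fun v => ?_)⟩
    rw [hσ.eq_id_of_surjective] at h
    exact h v

section Attach

variable {X : MarkedCubicalSet ∅} {S : Subfunctor X.cubes} {m : ℕ}
  {x : X.cubes.obj (op ⟨m + 1⟩)} {p : Fin (m + 1)} {b : Bool}

/-- The data making `x` a comical cube of `X` whose intersection with `S` is the open box
`(p, b)`. -/
structure IsComicalCell (S : Subfunctor X.cubes) (x : X.cubes.obj (op ⟨m + 1⟩))
    (p : Fin (m + 1)) (b : Bool) : Prop where
  mem_iff : ∀ {c : CubeCat ∅} (f : c ⟶ ⟨m + 1⟩),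
    X.cubes.map f.op x ∈ S.obj (op c) ↔ f ∈ (boxSub m p b).obj (op c)
  inj : ∀ {c : CubeCat ∅} (f g : c ⟶ ⟨m + 1⟩), f ∉ (boxSub m p b).obj (op c) →
    g ∉ (boxSub m p b).obj (op c) → X.cubes.map f.op x = X.cubes.map g.op x → f = g
  critical : ∀ {c : CubeCat ∅} (f : c ⟶ ⟨m + 1⟩), CubeCat.IsCritical p b f → 0 < c.dim →
    X.cubes.map f.op x ∈ X.marked c
  faces : X.cubes.map (CubeCat.face p b).op x ∈ X.marked ⟨m⟩ →
    ∀ j ε, (j, ε) ≠ (p, b) → X.cubes.map (CubeCat.face j ε).op x ∈ X.marked ⟨m⟩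

/-- The subcomplex `S ∪ ⟨x⟩`, in which new cubes are marked only if they are degenerate or
critical faces of `x`. -/
def attachBox (S : Subfunctor X.cubes) (x : X.cubes.obj (op ⟨m + 1⟩)) (p : Fin (m + 1))
    (b : Bool) : MarkedCubicalSet ∅ :=
  ofMarks (S ⊔ Subfunctor.ofSection x).toFunctor fun c =>
    {t | t.1 ∈ X.marked c ∧ (t.1 ∈ S.obj (op c) ∨
      ∃ f : c ⟶ ⟨m + 1⟩, CubeCat.IsCritical p b f ∧ X.cubes.map f.op x = t.1)}

/-- The inclusion of `S`. -/
def attachBoxInl (S : Subfunctor X.cubes) (x : X.cubes.obj (op ⟨m + 1⟩)) (p : Fin (m + 1))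
    (b : Bool) : X.regular S ⟶ attachBox S x p b where
  map := Subfunctor.homOfLe le_sup_left
  marked {_ t} ht := Or.inr ⟨X.pos ht, ht, Or.inl t.2⟩

/-- The map to `S ∪ ⟨x⟩` classifying `x`. -/
def cellMap (S : Subfunctor X.cubes) (x : X.cubes.obj (op ⟨m + 1⟩)) :
    yoneda.obj (⟨m + 1⟩ : CubeCat ∅) ⟶ (S ⊔ Subfunctor.ofSection x).toFunctor :=
  yonedaEquiv.symm ⟨x, Or.inr (Subfunctor.mem_ofSection_obj x)⟩

/-- Comparison of the two markings on `S ∪ ⟨x⟩`. -/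
def attachBoxToRegular (S : Subfunctor X.cubes) (x : X.cubes.obj (op ⟨m + 1⟩)) (p : Fin (m + 1))
    (b : Bool) : attachBox S x p b ⟶ X.regular (S ⊔ Subfunctor.ofSection x) where
  map := 𝟙 _
  marked {c t} ht := by
    rcases ht with ht | ⟨_, ht, _⟩
    · exact X.degenerate (ht.app (Subfunctor.ι _))
    · exact ht

namespace IsComicalCell

/-- The comical cube attached to `S`. -/
def boxInr (h : IsComicalCell S x p b) : comicalCube ∅ (m + 1) p b ⟶ attachBox S x p b where
  map := cellMap S x
  marked {c f} hf := by
    rcases hf with hf | ⟨hc, hf⟩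
    · exact Or.inl (hf.app _)
    · exact Or.inr ⟨hc, h.critical f hf hc, Or.inr ⟨f, hf, rfl⟩⟩

/-- The attaching map of the open box. -/
def boxTop (h : IsComicalCell S x p b) : comicalBox ∅ (m + 1) p b ⟶ X.regular S where
  map :=
    { app c := ↾fun f => ⟨X.cubes.map f.1.op x, (h.mem_iff f.1).2 f.2⟩
      naturality c d g := by
        ext f
        apply Subtype.ext
        exact X.cubes.map_comp_apply f.1.op g x }
  marked {c f} hf := by
    rcases hf with hf | ⟨hc, hf⟩
    · exact X.degenerate (hf.app (yonedaEquiv.symm x))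
    · exact h.critical f.1 hf hc

/-- `mem_iff` says which cubes of the cell lie in `S`, and `inj` that no further cubes are
identified. -/
theorem isPushout_box (h : IsComicalCell S x p b) :
    IsPushout h.boxTop (comicalBoxι ∅ (m + 1) p b) (attachBoxInl S x p b) h.boxInr := by
  refine isPushout_of_cover rfl (fun c => Subtype.val_injective)
    (fun c y z e => Subtype.ext
      (congrArg (fun t : (S ⊔ Subfunctor.ofSection x).toFunctor.obj (op c) => t.1) e)) ?_ ?_ ?_ ?_
  · rintro c ⟨t, ht | ⟨f, rfl⟩⟩
    · exact Or.inl ⟨⟨t, ht⟩, rfl⟩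
    · exact Or.inr ⟨f.unop, rfl⟩
  · intro c y z e
    refine ⟨⟨z, (h.mem_iff z).1 ?_⟩, rfl⟩
    have e' : y.1 = X.cubes.map (Quiver.Hom.op z) x := Subtype.ext_iff.1 e
    exact e' ▸ y.2
  · intro c y z hy hz e
    exact h.inj y z (fun hy' => hy ⟨⟨y, hy'⟩, rfl⟩) (fun hz' => hz ⟨⟨z, hz'⟩, rfl⟩)
      (congrArg Subtype.val e)
  · rintro c t (ht | ⟨hc, ht, ht' | ⟨f, hf, e⟩⟩)
    · exact Or.inl ht
    · exact Or.inr (Or.inl ⟨⟨t.1, ht'⟩, ht, rfl⟩)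
    · exact Or.inr (Or.inr ⟨f, Or.inr ⟨hc, hf⟩, Subtype.ext e⟩)

/-- The identity has no constant coordinate, so every condition on face maps holds vacuously: the
interior of a comical cube is marked. -/
theorem isCritical_of_heq {d : ℕ} {f : (⟨d⟩ : CubeCat ∅) ⟶ ⟨m + 1⟩} (hd : d = m + 1)
    (hf : ∀ v, HEq (f.1 v) v) : CubeCat.IsCritical p b f := by
  subst hd
  obtain rfl : f = 𝟙 _ := Subtype.ext (funext fun v => eq_of_heq (hf v))
  have key : ∀ (j : Fin (m + 1)) (ε : Bool),
      ¬ CubeCat.HasFace (𝟙 (⟨m + 1⟩ : CubeCat ∅)) j ε := by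
    intro j ε hj
    have : (!ε) = ε := hj fun _ => !ε
    simp at this
  exact ⟨inferInstance, fun hh => hh.elim (key _ _) (key _ _), fun ⟨j, _, hj, _⟩ => key _ _ hj,
    fun ⟨j, _, hj, _⟩ => key _ _ hj⟩

/-- Outside of the open box there are only degenerate cubes, the interior and the missing face; of
these only the missing face can lack its mark in `attachBox`. -/
theorem marked_cases (h : IsComicalCell S x p b) {c : CubeCat ∅}
    (t : (X.regular (S ⊔ Subfunctor.ofSection x)).cubes.obj (op c))
    (ht : t ∈ (X.regular (S ⊔ Subfunctor.ofSection x)).marked c) :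
    t ∈ (attachBox S x p b).marked c ∨ (c.dim = m ∧
      X.cubes.map (CubeCat.face p b).op x ∈ X.marked ⟨m⟩ ∧
        ∃ f : c ⟶ ⟨m + 1⟩, (cellMap S x).app (op c) f = t) := by
  obtain ⟨d⟩ := c
  obtain ⟨t, ht' | ⟨f, rfl⟩⟩ := t
  · exact Or.inl (Or.inr ⟨X.pos ht, ht, Or.inl ht'⟩)
  obtain ⟨f, rfl⟩ : ∃ g : (⟨d⟩ : CubeCat ∅) ⟶ ⟨m + 1⟩, f = g.op := ⟨f.unop, rfl⟩
  by_cases hb : f ∈ (boxSub m p b).obj (op ⟨d⟩)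
  · exact Or.inl (Or.inr ⟨X.pos ht, ht, Or.inl ((h.mem_iff f).2 hb)⟩)
  by_cases hd : IsDegenerateMap ∅ f.1
  · have := ((isDegenerate_iff_isDegenerateMap f).2 hd).app (cellMap S x)
    exact Or.inl (Or.inl this)
  rcases cases_of_not_mem_boxSub hb hd with ⟨hd, hf⟩ | ⟨rfl, hf⟩
  · exact Or.inl (Or.inr ⟨X.pos ht, ht, Or.inr ⟨f, isCritical_of_heq hd hf, rfl⟩⟩)
  · have hf : f = CubeCat.face p b := hf
    subst hf
    exact Or.inr ⟨rfl, ht, _, rfl⟩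

end IsComicalCell

end Attach

variable (W : MorphismProperty (MarkedCubicalSet ∅)) [W.IsStableUnderCobaseChange]
  [MorphismProperty.IsStableUnderTransfiniteComposition.{0} W]

/-- If the missing face is unmarked in `X`, the two markings agree. Otherwise `faces` shows that the
other codimension one faces are marked, and the missing mark is added by a pushout of a comical
marking extension. -/
theorem IsComicalCell.mem_attachBoxToRegular (hW : comicalGenerators ∅ ≤ W) {X : MarkedCubicalSet ∅}
    {S : Subfunctor X.cubes} {m : ℕ} {x : X.cubes.obj (op ⟨m + 1⟩)} {p : Fin (m + 1)} {b : Bool}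
    (h : IsComicalCell S x p b) : W (attachBoxToRegular S x p b) := by
  by_cases hy : X.cubes.map (CubeCat.face p b).op x ∈ X.marked ⟨m⟩
  swap
  · have : IsIso (attachBoxToRegular S x p b).map := inferInstanceAs (IsIso (𝟙 _))
    have : IsIso (attachBoxToRegular S x p b) := isIso_of_isIso_map _ fun c t ht =>
      (h.marked_cases t ht).resolve_right fun hh => hy hh.2.1
    exact W.of_isIso _
  -- For `m = 0` the missing face is a vertex, which is never marked.
  obtain _ | m := m
  · exact (X.pos hy).ne rfl |>.elim
  let top : ofMarks (yoneda.obj (⟨m + 2⟩ : CubeCat ∅)) (criticalAndOtherFaces ∅ (m + 1) p b) ⟶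
      attachBox S x p b :=
    { map := cellMap S x
      marked := by
        rintro c f (hf | ⟨hc, hf | ⟨j, ε, hne, hf⟩⟩)
        · exact Or.inl (hf.app _)
        · exact Or.inr ⟨hc, h.critical f hf hc, Or.inr ⟨f, hf, rfl⟩⟩
        · cases hf
          refine Or.inr ⟨hc, h.faces hy j ε hne, Or.inl ((h.mem_iff _).2 ?_)⟩
          exact mem_faceUnion_of_coord (P := fun j ε' => (j, ε') ≠ (p, b)) hne
            fun v => cubeFace_same j ε v }
  let bot : ofMarks (yoneda.obj (⟨m + 2⟩ : CubeCat ∅)) (criticalAndHighCubes ∅ (m + 1) p b) ⟶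
      X.regular (S ⊔ Subfunctor.ofSection x) :=
    { map := cellMap S x
      marked := by
        rintro ⟨d⟩ f (hf | ⟨hc, hf | hf⟩)
        · exact X.degenerate (hf.app (yonedaEquiv.symm x))
        · exact h.critical f hf hc
        · change m + 1 ≤ d at hf
          change X.cubes.map (Quiver.Hom.op f) x ∈ X.marked ⟨d⟩
          by_cases hd : IsDegenerateMap ∅ f.1
          · exact X.degenerate (isDegenerate_map f hd x)
          -- The nondegenerate cubes in this range are the codimension one faces and the interior.
          have hs := isDegenerateMap_of_not_forall_isEssential hd
          have hle : d ≤ m + 1 + 1 := f.2.le_of_isEssential hs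
          obtain rfl | rfl : d = m + 1 ∨ d = m + 1 + 1 := by omega
          · obtain ⟨i, ε, e⟩ := f.2.eq_face_of_isEssential hs
            obtain rfl : f = CubeCat.face i ε := Subtype.ext e
            by_cases hne : (i, ε) = (p, b)
            · obtain ⟨rfl, rfl⟩ := Prod.mk.inj hne
              exact hy
            · exact h.faces hy i ε hne
          · refine h.critical f (IsComicalCell.isCritical_of_heq rfl fun v => heq_of_eq ?_) hc
            exact congrFun (f.2.eq_id_of_isEssential hs) v }
  have hpo : IsPushout top (comicalMarkingExt ∅ m p b) (attachBoxToRegular S x p b) bot := by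
    refine isPushout_of_cover rfl (fun c => fun _ _ e => e) (fun c => fun _ _ e => e)
      (fun c t => Or.inl ⟨t, rfl⟩) (fun c y z _ => ⟨z, rfl⟩)
      (fun c y z hy => (hy ⟨y, rfl⟩).elim) fun c t ht => ?_
    rcases h.marked_cases t ht with ht' | ⟨hc, hm, f, rfl⟩
    · exact Or.inr (Or.inl ⟨t, ht', rfl⟩)
    · exact Or.inr (Or.inr ⟨f, Or.inr ⟨X.pos ht, Or.inr hc.ge⟩, rfl⟩)
  refine MorphismProperty.of_isPushout hpo (hW _ (Or.inr ?_))
  exact MorphismProperty.ofHoms.mk (f := fun q : (n : ℕ) × Fin (n + 2) × Bool =>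
    comicalMarkingExt ∅ q.1 q.2.1 q.2.2) ⟨m, p, b⟩

/-- Attaching a comical cell is in every saturated class of maps containing the comical
generators. -/
theorem IsComicalCell.mem (hW : comicalGenerators ∅ ≤ W) {X : MarkedCubicalSet ∅}
    {S : Subfunctor X.cubes} {m : ℕ} {x : X.cubes.obj (op ⟨m + 1⟩)} {p : Fin (m + 1)} {b : Bool}
    (h : IsComicalCell S x p b) :
    W (X.regularHomOfLE (le_sup_left : S ≤ S ⊔ Subfunctor.ofSection x)) := by
  have e : X.regularHomOfLE (le_sup_left : S ≤ S ⊔ Subfunctor.ofSection x) =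
      attachBoxInl S x p b ≫ (attachBoxToRegular S x p b) := rfl
  rw [e]
  refine W.comp_mem _ _ (MorphismProperty.of_isPushout h.isPushout_box (hW _ (Or.inl ?_)))
    (h.mem_attachBoxToRegular W hW)
  exact MorphismProperty.ofHoms.mk (f := fun q : (n : ℕ) × Fin (n + 1) × Bool =>
    comicalBoxι ∅ (q.1 + 1) q.2.1 q.2.2) ⟨m, p, b⟩

end MarkedCubicalSet

/-! ### Complexes of maps between cubes -/

/-- A property of maps to the `N`-cube which is stable under precomposition with maps of `□_∅`. -/
structure CubeSieve (N : ℕ) where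
  /-- the property -/
  mem : ∀ {m : ℕ}, ((Fin m → Bool) → (Fin N → Bool)) → Prop
  comp : ∀ {k m : ℕ} {f : (Fin k → Bool) → (Fin m → Bool)} {φ : (Fin m → Bool) → (Fin N → Bool)},
    IsCubeMap ∅ f → mem φ → mem fun v => φ (f v)

namespace MarkedCubicalSet

/-- The cubical set `i^* □_A^N`. -/
abbrev restrictedCube (A : Set Bool) (N : ℕ) : CubicalSet ∅ :=
  (CubeCat.incl (Set.empty_subset A)).op ⋙ yoneda.obj (⟨N⟩ : CubeCat A)

/-- The cubical set `i^* □_A^N`, in which a cube is marked if its composite with `g` is not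
injective. -/
def markedCube (A : Set Bool) (N : ℕ) {N' : ℕ} (g : (Fin N → Bool) → (Fin N' → Bool)) :
    MarkedCubicalSet ∅ where
  cubes := restrictedCube A N
  marked c := {ψ : (⟨c.dim⟩ : CubeCat A) ⟶ ⟨N⟩ | ¬ Function.Injective fun v => g (ψ.1 v)}
  pos {c ψ} h := by
    by_contra h0
    obtain ⟨d⟩ := c
    obtain rfl : d = 0 := by simpa using h0
    exact h (Function.injective_of_subsingleton _)
  degenerate {c ψ} h := by
    have key : ∀ {d d' : ℕ} {f : (Fin d → Bool) → (Fin d' → Bool)}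
        {φ : (Fin d' → Bool) → (Fin N → Bool)}, ¬ Function.Injective f →
          ¬ Function.Injective fun v => g (φ (f v)) := fun hf h =>
      hf (Function.Injective.of_comp (f := fun v => g _) h)
    cases h with
    | degen i y =>
      exact key (f := cubeDegen i) (φ := Subtype.val (p := IsCubeMap A) y)
        (cubeDegen_not_injective i)
    | conn i ε hε y => exact hε.elim

/-- The subcomplex of `i^* □_A^N` defined by a property of maps. -/
def sieveSub (A : Set Bool) {N : ℕ} (S : CubeSieve N) : Subfunctor (restrictedCube A N) where
  obj c := {ψ : (⟨c.unop.dim⟩ : CubeCat A) ⟶ ⟨N⟩ | S.mem ψ.1}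
  map f _ hψ := S.comp (f := f.unop.1) f.unop.2 hψ

theorem sieveSub_mono (A : Set Bool) {N : ℕ} {S T : CubeSieve N}
    (h : ∀ {m : ℕ} (φ : (Fin m → Bool) → (Fin N → Bool)), IsCubeMap A φ → S.mem φ → T.mem φ) :
    sieveSub A S ≤ sieveSub A T := fun _ ψ hψ => h ψ.1 ψ.2 hψ

end MarkedCubicalSet

/-- The conditions under which the complex of maps satisfying `T` is obtained from that of the maps
satisfying `S` by attaching comical cubes, with missing face in the variable that is inserted at
the coordinate `c`. -/
structure IsInsertionPair (A : Set Bool) {N N' : ℕ} (g : (Fin (N + 1) → Bool) → (Fin N' → Bool))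
    (S T : CubeSieve (N + 1)) (c : Fin (N + 1)) (b : Bool) : Prop where
  le : ∀ {m : ℕ} {φ : (Fin m → Bool) → (Fin (N + 1) → Bool)}, IsCubeMap A φ → S.mem φ → T.mem φ
  coord : ∀ {m : ℕ} {φ : (Fin m → Bool) → (Fin (N + 1) → Bool)}, IsCubeMap A φ → T.mem φ →
    ¬ S.mem φ → (∃ p, ∀ v, φ v c = v p) ∨ ∀ v, φ v c = b
  opposite : ∀ {m : ℕ} {φ : (Fin (m + 1) → Bool) → (Fin (N + 1) → Bool)} {p : Fin (m + 1)},
    IsCubeMap A φ → T.mem φ → ¬ S.mem φ → (∀ v, φ v c = v p) → S.mem fun v => φ (cubeFace p (!b) v)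
  missing : ∀ {m : ℕ} {φ : (Fin (m + 1) → Bool) → (Fin (N + 1) → Bool)} {p : Fin (m + 1)},
    IsCubeMap A φ → T.mem φ → ¬ S.mem φ → (∀ v, φ v c = v p) → ¬ S.mem fun v => φ (cubeFace p b v)
  insert : ∀ {m : ℕ} {φ : (Fin (m + 1) → Bool) → (Fin (N + 1) → Bool)} {p : Fin (m + 1)},
    IsCubeMap A φ → (∀ v, φ v c = v p) → (T.mem fun v => φ (cubeFace p b v)) →
      (¬ S.mem fun v => φ (cubeFace p b v)) → T.mem φ
  critical : ∀ {m : ℕ} {φ : (Fin (m + 1) → Bool) → (Fin (N + 1) → Bool)} {p : Fin (m + 1)},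
    IsCubeMap A φ → T.mem φ → ¬ S.mem φ → (∀ v, φ v c = v p) → (∀ s, IsEssential φ s) →
      ∀ {d : ℕ} (δ : (⟨d⟩ : CubeCat ∅) ⟶ ⟨m + 1⟩), CubeCat.IsCritical p b δ →
        ¬ Function.Injective fun v => g (φ (δ.1 v))
  faces : ∀ {m : ℕ} {φ : (Fin (m + 1) → Bool) → (Fin (N + 1) → Bool)} {p : Fin (m + 1)},
    IsCubeMap A φ → T.mem φ → ¬ S.mem φ → (∀ v, φ v c = v p) → (∀ s, IsEssential φ s) →
      (¬ Function.Injective fun v => g (φ (cubeFace p b v))) → ∀ j ε, (j, ε) ≠ (p, b) →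
        ¬ Function.Injective fun v => g (φ (cubeFace j ε v))

/-- Put `0` in the coordinates outside the range of `σ`. -/
theorem StrictMono.exists_section {m d : ℕ} {σ : Fin m → Fin d} (hσ : StrictMono σ) :
    ∃ g : (Fin m → Bool) → (Fin d → Bool), IsCubeMap ∅ g ∧ ∀ v j, g v (σ j) = v j := by
  classical
  have key : ∀ (v : Fin m → Bool) j, Function.extend σ v (fun _ => false) (σ j) = v j :=
    fun v j => hσ.injective.extend_apply _ _ _
  refine ⟨fun v => Function.extend σ v fun _ => false,
    isCubeMap_empty_of_isElementary _ (fun t => ?_) fun t t' s s' ht hs hs' => ?_, key⟩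
  · by_cases ht : ∃ j, σ j = t
    · obtain ⟨j, rfl⟩ := ht
      exact Or.inr ⟨j, fun v => key v j⟩
    · exact Or.inl ⟨false, fun v => Function.extend_apply' _ _ _ ht⟩
  · have range : ∀ {t : Fin d} {s : Fin m},
        IsEssential (fun v => Function.extend σ v (fun _ => false) t) s → t = σ s := by
      intro t s hs
      by_cases ht : ∃ j, σ j = t
      · obtain ⟨j, rfl⟩ := ht
        simp only [key, isEssential_proj] at hs
        rw [hs]
      · exact (not_isEssential_const (fun v => Function.extend_apply' _ _ _ ht) s hs).elim
    rw [range hs, range hs'] at ht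
    exact hσ.lt_iff_lt.1 ht

/-- A variable other than `p` is used by a coordinate other than `c`, and that coordinate does not
notice that `p` is fixed. -/
theorem isEssential_comp_cubeFace {A : Set Bool} {m n : ℕ}
    {x : (Fin (m + 1) → Bool) → (Fin (n + 1) → Bool)} (hx : IsCubeMap A x) {c : Fin (n + 1)}
    {p : Fin (m + 1)} (hc : ∀ v, x v c = v p) (hess : ∀ s, IsEssential x s) (b : Bool) (s : Fin m) :
    IsEssential (fun v => x (cubeFace p b v)) s := by
  obtain ⟨j, v, b', hv⟩ := (hess (p.succAbove s)).exists_coord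
  have hj : j ≠ c := by
    rintro rfl
    simp only [hc, Function.update_of_ne (Fin.succAbove_ne p s).symm] at hv
    exact hv rfl
  obtain ⟨j, rfl⟩ := Fin.exists_succAbove_eq hj
  refine IsEssential.of_coord (j := c.succAbove j) ⟨cubeDegen p v, b', ?_⟩
  have e := cubeDegen_eq_of_insert hx hc b
  have e1 : cubeDegen p (Function.update v (p.succAbove s) b') =
      Function.update (cubeDegen p v) s b' := by
    ext t
    by_cases ht : t = s
    · subst ht; simp [cubeDegen]
    · simp [cubeDegen, Function.update_of_ne ht,
        Function.update_of_ne (Fin.succAbove_right_injective.ne ht)]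
  have e2 := congrFun (e (Function.update v (p.succAbove s) b')) j
  have e3 := congrFun (e v) j
  rw [e1] at e2
  simp only [cubeDegen] at e2 e3
  intro h
  apply hv
  change x _ _ = x _ _
  rw [e2, e3]
  exact h

/-! ### Attaching the cells of an insertion pair. -/

namespace IsInsertionPair

variable {A : Set Bool} {N N' : ℕ} {g : (Fin (N + 1) → Bool) → (Fin N' → Bool)}
  {S T : CubeSieve (N + 1)} {c : Fin (N + 1)} {b : Bool}

/-- A nondegenerate cube to be attached: a map using all its variables, in `T` but not in `S`,
with coordinate `c` a projection. -/
structure IsCell (A : Set Bool) (S T : CubeSieve (N + 1)) (c : Fin (N + 1)) {m : ℕ}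
    (x : (Fin (m + 1) → Bool) → (Fin (N + 1) → Bool)) (p : Fin (m + 1)) : Prop where
  isCubeMap : IsCubeMap A x
  mem : T.mem x
  notMem : ¬ S.mem x
  coord : ∀ v, x v c = v p
  essential : ∀ s, IsEssential x s

/-- The nondegenerate cubes of positive dimension, all dimensions together. -/
abbrev Cubes (N : ℕ) := (m : ℕ) × ((Fin (m + 1) → Bool) → (Fin (N + 1) → Bool))

/-- All cells. -/
def cells (A : Set Bool) (S T : CubeSieve (N + 1)) (c : Fin (N + 1)) : Set (Cubes N) :=
  {a | ∃ p, IsCell A S T c a.2 p}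

/-- The cells of dimension at most `m`. -/
def below (A : Set Bool) (S T : CubeSieve (N + 1)) (c : Fin (N + 1)) (m : ℕ) : Set (Cubes N) :=
  {a | a ∈ cells A S T c ∧ a.1 < m}

theorem below_mono (A : Set Bool) (S T : CubeSieve (N + 1)) (c : Fin (N + 1)) {m m' : ℕ}
    (h : m ≤ m') : below A S T c m ⊆ below A S T c m' :=
  fun _ ha => ⟨ha.1, ha.2.trans_le h⟩

/-- The property of belonging to `S` or to one of the cubes in `K`. -/
def adjoin (S : CubeSieve (N + 1)) (K : Set (Cubes N)) : CubeSieve (N + 1) where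
  mem {m} φ := S.mem φ ∨ ∃ a ∈ K, ∃ f : (Fin m → Bool) → (Fin (a.1 + 1) → Bool),
    IsCubeMap ∅ f ∧ φ = fun v => a.2 (f v)
  comp {k m f φ} hf h := by
    rcases h with h | ⟨a, ha, f', hf', rfl⟩
    · exact Or.inl (S.comp hf h)
    · exact Or.inr ⟨a, ha, _, hf.comp hf', rfl⟩

theorem adjoin_mono {K L : Set (Cubes N)} (h : K ⊆ L) {m : ℕ}
    {φ : (Fin m → Bool) → (Fin (N + 1) → Bool)} (hφ : (adjoin S K).mem φ) :
    (adjoin S L).mem φ :=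
  hφ.imp_right fun ⟨a, ha, hf⟩ => ⟨a, h ha, hf⟩

variable (h : IsInsertionPair A g S T c b)

/-- Dropping the inessential variables keeps the coordinate `c` a variable: it cannot become
constant, as it is not constant on `φ`. The bound on the dimension ensures that such cells are
attached before any cell having `φ` as a face. -/
theorem exists_cell_of_proj (h : IsInsertionPair A g S T c b) {d : ℕ}
    {φ : (Fin d → Bool) → (Fin (N + 1) → Bool)}
    (hφ : IsCubeMap A φ) (hT : T.mem φ) (hS : ¬ S.mem φ) {q : Fin d} (hq : ∀ v, φ v c = v q) :
    ∃ a ∈ cells A S T c, a.1 + 1 ≤ d ∧ ∃ f, IsCubeMap ∅ f ∧ φ = fun v => a.2 (f v) := by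
  obtain ⟨d', f, k, hf, hk, hess, e⟩ := hφ.exists_isEssential_factorization
  have hS' : ¬ S.mem fun v => φ (k v) := fun hS' => hS (by simpa only [e] using S.comp hf hS')
  have hk' : ∀ s, IsEssential k s := fun s => by
    obtain ⟨v, b', hv⟩ := hess s
    exact ⟨v, b', fun e => hv (congrArg φ e)⟩
  have hle := hk.le_of_isEssential hk'
  have hkφ := (hk.mono (Set.empty_subset A)).comp hφ
  rcases h.coord hkφ (T.comp (f := k) hk hT) hS' with ⟨p, hp⟩ | hb
  · obtain _ | m := d'
    · exact p.elim0
    exact ⟨⟨m, fun v => φ (k v)⟩, ⟨p, hkφ, T.comp (f := k) hk hT, hS', hp, hess⟩, hle, f, hf,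
      funext fun v => (e v).symm⟩
  · exfalso
    have := hb (f fun _ => !b)
    rw [e, hq] at this
    simp at this

theorem exists_cell (h : IsInsertionPair A g S T c b) {d : ℕ}
    {φ : (Fin d → Bool) → (Fin (N + 1) → Bool)}
    (hφ : IsCubeMap A φ) (hT : T.mem φ) (hS : ¬ S.mem φ) :
    ∃ a ∈ cells A S T c, ∃ f, IsCubeMap ∅ f ∧ φ = fun v => a.2 (f v) := by
  rcases h.coord hφ hT hS with ⟨p, hp⟩ | hb
  · obtain ⟨a, ha, -, hf⟩ := h.exists_cell_of_proj hφ hT hS hp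
    exact ⟨a, ha, hf⟩
  obtain ⟨d', f, k, hf, hk, hess, e⟩ := hφ.exists_isEssential_factorization
  have hS' : ¬ S.mem fun v => φ (k v) := fun hS' => hS (by simpa only [e] using S.comp hf hS')
  -- The reduced map has the constant `b` at `c`. Replacing this constant by a new variable gives
  -- the cell whose missing face it is.
  obtain ⟨p, x, hx, hxc, hxd⟩ :=
    (((hk.mono (Set.empty_subset A)).comp hφ).comp (.degen c)).exists_insert c
  have hxf : ∀ v, x (cubeFace p b v) = φ (k v) := by
    intro v
    rw [← cubeFace_cubeDegen_of_eq (hb (k v))]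
    have := hxd (cubeFace p b v)
    rw [cubeDegen_cubeFace] at this
    rw [← this, cubeFace_cubeDegen_of_eq]
    rw [hxc, cubeFace_same]
  have hS'' : ¬ S.mem x := fun hS'' => hS' (by simpa only [hxf] using S.comp (.face p b) hS'')
  have hT' : T.mem x := h.insert hx hxc (by simpa only [hxf] using T.comp (f := k) hk hT)
    (by simpa only [hxf] using hS')
  refine ⟨⟨d', x⟩, ⟨p, hx, hT', hS'', hxc, fun s => ?_⟩, _, hf.comp (.face p b), ?_⟩
  · rcases Fin.eq_self_or_eq_succAbove p s with rfl | ⟨s, rfl⟩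
    · exact IsEssential.of_coord (j := c) (by simp only [hxc, isEssential_proj])
    · have hs := hess s
      simp only [← hxf] at hs
      obtain ⟨u, hu, hu'⟩ := IsEssential.exists_of_comp (f := cubeFace p b) (g := x) hs
      rcases Fin.eq_self_or_eq_succAbove p u with rfl | ⟨u, rfl⟩
      · exact (not_isEssential_const (b := b) (by simp) _ hu').elim
      · simp only [cubeFace_succAbove, isEssential_proj] at hu'
        rwa [hu']
  · ext1 v
    exact (e v).symm.trans (hxf (f v)).symm

/-! ### Attaching a single cell. -/

section Step

variable {K : Set (Cubes N)} {m : ℕ} {x : (Fin (m + 1) → Bool) → (Fin (N + 1) → Bool)}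
  {p : Fin (m + 1)}

/-- The face opposite to the missing one is in `S`. In the others the coordinate `c` is still a
variable, so those not in `S` come from a cell of smaller dimension. -/
theorem adjoin_face (h : IsInsertionPair A g S T c b) (hx : IsCell A S T c x p)
    (hK : ∀ a ∈ cells A S T c, a.1 < m → a ∈ K) {j : Fin (m + 1)} {ε : Bool}
    (hne : (j, ε) ≠ (p, b)) : (adjoin S K).mem fun v => x (cubeFace j ε v) := by
  by_cases hS : S.mem fun v => x (cubeFace j ε v)
  · exact Or.inl hS
  have hj : p ≠ j := by
    rintro rfl
    obtain rfl : ε = !b := by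
      rcases Bool.eq_or_eq_not ε b with rfl | e
      · exact (hne rfl).elim
      · exact e
    exact hS (h.opposite hx.isCubeMap hx.mem hx.notMem hx.coord)
  obtain ⟨q, rfl⟩ := Fin.exists_succAbove_eq hj
  obtain ⟨a, ha, hle, hf⟩ := h.exists_cell_of_proj (q := q) ((IsCubeMap.face j ε).comp hx.isCubeMap)
    (T.comp (.face j ε) hx.mem) hS fun v => by rw [hx.coord, cubeFace_succAbove]
  exact Or.inr ⟨a, hK a ha (by omega), hf⟩

/-- If `x` factors through a cell of `K`, the comparison map uses all its variables and is the
identity by dimension. -/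
theorem not_adjoin_self (hx : IsCell A S T c x p) (hKd : ∀ a ∈ K, a.1 ≤ m)
    (hxK : (⟨m, x⟩ : Cubes N) ∉ K) : ¬ (adjoin S K).mem x := by
  rintro (hS | ⟨⟨m', x'⟩, ha, f, hf, e⟩)
  · exact hx.notMem hS
  have hess : ∀ s, IsEssential f s := fun s => by
    obtain ⟨v, b', hv⟩ := hx.essential s
    exact ⟨v, b', fun e' => hv (by rw [e]; exact congrArg x' e')⟩
  have hle := hf.le_of_isEssential hess
  have hle' := hKd _ ha
  dsimp at f hf hle hle' e
  obtain rfl : m' = m := by omega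
  rw [hf.eq_id_of_isEssential hess] at e
  exact hxK (by rw [e]; exact ha)

/-- Suppose that the missing face of `x` comes from a cell `x'` in `K`. By dimension it is `x'`
itself, which is absurd as the coordinate `c` of `x'` is not constant, or a codimension one face of
`x'`. The latter must be the missing face of `x'`, and then `x = x'`. -/
theorem not_adjoin_missing (h : IsInsertionPair A g S T c b) (hx : IsCell A S T c x p)
    (hKc : K ⊆ cells A S T c) (hKd : ∀ a ∈ K, a.1 ≤ m) (hxK : (⟨m, x⟩ : Cubes N) ∉ K) :
    ¬ (adjoin S K).mem fun v => x (cubeFace p b v) := by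
  rintro (hS | ⟨⟨m', x'⟩, ha, f, hf, e⟩)
  · exact h.missing hx.isCubeMap hx.mem hx.notMem hx.coord hS
  have hy := isEssential_comp_cubeFace hx.isCubeMap hx.coord hx.essential b
  have hess : ∀ s, IsEssential f s := fun s => by
    obtain ⟨v, b', hv⟩ := hy s
    exact ⟨v, b', fun e' => hv ((congrFun e _).trans ((congrArg x' e').trans (congrFun e _).symm))⟩
  have hle := hf.le_of_isEssential hess
  have hle' := hKd _ ha
  obtain ⟨p', hx'⟩ := hKc ha
  dsimp at f hf hle hle' e hx'
  have hc : ∀ v, f v p' = b := fun v =>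
    (hx'.coord (f v)).symm.trans ((congrFun (congrFun e v) c).symm.trans
      ((hx.coord _).trans (cubeFace_same p b v)))
  obtain rfl | rfl : m = m' + 1 ∨ m = m' := by omega
  · rw [hf.eq_id_of_isEssential hess] at hc
    have := hc fun _ => !b
    simp at this
  · obtain ⟨i, ε, rfl⟩ := hf.eq_face_of_isEssential hess
    by_cases hi : p' = i
    · subst hi
      obtain rfl : ε = b := by simpa using hc fun _ => b
      have := eq_of_insert hx.isCubeMap hx'.isCubeMap hx.coord hx'.coord (congrFun e) hy
      exact hxK (this ▸ ha)
    · obtain ⟨q, rfl⟩ := Fin.exists_succAbove_eq hi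
      have := hc fun _ => !b
      rw [cubeFace_succAbove] at this
      simp at this

/-- Outside of the open box, `f` is a projection, possibly followed by the missing face; a section
of the projection reduces to `not_adjoin_self` and `not_adjoin_missing`. -/
theorem adjoin_comp_iff (h : IsInsertionPair A g S T c b) (hx : IsCell A S T c x p)
    (hKc : K ⊆ cells A S T c) (hK : ∀ a ∈ cells A S T c, a.1 < m → a ∈ K)
    (hKd : ∀ a ∈ K, a.1 ≤ m) (hxK : (⟨m, x⟩ : Cubes N) ∉ K) {d : ℕ}
    {f : (Fin d → Bool) → (Fin (m + 1) → Bool)} (hf : IsCubeMap ∅ f) :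
    ((adjoin S K).mem fun v => x (f v)) ↔ ∃ j ε, (j, ε) ≠ (p, b) ∧ ∀ v, f v j = ε := by
  constructor
  · intro hm
    by_contra hbox
    rcases hf.eq_proj_or_face hbox with ⟨σ, hσ, e⟩ | ⟨σ, hσ, e⟩
    · obtain ⟨k, hk, hkσ⟩ := hσ.exists_section
      have := (adjoin S K).comp hk hm
      simp only [e, hkσ] at this
      exact not_adjoin_self hx hKd hxK this
    · obtain ⟨k, hk, hkσ⟩ := hσ.exists_section
      have := (adjoin S K).comp hk hm
      simp only [e, hkσ] at this
      exact h.not_adjoin_missing hx hKc hKd hxK this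
  · rintro ⟨j, ε, hne, hj⟩
    have := (adjoin S K).comp (hf.comp (.degen j)) (h.adjoin_face hx hK hne)
    simpa only [cubeFace_cubeDegen_of_eq (hj _)] using this

/-- The coordinate `c` of the composite tells whether `f` passes through the missing face. In either
case the remaining projection is determined, because the cell and its missing face use all their
variables. -/
theorem eq_of_comp_eq (hx : IsCell A S T c x p) {d : ℕ}
    {f f' : (Fin d → Bool) → (Fin (m + 1) → Bool)} (hf : IsCubeMap ∅ f) (hf' : IsCubeMap ∅ f')
    (hb : ¬ ∃ j ε, (j, ε) ≠ (p, b) ∧ ∀ v, f v j = ε)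
    (hb' : ¬ ∃ j ε, (j, ε) ≠ (p, b) ∧ ∀ v, f' v j = ε) (e : ∀ v, x (f v) = x (f' v)) : f = f' := by
  have ep : ∀ v, f v p = f' v p := fun v => by rw [← hx.coord (f v), e, hx.coord]
  rcases hf.eq_proj_or_face hb with ⟨σ, hσ, h1⟩ | ⟨σ, hσ, h1⟩ <;>
    rcases hf'.eq_proj_or_face hb' with ⟨τ, hτ, h2⟩ | ⟨τ, hτ, h2⟩
  · simp only [h1, h2] at e
    have := eq_of_comp_eq_comp hx.essential hσ hτ e
    ext1 v
    rw [h1, h2, this]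
  · have := ep fun _ => !b
    simp [h1, h2] at this
  · have := ep fun _ => !b
    simp [h1, h2] at this
  · simp only [h1, h2] at e
    have := eq_of_comp_eq_comp
      (isEssential_comp_cubeFace hx.isCubeMap hx.coord hx.essential b) hσ hτ e
    ext1 v
    rw [h1, h2, this]

open MarkedCubicalSet

theorem isComicalCell (h : IsInsertionPair A g S T c b) (hx : IsCell A S T c x p)
    (hKc : K ⊆ cells A S T c) (hK : ∀ a ∈ cells A S T c, a.1 < m → a ∈ K)
    (hKd : ∀ a ∈ K, a.1 ≤ m) (hxK : (⟨m, x⟩ : Cubes N) ∉ K) :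
    IsComicalCell (X := markedCube A (N + 1) g) (sieveSub A (adjoin S K)) (m := m)
      (⟨x, hx.isCubeMap⟩ : (⟨m + 1⟩ : CubeCat A) ⟶ ⟨N + 1⟩) p b where
  mem_iff f := (h.adjoin_comp_iff hx hKc hK hKd hxK f.2).trans mem_faceUnion_iff.symm
  inj f f' hf hf' e := Subtype.ext (eq_of_comp_eq hx f.2 f'.2
    (fun hb => hf (mem_faceUnion_iff.2 hb)) (fun hb => hf' (mem_faceUnion_iff.2 hb))
    fun v => congrFun (congrArg (Subtype.val (p := IsCubeMap A)) e) v)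
  critical f hf _ := h.critical hx.isCubeMap hx.mem hx.notMem hx.coord hx.essential f hf
  faces hy j ε hne := h.faces hx.isCubeMap hx.mem hx.notMem hx.coord hx.essential hy j ε hne

theorem sieveSub_adjoin_insert (hx : IsCubeMap A x) :
    sieveSub A (adjoin S (Insert.insert (⟨m, x⟩ : Cubes N) K)) = sieveSub A (adjoin S K) ⊔
      Subfunctor.ofSection (F := restrictedCube A (N + 1)) (X := op ⟨m + 1⟩)
        (⟨x, hx⟩ : (⟨m + 1⟩ : CubeCat A) ⟶ ⟨N + 1⟩) := by
  apply le_antisymm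
  · rintro d ψ (hψ | ⟨a, rfl | ha, f, hf, e⟩)
    · exact Or.inl (Or.inl hψ)
    · exact Or.inr ⟨Quiver.Hom.op ⟨f, hf⟩, Subtype.ext e.symm⟩
    · exact Or.inl (Or.inr ⟨a, ha, f, hf, e⟩)
  · rintro d ψ (hψ | ⟨f, rfl⟩)
    · exact adjoin_mono (Set.subset_insert _ _) hψ
    · exact Or.inr ⟨_, Set.mem_insert _ _, f.unop.1, f.unop.2, rfl⟩

end Step

open MarkedCubicalSet

theorem mem_regularHomOfLE_congr (W : MorphismProperty (MarkedCubicalSet ∅))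
    {X : MarkedCubicalSet ∅} {S S' T T' : Subfunctor X.cubes}
    (hS : S = S') (hT : T = T') {hle : S ≤ T} (hle' : S' ≤ T') (h : W (X.regularHomOfLE hle)) :
    W (X.regularHomOfLE hle') := by
  subst hS hT
  exact h

variable (W : MorphismProperty (MarkedCubicalSet ∅)) [W.IsStableUnderCobaseChange]
  [MorphismProperty.IsStableUnderTransfiniteComposition.{0} W]

/-- Cells of equal dimension can be attached in any order: only the smaller cells have to be present
already. -/
theorem mem_layer (h : IsInsertionPair A g S T c b) (hW : comicalGenerators ∅ ≤ W) (m : ℕ)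
    (L : Finset (Cubes N)) (hL : ∀ a ∈ L, a ∈ cells A S T c ∧ a.1 = m) :
    W ((markedCube A (N + 1) g).regularHomOfLE
      (sieveSub_mono A (S := adjoin S (below A S T c m))
        (T := adjoin S ((below A S T c m) ∪ L))
        fun _ _ h => adjoin_mono Set.subset_union_left h)) := by
  classical
  induction L using Finset.induction_on with
  | empty =>
    exact mem_regularHomOfLE_congr W (X := markedCube A (N + 1) g) rfl
      (by rw [Finset.coe_empty, Set.union_empty]) (hle := le_refl _) _ (W.id_mem _)
  | insert a L ha ih =>
    have ih := ih fun a' ha' => hL a' (Finset.mem_insert_of_mem ha')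
    obtain ⟨⟨p, hp⟩, rfl⟩ := hL a (Finset.mem_insert_self _ _)
    have hcell := h.isComicalCell (K := below A S T c a.1 ∪ L) hp
      (Set.union_subset (fun a' h' => h'.1)
        fun a' h' => (hL a' (Finset.mem_insert_of_mem h')).1)
      (fun a' h1 h2 => Or.inl ⟨h1, h2⟩)
      (by
        rintro a' (h' | h')
        · exact h'.2.le
        · exact (hL a' (Finset.mem_insert_of_mem h')).2.le)
      (by
        rintro (h' | h')
        · exact lt_irrefl _ h'.2
        · exact ha h')
    have hmem := hcell.mem W hW
    refine mem_regularHomOfLE_congr W (X := markedCube A (N + 1) g) rfl ?_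
      (hle := (sieveSub_mono A fun _ _ h => adjoin_mono Set.subset_union_left h).trans le_sup_left)
      _ (W.comp_mem _ _ ih hmem)
    refine (sieveSub_adjoin_insert hp.isCubeMap).symm.trans ?_
    rw [Finset.coe_insert, Set.union_insert]

theorem finite_layer (m : ℕ) : {a : Cubes N | a.1 = m}.Finite := by
  refine (Set.finite_range fun x : (Fin (m + 1) → Bool) → (Fin (N + 1) → Bool) =>
    (⟨m, x⟩ : Cubes N)).subset ?_
  rintro ⟨m', x⟩ rfl
  exact ⟨x, rfl⟩

/-- The inclusion of complexes of maps given by an insertion pair is in every saturated class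
containing the comical generators. -/
theorem mem_property (h : IsInsertionPair A g S T c b) (hW : comicalGenerators ∅ ≤ W)
    (hle : sieveSub A S ≤ sieveSub A T) :
    W ((markedCube A (N + 1) g).regularHomOfLE hle) := by
  have hmono : Monotone fun m : ℕ =>
      sieveSub A (adjoin S (below A S T c m)) := fun m m' hm =>
    sieveSub_mono A fun _ _ hφ => adjoin_mono (below_mono A S T c hm) hφ
  have hT : sieveSub A T =
      ⨆ m : ℕ, sieveSub A (adjoin S (below A S T c m)) := by
    apply le_antisymm
    · intro d ψ hψ
      rw [Subfunctor.iSup_obj, Set.mem_iUnion]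
      by_cases hS : S.mem ψ.1
      · exact ⟨0, Or.inl hS⟩
      · obtain ⟨a, ha, f, hf, e⟩ := h.exists_cell ψ.2 hψ hS
        exact ⟨a.1 + 1, Or.inr ⟨a, ⟨ha, Nat.lt_succ_self _⟩, f, hf, e⟩⟩
    · refine iSup_le fun m => sieveSub_mono A fun φ hφ hm => ?_
      rcases hm with hS | ⟨a, ⟨⟨p, ha⟩, -⟩, f, hf, rfl⟩
      · exact h.le hφ hS
      · exact T.comp hf ha.mem
  have h0 : sieveSub A (adjoin S (below A S T c 0)) = sieveSub A S := by
    apply le_antisymm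
    · rintro d ψ (hψ | ⟨a, ha, -⟩)
      · exact hψ
      · exact (Nat.not_lt_zero _ ha.2).elim
    · exact fun d ψ hψ => Or.inl hψ
  refine mem_regularHomOfLE_congr W (X := markedCube A (N + 1) g) h0 rfl (hle := h0.le.trans hle) _
    (mem_of_chain W (X := markedCube A (N + 1) g) hmono hT (fun m => ?_) _)
  have hfin : {a | a ∈ cells A S T c ∧ a.1 = m}.Finite :=
    (finite_layer m).subset fun a ha => ha.2
  have hm := h.mem_layer W hW m hfin.toFinset fun a ha => hfin.mem_toFinset.1 ha
  refine mem_regularHomOfLE_congr W (X := markedCube A (N + 1) g) rfl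
    (congrArg (fun K => sieveSub A (adjoin S K)) ?_) _ hm
  ext a
  simp only [Set.Finite.coe_toFinset, Set.mem_union, below, Set.mem_ofPred_eq, ← and_or_left,
    Nat.lt_succ_iff_lt_or_eq]

end IsInsertionPair

/-! ### Adding a connection at one coordinate -/

theorem eq_of_comp_cubeFace {A : Set Bool} {m n : ℕ} {φ : (Fin (m + 1) → Bool) → (Fin n → Bool)}
    (hφ : IsCubeMap A φ) {c a : Fin n} {p : Fin (m + 1)} (hc : ∀ v, φ v c = v p) (ha : a ≠ c)
    (b : Bool) (v : Fin (m + 1) → Bool) : φ (cubeFace p b (cubeDegen p v)) a = φ v a :=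
  eq_cubeFace_cubeDegen_of_not_isEssential (g := fun v => φ v a)
    (fun h => ha (hφ.eq_of_isEssential h (by simp only [hc, isEssential_proj]))) b v

theorem const_of_comp_cubeFace {A : Set Bool} {m n : ℕ}
    {φ : (Fin (m + 1) → Bool) → (Fin n → Bool)} (hφ : IsCubeMap A φ) {c a : Fin n}
    {p : Fin (m + 1)} (hc : ∀ v, φ v c = v p) (ha : a ≠ c) {b b' : Bool}
    (h : ∀ v, φ (cubeFace p b v) a = b') (v : Fin (m + 1) → Bool) : φ v a = b' := by
  rw [← eq_of_comp_cubeFace hφ hc ha b, h]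

theorem isElementary_of_comp_cubeFace {A : Set Bool} {m n : ℕ}
    {φ : (Fin (m + 1) → Bool) → (Fin n → Bool)} (hφ : IsCubeMap A φ) {c a : Fin n}
    {p : Fin (m + 1)} (hc : ∀ v, φ v c = v p) (ha : a ≠ c) {b : Bool}
    (h : IsElementary fun v => φ (cubeFace p b v) a) : IsElementary fun v => φ v a := by
  have := h.comp (IsCubeMap.degen p).isElementary
  simpa only [eq_of_comp_cubeFace hφ hc ha b] using this

/-- The variable `s` enters `δ` only through the coordinate `t`. -/
theorem IsCubeMap.isEssential_of_comp {B : Set Bool} {d m n : ℕ}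
    {φ : (Fin m → Bool) → (Fin n → Bool)} {δ : (Fin d → Bool) → (Fin m → Bool)}
    (hδ : IsCubeMap B δ) {a : Fin n} {s : Fin d} {t : Fin m} (ht : ∀ v, δ v t = v s)
    (h : IsEssential (fun v => φ (δ v) a) s) : IsEssential (fun v => φ v a) t := by
  obtain ⟨u, hu, hu'⟩ := IsEssential.exists_of_comp (g := fun v => φ v a) h
  have hts : IsEssential (fun v => δ v t) s := by simp only [ht, isEssential_proj]
  rwa [hδ.eq_of_isEssential hts hu']

section Connection

variable {A : Set Bool} {n : ℕ} (k : Fin (n + 1)) (ε : Bool)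

theorem castSucc_ne_succ : k.castSucc ≠ k.succ := (Fin.castSucc_lt_succ).ne

theorem ne_of_cubeConn_coord {j : Fin (n + 1)} (hj : j ≠ k) : ∃ a, a ≠ k.castSucc ∧ a ≠ k.succ ∧
    ∀ x, cubeConn k ε x j = x a := by
  rcases lt_or_gt_of_ne hj with h | h
  · refine ⟨j.castSucc, ?_, ?_, cubeConn_lt h ε⟩ <;>
      simp only [Fin.lt_def, ne_eq, Fin.ext_iff, Fin.val_castSucc, Fin.val_succ] at * <;> omega
  · refine ⟨j.succ, ?_, ?_, cubeConn_gt h ε⟩ <;>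
      simp only [Fin.lt_def, ne_eq, Fin.ext_iff, Fin.val_castSucc, Fin.val_succ] at * <;> omega

/-- Two points identified by the connection. -/
theorem cubeConn_eq {x y : Fin (n + 2) → Bool}
    (h : ∀ a, a ≠ k.castSucc → a ≠ k.succ → x a = y a)
    (hk : connOp ε (x k.castSucc) (x k.succ) = connOp ε (y k.castSucc) (y k.succ)) :
    cubeConn k ε x = cubeConn k ε y := by
  ext j
  by_cases hj : j = k
  · subst hj
    rw [cubeConn_same, cubeConn_same, hk]
  · obtain ⟨a, ha, ha', e⟩ := ne_of_cubeConn_coord k ε hj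
    rw [e, e, h a ha ha']

/-- At `v` the coordinate `c'` is absorbing, so flipping `s`, which affects the coordinate `c` only,
is not seen by the connection. -/
theorem not_injective_of_absorbing {d : ℕ} {ψ : (Fin d → Bool) → (Fin (n + 2) → Bool)}
    (hψ : IsCubeMap A ψ) {c c' : Fin (n + 2)}
    (hc : (c = k.castSucc ∧ c' = k.succ) ∨ (c = k.succ ∧ c' = k.castSucc)) {s : Fin d}
    (hs : IsEssential (fun v => ψ v c) s) {v : Fin d → Bool} (hv : ψ v c' = !ε) :
    ¬ Function.Injective fun v => cubeConn k ε (ψ v) := by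
  intro hinj
  have hne : c ≠ c' := by
    rcases hc with ⟨rfl, rfl⟩ | ⟨rfl, rfl⟩
    · exact castSucc_ne_succ k
    · exact (castSucc_ne_succ k).symm
  have agree : ∀ a, a ≠ c → ψ (Function.update v s (!v s)) a = ψ v a := fun a ha => by
    by_contra h
    exact ha (hψ.eq_of_isEssential ⟨v, _, h⟩ hs)
  have e : Function.update v s (!v s) = v := by
    apply hinj
    refine cubeConn_eq k ε (fun a h1 h2 => agree a ?_) ?_
    · rcases hc with ⟨rfl, rfl⟩ | ⟨rfl, rfl⟩ <;> assumption
    · have h' := agree c' hne.symm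
      rcases hc with ⟨rfl, rfl⟩ | ⟨rfl, rfl⟩ <;> rw [h', hv] <;> simp
  have := congrFun e s
  simp at this

/-- The variable `s'` could enter only through the coordinate `k`, which is constant at the unit
along `δ`. So the composite does not depend on it. -/
theorem not_injective_of_unit {d m : ℕ} {φ : (Fin m → Bool) → (Fin (n + 2) → Bool)}
    (hφ : IsCubeMap A φ) {δ : (Fin d → Bool) → (Fin m → Bool)} (hδ : IsCubeMap ∅ δ) {p t : Fin m}
    (hp : ∀ v, φ v k.succ = v p) (ht : IsEssential (fun v => φ v k.castSucc) t) {s s' : Fin d}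
    (hs : ∀ v, δ v p = v s) (hs' : ∀ v, δ v t = v s') (hu : ∀ v, φ (δ v) k.castSucc = ε) :
    ¬ Function.Injective fun v => cubeConn k ε (φ (δ v)) := by
  have hpe : IsEssential (fun v => φ v k.succ) p := by simp only [hp, isEssential_proj]
  have hss : s' ≠ s := by
    refine (hδ.ordered (hφ.ordered Fin.castSucc_lt_succ ht hpe) (s := s') (t := s) ?_ ?_).ne
    · simp only [hs', isEssential_proj]
    · simp only [hs, isEssential_proj]
  apply not_injective_of_not_isEssential (s := s')
  intro h
  obtain ⟨j, hj⟩ := h.exists_coord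
  by_cases hjk : j = k
  · subst hjk
    simp only [cubeConn_same, hu, hp, hs, connOp_unit_left, isEssential_proj] at hj
    exact hss hj
  · obtain ⟨a, ha, -, e⟩ := ne_of_cubeConn_coord k ε hjk
    simp only [e] at hj
    exact ha (hφ.eq_of_isEssential (hδ.isEssential_of_comp hs' hj) ht)

/-- Maps whose composite with the connection has a constant coordinate. -/
def HasConstantConn {m : ℕ} (φ : (Fin m → Bool) → (Fin (n + 2) → Bool)) : Prop :=
  ∃ j b, ∀ v, cubeConn k ε (φ v) j = b

theorem HasConstantConn.comp {k : Fin (n + 1)} {ε : Bool} {d m : ℕ}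
    {φ : (Fin m → Bool) → (Fin (n + 2) → Bool)} (h : HasConstantConn k ε φ)
    (f : (Fin d → Bool) → (Fin m → Bool)) : HasConstantConn k ε fun v => φ (f v) :=
  let ⟨j, b, hb⟩ := h
  ⟨j, b, fun _ => hb _⟩

theorem hasConstantConn_of_absorbing {m : ℕ} {φ : (Fin m → Bool) → (Fin (n + 2) → Bool)}
    (h : (∀ v, φ v k.castSucc = !ε) ∨ ∀ v, φ v k.succ = !ε) : HasConstantConn k ε φ := by
  refine ⟨k, !ε, fun v => ?_⟩
  rw [cubeConn_same]
  rcases h with h | h <;> rw [h] <;> simp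

/-- With `c` at the unit, the merged coordinate is `c'`, and no coordinate other than `c` depends on
`p`. So a coordinate constant on the face was constant before, unless it is the merged one; then
`c'` is constant, either absorbing or the unit. -/
theorem hasConstantConn_of_comp_cubeFace {m : ℕ}
    {φ : (Fin (m + 1) → Bool) → (Fin (n + 2) → Bool)} (hφ : IsCubeMap A φ) {c c' : Fin (n + 2)}
    (hc : (c = k.castSucc ∧ c' = k.succ) ∨ (c = k.succ ∧ c' = k.castSucc)) {p : Fin (m + 1)}
    (hp : ∀ v, φ v c = v p) (h : HasConstantConn k ε fun v => φ (cubeFace p ε v)) :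
    HasConstantConn k ε φ ∨ ∀ v, φ v c' = ε := by
  obtain ⟨j, b, hb⟩ := h
  by_cases hj : j = k
  · subst hj
    have hc' : ∀ v, φ (cubeFace p ε v) c' = b := by
      intro v
      rw [← hb v, cubeConn_same]
      beta_reduce
      rcases hc with ⟨rfl, rfl⟩ | ⟨rfl, rfl⟩ <;> rw [hp, cubeFace_same] <;> simp
    have hne : c' ≠ c := by
      rcases hc with ⟨rfl, rfl⟩ | ⟨rfl, rfl⟩
      · exact (castSucc_ne_succ j).symm
      · exact castSucc_ne_succ j
    have := const_of_comp_cubeFace hφ hp hne hc'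
    rcases Bool.eq_or_eq_not b ε with rfl | rfl
    · exact Or.inr this
    · left
      apply hasConstantConn_of_absorbing
      rcases hc with ⟨rfl, rfl⟩ | ⟨rfl, rfl⟩
      · exact Or.inr this
      · exact Or.inl this
  · obtain ⟨a, ha, ha', e⟩ := ne_of_cubeConn_coord k ε hj
    simp only [e] at hb
    left
    refine ⟨j, b, fun v => ?_⟩
    rw [e]
    exact const_of_comp_cubeFace hφ hp
      (by rcases hc with ⟨rfl, rfl⟩ | ⟨rfl, rfl⟩ <;> assumption) hb v

/-- The sieve of maps whose coordinates from `l` on are elementary, together with those that become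
degenerate in the boundary. -/
def elementaryFrom (l : Fin (n + 2)) : CubeSieve (n + 2) where
  mem φ := HasConstantConn k ε φ ∨ ∀ a, l ≤ a → IsElementary fun v => φ v a
  comp hf h := h.imp (fun h => h.comp _) fun h a ha => (h a ha).comp hf.isElementary

/-- The subsieve of `elementaryFrom k` of the maps with coordinate `k + 1` constant at the unit of
the connection. -/
def unitSieve : CubeSieve (n + 2) where
  mem φ := HasConstantConn k ε φ ∨
    ((∀ a, k.castSucc ≤ a → IsElementary fun v => φ v a) ∧ ∀ v, φ v k.succ = ε)
  comp hf h := h.imp (fun h => h.comp _)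
    fun h => ⟨fun a ha => (h.1 a ha).comp hf.isElementary, fun _ => h.2 _⟩

variable {k ε}

theorem exists_proj_of_not_unitSieve {m : ℕ} {φ : (Fin m → Bool) → (Fin (n + 2) → Bool)}
    (hT : (elementaryFrom k ε k.castSucc).mem φ) (hS : ¬ (unitSieve k ε).mem φ) :
    ∃ q, ∀ v, φ v k.succ = v q := by
  rcases hT with hB | hT
  · exact (hS (Or.inl hB)).elim
  rcases hT k.succ Fin.castSucc_lt_succ.le with ⟨b, hb⟩ | hq
  · rcases Bool.eq_or_eq_not b ε with rfl | rfl
    · exact (hS (Or.inr ⟨hT, hb⟩)).elim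
    · exact (hS (Or.inl (hasConstantConn_of_absorbing k ε (Or.inr hb)))).elim
  · exact hq

/-- Such a variable would be used by a coordinate strictly between `k` and `k + 1`. -/
theorem not_between {m : ℕ} {φ : (Fin m → Bool) → (Fin (n + 2) → Bool)} (hφ : IsCubeMap A φ)
    {p q t : Fin m} (hp : ∀ v, φ v k.castSucc = v p) (hq : ∀ v, φ v k.succ = v q)
    (hess : ∀ s, IsEssential φ s) (hpt : p < t) (htq : t < q) : False := by
  obtain ⟨j, hj⟩ := (hess t).exists_coord
  have ep : IsEssential (fun v => φ v k.castSucc) p := by simp only [hp, isEssential_proj]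
  have eq : IsEssential (fun v => φ v k.succ) q := by simp only [hq, isEssential_proj]
  rcases lt_trichotomy j k.castSucc with h | rfl | h
  · exact lt_asymm hpt (hφ.ordered h hj ep)
  · simp only [hp, isEssential_proj] at hj
    exact hpt.ne' hj
  rcases lt_trichotomy j k.succ with h' | rfl | h'
  · simp only [Fin.lt_def, Fin.val_castSucc, Fin.val_succ] at h h'
    omega
  · simp only [hq, isEssential_proj] at hj
    exact htq.ne hj
  · exact lt_asymm htq (hφ.ordered h' eq hj)

/-- For adjacent `p` and `q`, fixing either at the unit leaves the other at the same position, and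
the connection returns it. -/
theorem cubeConn_face_eq {m : ℕ} {φ : (Fin (m + 1) → Bool) → (Fin (n + 2) → Bool)}
    (hφ : IsCubeMap A φ) {p q : Fin (m + 1)} (hp : ∀ v, φ v k.castSucc = v p)
    (hq : ∀ v, φ v k.succ = v q) (hpq : q.val = p.val + 1) (v : Fin m → Bool) :
    cubeConn k ε (φ (cubeFace q ε v)) = cubeConn k ε (φ (cubeFace p ε v)) := by
  have hpm : p.val < m := by omega
  have e1 : p = q.succAbove ⟨p.val, hpm⟩ := by
    rw [Fin.succAbove_of_castSucc_lt]
    · rfl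
    · simp only [Fin.lt_def, Fin.val_castSucc]; omega
  have e2 : q = p.succAbove ⟨p.val, hpm⟩ := by
    rw [Fin.succAbove_of_le_castSucc]
    · exact Fin.ext hpq
    · simp only [Fin.le_def, Fin.val_castSucc, le_refl]
  refine cubeConn_eq k ε (fun a ha ha' => ?_) ?_
  · refine eq_of_agree_on_essential (fun v => φ v a) fun u hu => ?_
    have hup : u ≠ p := by
      rintro rfl
      exact ha (hφ.eq_of_isEssential hu (by simp only [hp, isEssential_proj]))
    have huq : u ≠ q := by
      rintro rfl
      exact ha' (hφ.eq_of_isEssential hu (by simp only [hq, isEssential_proj]))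
    obtain ⟨w, rfl⟩ := Fin.exists_succAbove_eq hup
    have : p.succAbove w = q.succAbove w := by
      simp only [Fin.succAbove, Fin.lt_def, Fin.ext_iff, Fin.val_castSucc, ne_eq] at *
      split_ifs at * <;> simp only [Fin.val_castSucc, Fin.val_succ] at * <;> omega
    rw [cubeFace_succAbove, this, cubeFace_succAbove]
  · rw [hp, hq, hp, hq, cubeFace_same, cubeFace_same, connOp_unit_left, connOp_unit_right]
    conv_lhs => rw [e1]
    conv_rhs => rw [e2]
    rw [← e1, ← e2]
    have h1 := cubeFace_succAbove q ε v ⟨p.val, hpm⟩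
    have h2 := cubeFace_succAbove p ε v ⟨p.val, hpm⟩
    rw [← e1] at h1
    rw [← e2] at h2
    rw [h1, h2]

theorem exists_eq_not {m : ℕ} {g : (Fin m → Bool) → Bool} {b : Bool}
    (hb : ¬ ∀ v, g v = b) : ∃ v, g v = !b := by
  by_contra! hc
  refine hb fun v => ?_
  rcases Bool.eq_or_eq_not (g v) b with e | e
  · exact e
  · exact (hc v e).elim

/-- Outside of the smaller complex the coordinate `k + 1` is a variable `q`, and the coordinate `k`
is a variable or the unit, since an absorbing constant would make the composite constant at `k`. -/
theorem isInsertionPair_unitSieve :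
    IsInsertionPair A (cubeConn k ε) (unitSieve k ε) (elementaryFrom k ε k.castSucc)
      k.castSucc ε where
  le _ h := h.imp_right fun h => h.1
  coord {m φ} hφ hT hS := by
    rcases hT with hB | hT
    · exact (hS (Or.inl hB)).elim
    rcases hT k.castSucc le_rfl with ⟨b, hb⟩ | hq
    · rcases Bool.eq_or_eq_not b ε with rfl | rfl
      · exact Or.inr hb
      · exact (hS (Or.inl (hasConstantConn_of_absorbing k ε (Or.inl hb)))).elim
    · exact Or.inl hq
  opposite hφ hT hS hp :=
    Or.inl (hasConstantConn_of_absorbing k ε (Or.inl fun v => by rw [hp, cubeFace_same]))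
  missing {m φ p} hφ hT hS hp hm := by
    obtain ⟨q, hq⟩ := exists_proj_of_not_unitSieve hT hS
    have hne : ¬ ∀ v, φ v k.succ = ε := fun h => by
      have := h fun _ => !ε
      rw [hq] at this
      simp at this
    rcases hm with hB | ⟨-, hm⟩
    · rcases hasConstantConn_of_comp_cubeFace k ε hφ (Or.inl ⟨rfl, rfl⟩) hp hB with h | h
      · exact hS (Or.inl h)
      · exact hne h
    · exact hne (const_of_comp_cubeFace hφ hp (castSucc_ne_succ k).symm hm)
  insert {m φ p} hφ hp hT hS := by
    rcases hT with hB | hT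
    · exact (hS (Or.inl hB)).elim
    refine Or.inr fun a ha => ?_
    by_cases hac : a = k.castSucc
    · subst hac
      exact Or.inr ⟨p, hp⟩
    · exact isElementary_of_comp_cubeFace hφ hp hac (hT a ha)
  critical {m φ p} hφ hT hS hp hess d δ hδ := by
    obtain ⟨q, hq⟩ := exists_proj_of_not_unitSieve hT hS
    obtain ⟨s, hs⟩ : ∃ s, ∀ v, δ.1 v p = v s := by
      rcases δ.2.isElementary p with ⟨b, hb⟩ | hs
      · refine (hδ.middle ?_).elim
        rcases Bool.eq_or_eq_not b ε with rfl | rfl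
        · exact Or.inl hb
        · exact Or.inr hb
      · exact hs
    have hpq : p < q := hφ.ordered (Fin.castSucc_lt_succ (i := k))
      (by simp only [hp, isEssential_proj]) (by simp only [hq, isEssential_proj])
    -- As no variable lies between `p` and `q`, criticality forbids fixing `q` at `ε`; hence `q`
    -- takes the absorbing value.
    obtain ⟨v, hv⟩ := exists_eq_not (g := fun v => δ.1 v q) (b := ε) fun h =>
      hδ.high ⟨q, hpq, h, fun t h1 h2 => (not_between hφ hp hq hess h1 h2).elim⟩
    refine not_injective_of_absorbing k ε ((δ.2.mono (Set.empty_subset A)).comp hφ)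
      (Or.inl ⟨rfl, rfl⟩) (s := s) ?_ (v := v) ?_
    · simp only [hp, hs, isEssential_proj]
    · rw [hq, hv]
  faces {m φ p} hφ hT hS hp hess hy j η hne := by
    obtain ⟨q, hq⟩ := exists_proj_of_not_unitSieve hT hS
    have hpq : p < q := hφ.ordered (Fin.castSucc_lt_succ (i := k))
      (by simp only [hp, isEssential_proj]) (by simp only [hq, isEssential_proj])
    have hψ := (IsCubeMap.face j η).comp hφ
    by_cases hj : p = j
    · subst hj
      obtain rfl : η = !ε := by
        rcases Bool.eq_or_eq_not η ε with rfl | e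
        · exact (hne rfl).elim
        · exact e
      obtain ⟨q', rfl⟩ := Fin.exists_succAbove_eq hpq.ne'
      refine not_injective_of_absorbing k ε hψ (Or.inr ⟨rfl, rfl⟩) (s := q') ?_
        (v := fun _ => false) ?_
      · simp only [hq, cubeFace_succAbove, isEssential_proj]
      · rw [hp, cubeFace_same]
    obtain ⟨p', rfl⟩ := Fin.exists_succAbove_eq hj
    -- The face `∂_{q,ε}` has the same composite with the connection as the missing face, which is
    -- not injective by `hy`. In the remaining faces `p` is free and `q` takes the absorbing value.
    by_cases hju : j = q ∧ η = ε
    · obtain ⟨rfl, rfl⟩ := hju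
      have hadj : j.val = (j.succAbove p').val + 1 := by
        by_contra hadj
        have hlt : (j.succAbove p').val + 1 < j.val := by
          simp only [Fin.lt_def] at hpq
          omega
        exact not_between hφ hp hq hess
          (t := ⟨(j.succAbove p').val + 1, hlt.trans j.2⟩) (Nat.lt_succ_self _) hlt
      simpa only [cubeConn_face_eq hφ hp hq hadj] using hy
    · obtain ⟨v, hv⟩ := exists_eq_not
        (g := fun v : Fin m → Bool => cubeFace j η v q) (b := ε) fun h => by
          by_cases hjq : q = j
          · subst hjq
            refine hju ⟨rfl, ?_⟩
            simpa using h fun _ => false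
          · obtain ⟨q', rfl⟩ := Fin.exists_succAbove_eq hjq
            have := h fun _ => !ε
            rw [cubeFace_succAbove] at this
            simp at this
      refine not_injective_of_absorbing k ε hψ (Or.inl ⟨rfl, rfl⟩) (s := p') ?_ (v := v) ?_
      · simp only [hp, cubeFace_succAbove, isEssential_proj]
      · rw [hq, hv]

theorem not_isElementary_of_not_mem {m : ℕ} {φ : (Fin m → Bool) → (Fin (n + 2) → Bool)}
    (hT : (elementaryFrom k ε k.succ).mem φ) (hS : ¬ (elementaryFrom k ε k.castSucc).mem φ) :
    ¬ IsElementary fun v => φ v k.castSucc := by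
  intro h
  rcases hT with hB | hT
  · exact hS (Or.inl hB)
  refine hS (Or.inr fun a ha => ?_)
  rcases eq_or_lt_of_le ha with rfl | ha
  · exact h
  · refine hT a ?_
    simp only [Fin.lt_def, Fin.le_def, Fin.val_castSucc, Fin.val_succ] at *
    omega

/-- Now the coordinate `k` is not elementary, so it uses at least two variables, and `k + 1` is a
variable or the unit. -/
theorem isInsertionPair_elementaryFrom :
    IsInsertionPair A (cubeConn k ε) (elementaryFrom k ε k.castSucc) (elementaryFrom k ε k.succ)
      k.succ ε where
  le _ h := h.imp_right fun h a ha => h a (Fin.castSucc_lt_succ.le.trans ha)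
  coord {m φ} hφ hT hS := by
    rcases hT with hB | hT
    · exact (hS (Or.inl hB)).elim
    rcases hT k.succ le_rfl with ⟨b, hb⟩ | hq
    · rcases Bool.eq_or_eq_not b ε with rfl | rfl
      · exact Or.inr hb
      · exact (hS (Or.inl (hasConstantConn_of_absorbing k ε (Or.inr hb)))).elim
    · exact Or.inl hq
  opposite hφ hT hS hp :=
    Or.inl (hasConstantConn_of_absorbing k ε (Or.inr fun v => by rw [hp, cubeFace_same]))
  missing {m φ p} hφ hT hS hp hm := by
    have hne := not_isElementary_of_not_mem hT hS
    rcases hm with hB | hm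
    · rcases hasConstantConn_of_comp_cubeFace k ε hφ (Or.inr ⟨rfl, rfl⟩) hp hB with h | h
      · exact hS (Or.inl h)
      · exact hne (Or.inl ⟨ε, h⟩)
    · exact hne (isElementary_of_comp_cubeFace hφ hp (castSucc_ne_succ k) (hm _ le_rfl))
  insert {m φ p} hφ hp hT hS := by
    rcases hT with hB | hT
    · exact (hS (Or.inl hB)).elim
    refine Or.inr fun a ha => ?_
    by_cases hac : a = k.succ
    · subst hac
      exact Or.inr ⟨p, hp⟩
    · exact isElementary_of_comp_cubeFace hφ hp hac (hT a ha)
  critical {m φ p} hφ hT hS hp hess d δ hδ := by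
    have hne := not_isElementary_of_not_mem hT hS
    have hpe : IsEssential (fun v => φ v k.succ) p := by simp only [hp, isEssential_proj]
    obtain ⟨s, hs⟩ : ∃ s, ∀ v, δ.1 v p = v s := by
      rcases δ.2.isElementary p with ⟨b, hb⟩ | hs
      · refine (hδ.middle ?_).elim
        rcases Bool.eq_or_eq_not b ε with rfl | rfl
        · exact Or.inl hb
        · exact Or.inr hb
      · exact hs
    -- Either the coordinate `k` takes the absorbing value along `δ`, or it is constantly the unit.
    -- In the latter case one of its variables stays free, or `δ` fixes them all, which will
    -- contradict criticality.
    by_cases hu : ∃ v, φ (δ.1 v) k.castSucc = !ε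
    · obtain ⟨v, hv⟩ := hu
      refine not_injective_of_absorbing k ε ((δ.2.mono (Set.empty_subset A)).comp hφ)
        (Or.inr ⟨rfl, rfl⟩) (s := s) ?_ hv
      simp only [hp, hs, isEssential_proj]
    have hu : ∀ v, φ (δ.1 v) k.castSucc = ε := fun v =>
      (Bool.eq_or_eq_not _ ε).resolve_right fun e => hu ⟨v, e⟩
    by_cases ht : ∃ t, IsEssential (fun v => φ v k.castSucc) t ∧ ∃ s', ∀ v, δ.1 v t = v s'
    · obtain ⟨t, ht, s', hs'⟩ := ht
      exact not_injective_of_unit k ε hφ δ.2 hp ht hs hs' hu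
    have hconst : ∀ t, IsEssential (fun v => φ v k.castSucc) t → ∃ b, ∀ v, δ.1 v t = b :=
      fun t h => (δ.2.isElementary t).resolve_right fun h' => ht ⟨t, h, h'⟩
    exfalso
    obtain ⟨v0, hv0⟩ : ∃ v, φ v k.castSucc = !ε := by
      by_contra! hc
      exact hne (Or.inl ⟨ε, fun v => (Bool.eq_or_eq_not _ ε).resolve_right (hc v)⟩)
    -- If all variables of the coordinate `k` were fixed at `!ε`, its value would be `!ε` by
    -- monotonicity; so one of them is fixed at `ε`.
    have hmin := eq_of_monotone_of_const (g := fun v => φ v k.castSucc)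
      (fun v w h => hφ.monotone h _) (!ε) hv0
    have hex : ∃ t, IsEssential (fun v => φ v k.castSucc) t ∧ ∀ v, δ.1 v t = ε := by
      by_contra! hc
      have : φ (δ.1 fun _ => false) k.castSucc = φ (fun _ => !ε) k.castSucc := by
        refine eq_of_agree_on_essential (fun v => φ v k.castSucc) fun t ht => ?_
        obtain ⟨b, hb⟩ := hconst t ht
        obtain ⟨v, hv⟩ := hc t ht
        rw [hb] at hv ⊢
        exact (Bool.eq_or_eq_not _ _).resolve_left hv
      rw [hu] at this
      rw [← this] at hmin
      simp at hmin
    classical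
    -- Take the last such variable. Those between it and `p` also belong to the coordinate `k`,
    -- hence are fixed at `!ε`: this is the pattern excluded by `hδ.low`.
    obtain ⟨t, ht, hmax⟩ := (Finset.univ.filter fun t =>
      IsEssential (fun v => φ v k.castSucc) t ∧ ∀ v, δ.1 v t = ε).exists_max_image
        (fun t => t) (hex.imp fun t h => by simpa using h)
    simp only [Finset.mem_filter, Finset.mem_univ, true_and] at ht hmax
    refine hδ.low ⟨t, hφ.ordered Fin.castSucc_lt_succ ht.1 hpe, ht.2, fun u h1 h2 => ?_⟩
    obtain ⟨j, hj⟩ := (hess u).exists_coord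
    have hjk : j = k.castSucc := by
      rcases lt_trichotomy j k.castSucc with h | h | h
      · exact (lt_asymm h1 (hφ.ordered h hj ht.1)).elim
      · exact h
      rcases lt_trichotomy j k.succ with h' | rfl | h'
      · simp only [Fin.lt_def, Fin.val_castSucc, Fin.val_succ] at h h'
        omega
      · simp only [hp, isEssential_proj] at hj
        exact (h2.ne hj).elim
      · exact (lt_asymm h2 (hφ.ordered h' hpe hj)).elim
    subst hjk
    obtain ⟨b, hb⟩ := hconst u hj
    rcases Bool.eq_or_eq_not b ε with rfl | rfl
    · exact absurd h1 (not_lt.2 (hmax u ⟨hj, hb⟩))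
    · exact hb
  faces {m φ p} hφ hT hS hp hess hy j η hjne := by
    have hne := not_isElementary_of_not_mem hT hS
    have hψ := (IsCubeMap.face j η).comp hφ
    by_cases hj : p = j
    · subst hj
      obtain rfl : η = !ε := by
        rcases Bool.eq_or_eq_not η ε with rfl | e
        · exact (hjne rfl).elim
        · exact e
      obtain ⟨s, hs⟩ : ∃ s, IsEssential (fun v => φ (cubeFace p (!ε) v) k.castSucc) s := by
        by_contra! hc
        have := const_of_forall_not_isEssential hc fun _ => false
        exact hne (Or.inl ⟨_, const_of_comp_cubeFace hφ hp (castSucc_ne_succ k) this⟩)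
      refine not_injective_of_absorbing k ε hψ (Or.inl ⟨rfl, rfl⟩) hs (v := fun _ => false) ?_
      rw [hp, cubeFace_same]
    obtain ⟨p', rfl⟩ := Fin.exists_succAbove_eq hj
    by_cases hu : ∃ v, φ (cubeFace j η v) k.castSucc = !ε
    · obtain ⟨v, hv⟩ := hu
      refine not_injective_of_absorbing k ε hψ (Or.inr ⟨rfl, rfl⟩) (s := p') ?_ hv
      simp only [hp, cubeFace_succAbove, isEssential_proj]
    have hu : ∀ v, φ (cubeFace j η v) k.castSucc = ε := fun v =>
      (Bool.eq_or_eq_not _ ε).resolve_right fun e => hu ⟨v, e⟩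
    -- A monotone function which is not elementary depends on a variable other than `j`.
    obtain ⟨t, ht, htj⟩ : ∃ t, IsEssential (fun v => φ v k.castSucc) t ∧ t ≠ j := by
      by_contra! hc
      exact hne (isElementary_of_monotone (fun v w h => hφ.monotone h _) j hc)
    obtain ⟨t', rfl⟩ := Fin.exists_succAbove_eq htj
    exact not_injective_of_unit k ε hφ (.face j η) hp ht
      (fun v => cubeFace_succAbove _ _ _ _) (fun v => cubeFace_succAbove _ _ _ _) hu

end Connection

/-! ### The filtration of the cube with connections -/

/-- Maps with a constant coordinate, or whose coordinates from `K` on are elementary. -/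
def cubeFiltration (n K : ℕ) : CubeSieve n where
  mem φ := (∃ j b, ∀ v, φ v j = b) ∨ ∀ j : Fin n, K ≤ j.val → IsElementary fun v => φ v j
  comp hf h := h.imp (fun ⟨j, b, h⟩ => ⟨j, b, fun _ => h _⟩)
    fun h j hj => (h j hj).comp hf.isElementary

/-- The unit law of the connection, from which the retraction between the two filtrations comes. -/
theorem cubeConn_cubeFace_succ {n : ℕ} (k : Fin (n + 1)) (ε : Bool) (x : Fin (n + 1) → Bool) :
    cubeConn k ε (cubeFace k.succ ε x) = x := by
  ext j
  rcases lt_trichotomy j k with hj | rfl | hj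
  · rw [cubeConn_lt hj, ← Fin.succAbove_of_castSucc_lt k.succ j, cubeFace_succAbove]
    exact (Fin.castSucc_lt_castSucc_iff.2 hj).trans Fin.castSucc_lt_succ
  · rw [cubeConn_same, cubeFace_same, connOp_unit_right,
      ← Fin.succAbove_of_castSucc_lt j.succ j Fin.castSucc_lt_succ, cubeFace_succAbove]
  · rw [cubeConn_gt hj, ← Fin.succAbove_of_le_castSucc k.succ j, cubeFace_succAbove]
    simp only [Fin.lt_def, Fin.le_def, Fin.val_castSucc, Fin.val_succ] at *
    omega

/-! ### The filtration steps inside a cube of one dimension more. -/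

section Retract

variable {n m : ℕ} {k : Fin (n + 1)} {ε : Bool}

/-- Coordinates up to `k` keep their index, and those after the inserted one are shifted by one,
whence the strict `K < a.val`. -/
theorem isElementary_cubeFace_succ {K : ℕ} {φ : (Fin m → Bool) → (Fin (n + 1) → Bool)}
    (h : ∀ j : Fin (n + 1), K ≤ j.val → IsElementary fun v => φ v j) {a : Fin (n + 2)}
    (ha : a = k.succ ∨ (a.val ≤ k.val ∧ K ≤ a.val) ∨ K < a.val) :
    IsElementary fun v => cubeFace k.succ ε (φ v) a := by
  rcases Fin.eq_self_or_eq_succAbove k.succ a with rfl | ⟨j, rfl⟩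
  · exact Or.inl ⟨ε, fun v => cubeFace_same _ _ _⟩
  · simp only [cubeFace_succAbove]
    refine h j ?_
    have hne := Fin.succAbove_ne k.succ j
    by_cases hj : j.castSucc < k.succ
    · rw [Fin.succAbove_of_castSucc_lt _ _ hj] at ha hne
      simp only [Fin.lt_def, Fin.ext_iff, Fin.val_castSucc, Fin.val_succ, ne_eq] at *
      omega
    · rw [Fin.succAbove_of_le_castSucc _ _ (not_lt.1 hj)] at ha hne
      simp only [Fin.lt_def, Fin.ext_iff, Fin.val_castSucc, Fin.val_succ, ne_eq] at *
      omega

theorem cubeFiltration_unitSieve {φ : (Fin m → Bool) → (Fin (n + 1) → Bool)}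
    (h : (cubeFiltration (n + 1) k).mem φ) :
    (unitSieve k ε).mem fun v => cubeFace k.succ ε (φ v) := by
  rcases h with ⟨j, b, h⟩ | h
  · exact Or.inl ⟨j, b, fun v => by rw [cubeConn_cubeFace_succ, h]⟩
  · refine Or.inr ⟨fun a ha => isElementary_cubeFace_succ h ?_, fun v => cubeFace_same _ _ _⟩
    simp only [Fin.le_def, Fin.ext_iff, Fin.val_castSucc, Fin.val_succ] at *
    omega

theorem cubeFiltration_elementaryFrom {φ : (Fin m → Bool) → (Fin (n + 1) → Bool)}
    (h : (cubeFiltration (n + 1) (k + 1)).mem φ) :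
    (elementaryFrom k ε k.succ).mem fun v => cubeFace k.succ ε (φ v) := by
  rcases h with ⟨j, b, h⟩ | h
  · exact Or.inl ⟨j, b, fun v => by rw [cubeConn_cubeFace_succ, h]⟩
  · refine Or.inr fun a ha => isElementary_cubeFace_succ h ?_
    simp only [Fin.le_def, Fin.ext_iff, Fin.val_succ] at *
    omega

theorem unitSieve_cubeFiltration {ψ : (Fin m → Bool) → (Fin (n + 2) → Bool)}
    (h : (unitSieve k ε).mem ψ) :
    (cubeFiltration (n + 1) k).mem fun v => cubeConn k ε (ψ v) := by
  refine h.imp id fun ⟨h, hε⟩ j hj => ?_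
  rcases eq_or_lt_of_le (show k ≤ j from hj) with rfl | hj
  · simp only [cubeConn_same, hε, connOp_unit_right]
    exact h _ le_rfl
  · simp only [cubeConn_gt hj]
    refine h _ ?_
    simp only [Fin.lt_def, Fin.le_def, Fin.val_castSucc, Fin.val_succ] at *
    omega

theorem elementaryFrom_cubeFiltration {ψ : (Fin m → Bool) → (Fin (n + 2) → Bool)}
    (h : (elementaryFrom k ε k.succ).mem ψ) :
    (cubeFiltration (n + 1) (k + 1)).mem fun v => cubeConn k ε (ψ v) := by
  refine h.imp id fun h j hj => ?_
  simp only [cubeConn_gt (show k < j from hj)]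
  refine h _ ?_
  simp only [Fin.le_def, Fin.val_succ]
  omega

end Retract

theorem cubeFiltration_mono {n K L m : ℕ} (h : K ≤ L) {φ : (Fin m → Bool) → (Fin n → Bool)}
    (hφ : (cubeFiltration n K).mem φ) : (cubeFiltration n L).mem φ :=
  hφ.imp_right fun hφ j hj => hφ j (h.trans hj)

namespace MarkedCubicalSet

variable {A : Set Bool}

/-- The map of complexes induced by a map between cubes. -/
def sieveMap {N N' M M' : ℕ} {g : (Fin N → Bool) → (Fin M → Bool)}
    {g' : (Fin N' → Bool) → (Fin M' → Bool)} {S : CubeSieve N} {S' : CubeSieve N'}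
    (u : (⟨N⟩ : CubeCat A) ⟶ ⟨N'⟩)
    (hS : ∀ {m : ℕ} {φ : (Fin m → Bool) → (Fin N → Bool)}, S.mem φ → S'.mem fun v => u.1 (φ v))
    (hg : ∀ {m : ℕ} {φ : (Fin m → Bool) → (Fin N → Bool)}, (¬ Function.Injective fun v => g (φ v)) →
      ¬ Function.Injective fun v => g' (u.1 (φ v))) :
    (markedCube A N g).regular (sieveSub A S) ⟶ (markedCube A N' g').regular (sieveSub A S') where
  map := { app c := ↾fun φ => ⟨(show (⟨c.unop.dim⟩ : CubeCat A) ⟶ ⟨N⟩ from φ.1) ≫ u, hS φ.2⟩ }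
  marked h := hg h

/-- The steps of the filtration are retracts of compositions of attachments. -/
def cubeFiltrationRetract {n : ℕ} (k : Fin (n + 1)) {ε : Bool} (hε : ε ∈ A)
    (hle : sieveSub A (cubeFiltration (n + 1) k) ≤ sieveSub A (cubeFiltration (n + 1) (k + 1)))
    (hle' : sieveSub A (unitSieve k ε) ≤ sieveSub A (elementaryFrom k ε k.succ)) :
    RetractArrow ((markedCube A (n + 1) fun v => v).regularHomOfLE hle)
      ((markedCube A (n + 2) (cubeConn k ε)).regularHomOfLE hle') where
  i := Arrow.homMk
    (sieveMap (CubeCat.face k.succ ε) cubeFiltration_unitSieve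
      fun h => by simpa only [CubeCat.face, cubeConn_cubeFace_succ] using h)
    (sieveMap (CubeCat.face k.succ ε) cubeFiltration_elementaryFrom
      fun h => by simpa only [CubeCat.face, cubeConn_cubeFace_succ] using h) rfl
  r := Arrow.homMk
    (sieveMap (CubeCat.conn k ε hε) unitSieve_cubeFiltration id)
    (sieveMap (CubeCat.conn k ε hε) elementaryFrom_cubeFiltration id) rfl
  retract := by
    have key : ∀ {c : CubeCat A} (φ : c ⟶ ⟨n + 1⟩),
        (φ ≫ CubeCat.face k.succ ε) ≫ CubeCat.conn k ε hε = φ := fun φ =>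
      Subtype.ext (funext fun v => cubeConn_cubeFace_succ k ε (φ.1 v))
    ext1
    · ext1
      ext c φ
      exact Subtype.ext (key _)
    · ext1
      ext c φ
      exact Subtype.ext (key _)

section Saturated

variable (W : MorphismProperty (MarkedCubicalSet ∅)) [W.IsStableUnderCobaseChange]
  [MorphismProperty.IsStableUnderTransfiniteComposition.{0} W] [W.IsStableUnderRetracts]

theorem mem_cubeFiltration_step (hW : comicalGenerators ∅ ≤ W) {n : ℕ} (k : Fin (n + 1))
    {ε : Bool} (hε : ε ∈ A)
    (hle : sieveSub A (cubeFiltration (n + 1) k) ≤ sieveSub A (cubeFiltration (n + 1) (k + 1))) :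
    W ((markedCube A (n + 1) fun v => v).regularHomOfLE hle) := by
  have h1 := (isInsertionPair_unitSieve (A := A) (k := k) (ε := ε))
  have h2 := (isInsertionPair_elementaryFrom (A := A) (k := k) (ε := ε))
  have l1 := sieveSub_mono A fun _ => h1.le
  have l2 := sieveSub_mono A fun _ => h2.le
  exact MorphismProperty.of_retract (cubeFiltrationRetract k hε hle (l1.trans l2))
    (W.comp_mem _ _ (h1.mem_property W hW l1) (h2.mem_property W hW l2))

theorem mem_cubeFiltration (hW : comicalGenerators ∅ ≤ W) (n : ℕ)
    (hle : sieveSub A (cubeFiltration n 0) ≤ ⊤) :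
    W ((markedCube A n fun v => v).regularHomOfLE hle) := by
  have htop : sieveSub A (cubeFiltration n n) = ⊤ :=
    top_le_iff.1 fun c φ _ => Or.inr fun j hj => (hj.not_gt j.2).elim
  have hF : ∀ K, sieveSub A (cubeFiltration n 0) ≤ sieveSub A (cubeFiltration n K) := fun K =>
    sieveSub_mono A fun _ _ => cubeFiltration_mono K.zero_le
  -- Without connections the bottom stage is already everything. Otherwise one `ε` serves for all
  -- steps, even if `A` has two elements.
  obtain rfl | ⟨ε, hε⟩ := A.eq_empty_or_nonempty
  · refine IsInsertionPair.mem_regularHomOfLE_congr W (X := markedCube ∅ n fun v => v) rfl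
      (top_le_iff.1 fun c φ _ => ?_) (hle := le_refl _) _ (W.id_mem _)
    exact Or.inr fun j _ => IsCubeMap.isElementary (Subtype.property (p := IsCubeMap ∅) φ) j
  refine IsInsertionPair.mem_regularHomOfLE_congr W (X := markedCube A n fun v => v) rfl
    htop (hle := hF n) _ ?_
  suffices h : ∀ K ≤ n, W ((markedCube A n fun v => v).regularHomOfLE (hF K)) from h n le_rfl
  intro K
  induction K with
  | zero => exact fun _ => W.id_mem _
  | succ K ih =>
    intro hK
    obtain _ | n := n
    · omega
    exact W.comp_mem _ _ (ih (by omega)) (mem_cubeFiltration_step W hW ⟨K, by omega⟩ hε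
      (sieveSub_mono A fun _ _ => cubeFiltration_mono K.le_succ))

end Saturated

/-! ### The corner inclusion -/

theorem mem_marked_stdCube_iff {n : ℕ} {c : CubeCat A} (φ : c ⟶ (⟨n⟩ : CubeCat A)) :
    φ ∈ (stdCube A n).marked c ↔ ¬ Function.Injective φ.1 := by
  rw [← φ.2.isDegenerateMap_iff, ← isDegenerate_iff_isDegenerateMap]
  exact ⟨fun h => h.resolve_right fun h => h.2, Or.inl⟩

/-- The standard cube of `□_∅` in the bottom of the filtration. -/
def stdCubeToFiltration (A : Set Bool) (n : ℕ) :
    stdCube ∅ n ⟶ (markedCube A n fun v => v).regular (sieveSub A (cubeFiltration n 0)) where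
  map := { app c := ↾fun φ => ⟨(CubeCat.incl (Set.empty_subset A)).map φ,
    Or.inr fun j _ => IsCubeMap.isElementary (Subtype.property (p := IsCubeMap ∅) φ) j⟩ }
  marked {_ φ} h := (mem_marked_stdCube_iff φ).1 h

/-- The boundary of the cube of `□_A` in the bottom of the filtration. -/
def boundaryToFiltration (A : Set Bool) (n : ℕ) :
    (iStar (Set.empty_subset A)).obj (boundary A n) ⟶
      (markedCube A n fun v => v).regular (sieveSub A (cubeFiltration n 0)) where
  map := { app c := ↾fun φ => ⟨φ.1, Or.inl (by
    obtain ⟨j, ε, -, h⟩ := mem_faceUnion_iff.1 φ.2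
    exact ⟨j, ε, h⟩)⟩ }
  marked {_ φ} h := (mem_marked_stdCube_iff φ.1).1 h

/-- An elementary cube map lies in `□_∅`, so the bottom stage is covered by `□_∅^n` and the
boundary. They meet in the elementary maps with a constant coordinate, which form `∂□_∅^n`. -/
theorem isPushout_cubeFiltration (n : ℕ) :
    IsPushout (boundaryι ∅ n) (boundaryToIStar (Set.empty_subset A) n) (stdCubeToFiltration A n)
      (boundaryToFiltration A n) := by
  refine isPushout_of_cover rfl ?_ ?_ ?_ ?_ ?_ ?_
  · intro c φ ψ h
    exact Subtype.ext (Subtype.ext (congrArg (fun x => x.1.1) h))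
  · intro c φ ψ h
    exact Subtype.ext (congrArg (fun x => x.1.1) h)
  · rintro c ⟨φ, h | h⟩
    · obtain ⟨j, b, h⟩ := h
      exact Or.inr ⟨⟨φ, mem_faceUnion_of_coord trivial h⟩, rfl⟩
    · exact Or.inl ⟨⟨_, IsCubeMap.of_isElementary (Subtype.property (p := IsCubeMap A) φ)
        fun j => h j (Nat.zero_le _)⟩, rfl⟩
  · intro c φ ψ h
    obtain ⟨j, ε, -, hj⟩ := mem_faceUnion_iff.1 ψ.2
    have e : φ.1 = ψ.1.1 := congrArg (fun x => x.1.1) h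
    refine ⟨⟨φ, mem_faceUnion_of_coord (j := j) (ε := ε) trivial fun v => ?_⟩,
      Subtype.ext (Subtype.ext e)⟩
    exact (congrFun (congrFun e v) j).trans (hj v)
  · intro c φ ψ _ _ h
    exact Subtype.ext (congrArg (fun x => x.1) h)
  · rintro c ⟨φ, h | h⟩ hφ
    · obtain ⟨j, b, h⟩ := h
      exact Or.inr (Or.inr ⟨⟨φ, mem_faceUnion_of_coord trivial h⟩,
        (mem_marked_stdCube_iff _).2 hφ, rfl⟩)
    · exact Or.inr (Or.inl ⟨⟨_, IsCubeMap.of_isElementary (Subtype.property (p := IsCubeMap A) φ)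
        fun j => h j (Nat.zero_le _)⟩, (mem_marked_stdCube_iff _).2 hφ, rfl⟩)

/-- The top of the filtration. -/
def filtrationIso (A : Set Bool) (n : ℕ) :
    (markedCube A n fun v => v).regular ⊤ ≅ (iStar (Set.empty_subset A)).obj (stdCube A n) where
  hom :=
    { map := { app c := ↾fun φ => φ.1 }
      marked {_ φ} h := (mem_marked_stdCube_iff φ.1).2 h }
  inv :=
    { map := { app c := ↾fun φ => ⟨φ, trivial⟩ }
      marked {_ φ} h := (mem_marked_stdCube_iff φ).1 h }

/-- The corner inclusion is comical. -/
theorem comical_cornerInclusion (A : Set Bool) (n : ℕ) :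
    comical ∅ (cornerInclusion (Set.empty_subset A) n) := by
  intro W hW _ _ _
  have h := isPushout_cubeFiltration (A := A) n
  have e : cornerInclusion (Set.empty_subset A) n = h.isoPushout.inv ≫
      (markedCube A n fun v => v).regularHomOfLE le_top ≫ (filtrationIso A n).hom := by
    apply pushout.hom_ext
    · rw [cornerInclusion, pushout.inl_desc, h.inl_isoPushout_inv_assoc]
      rfl
    · rw [cornerInclusion, pushout.inr_desc, h.inr_isoPushout_inv_assoc]
      rfl
  rw [e]
  exact (W.cancel_left_of_respectsIso _ _).2
    ((W.cancel_right_of_respectsIso _ _).2 (mem_cubeFiltration W hW n le_top))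

end MarkedCubicalSet

/-! ### The left adjoint on cubes and their boundaries -/

namespace CubeCat

/-- The idempotent of the cube which sets the coordinate `j` to `ε`. -/
def setCoord {n : ℕ} (j : Fin n) (ε : Bool) : (⟨n⟩ : CubeCat ∅) ⟶ ⟨n⟩ :=
  ⟨fun v => Function.update v j ε, by
    obtain _ | n := n
    · exact j.elim0
    · simp only [← cubeFace_cubeDegen]
      exact (IsCubeMap.degen j).comp (.face j ε)⟩

theorem setCoord_comm {n : ℕ} {j j' : Fin n} (h : j ≠ j') (ε ε' : Bool) :
    setCoord j ε ≫ setCoord j' ε' = setCoord j' ε' ≫ setCoord j ε :=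
  Subtype.ext (funext fun _ => Function.update_comm h _ _ _)

theorem comp_setCoord {A : Set Bool} {n : ℕ} {c : CubeCat A} {φ : c ⟶ ⟨n⟩} {j : Fin n} {ε : Bool}
    (h : ∀ v, φ.1 v j = ε) : φ ≫ (incl (Set.empty_subset A)).map (setCoord j ε) = φ :=
  Subtype.ext (funext fun v => by
    change Function.update (φ.1 v) j ε = φ.1 v
    rw [← h v, Function.update_eq_self])

end CubeCat

namespace MarkedCubicalSet

open CubeCat

variable {A : Set Bool} {n : ℕ}

/-- By Yoneda both sides are the `n`-cubes of `Z`; the degenerate markings impose no condition. -/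
theorem bijective_cubeToIStar_comp (Z : MarkedCubicalSet A) :
    Function.Bijective fun u : stdCube A n ⟶ Z =>
      cubeToIStar (Set.empty_subset A) n ≫ (iStar (Set.empty_subset A)).map u := by
  constructor
  · intro u u' h
    ext1
    refine yonedaEquiv.injective ?_
    exact ConcreteCategory.congr_hom (congr_app (congrArg Hom.map h) (op ⟨n⟩))
      (𝟙 (⟨n⟩ : CubeCat ∅))
  · intro g
    let u : stdCube A n ⟶ Z :=
      { map := yonedaEquiv.symm (g.map.app (op ⟨n⟩) (𝟙 (⟨n⟩ : CubeCat ∅)))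
        marked {c φ} h := Z.degenerate ((h.resolve_right fun h => h.2).app _) }
    refine ⟨u, ?_⟩
    ext1
    refine yonedaEquiv.injective ?_
    exact ConcreteCategory.congr_hom (Z.cubes.map_id (op ⟨n⟩)) _

/-- The cube of the boundary which sets the coordinate `j` to `ε`. -/
def boundarySetCoord (j : Fin n) (ε : Bool) : (boundary ∅ n).cubes.obj (op ⟨n⟩) :=
  ⟨setCoord j ε, mem_faceUnion_of_coord (j := j) (ε := ε) trivial fun _ => Function.update_self ..⟩

/-- A cube with two constant coordinates is fixed by both idempotents, and these commute in the
boundary of `□_∅^n`. -/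
theorem map_boundarySetCoord_eq {Z : MarkedCubicalSet A}
    (g : boundary ∅ n ⟶ (iStar (Set.empty_subset A)).obj Z) {c : CubeCat A} (φ : c ⟶ ⟨n⟩)
    {j j' : Fin n} {ε ε' : Bool} (h : ∀ v, φ.1 v j = ε) (h' : ∀ v, φ.1 v j' = ε') :
    Z.cubes.map φ.op (g.map.app (op ⟨n⟩) (boundarySetCoord j ε)) =
      Z.cubes.map φ.op (g.map.app (op ⟨n⟩) (boundarySetCoord j' ε')) := by
  by_cases hj : j = j'
  · subst hj
    obtain rfl : ε = ε' := (h fun _ => false).symm.trans (h' _)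
    rfl
  have key : ∀ {j j' : Fin n} {ε ε' : Bool}, (∀ v, φ.1 v j' = ε') →
      Z.cubes.map φ.op (g.map.app (op ⟨n⟩) (boundarySetCoord j ε)) =
        Z.cubes.map φ.op (g.map.app (op ⟨n⟩)
          ((boundary ∅ n).cubes.map (setCoord j' ε').op (boundarySetCoord j ε))) := by
    intro j j' ε ε' h'
    conv_lhs => rw [← comp_setCoord h']
    rw [NatTrans.naturality_apply]
    exact ConcreteCategory.congr_hom (Z.cubes.map_comp _ _) _
  rw [key h', key (j := j') h]
  refine congrArg (fun x => Z.cubes.map φ.op (g.map.app (op ⟨n⟩) x)) (Subtype.ext ?_)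
  exact setCoord_comm (Ne.symm hj) ε' ε

/-- The extension of a map from the boundary of the cube of `□_∅`. -/
noncomputable def boundaryExtend {Z : MarkedCubicalSet A}
    (g : boundary ∅ n ⟶ (iStar (Set.empty_subset A)).obj Z) : boundary A n ⟶ Z where
  map :=
    { app c := ↾fun φ : (boundary A n).cubes.obj c =>
        Z.cubes.map (Quiver.Hom.op (X := c.unop) (Y := ⟨n⟩) φ.1) (g.map.app (op ⟨n⟩)
          (boundarySetCoord (mem_faceUnion_iff.1 φ.2).choose
            (mem_faceUnion_iff.1 φ.2).choose_spec.choose))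
      naturality c d f := by
        ext φ
        have h := (mem_faceUnion_iff.1 φ.2).choose_spec.choose_spec.2
        have h' := (mem_faceUnion_iff.1
          ((boundary A n).cubes.map f φ).2).choose_spec.choose_spec.2
        refine (map_boundarySetCoord_eq g _ h' fun v => h (f.unop.1 v)).trans ?_
        exact ConcreteCategory.congr_hom
          (Z.cubes.map_comp (Quiver.Hom.op (X := c.unop) (Y := ⟨n⟩) φ.1) f)
          (g.map.app (op ⟨n⟩) (boundarySetCoord (mem_faceUnion_iff.1 φ.2).choose
            (mem_faceUnion_iff.1 φ.2).choose_spec.choose)) }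
  marked {c φ} h := Z.degenerate (isDegenerate_map (c := c) (d := ⟨n⟩) φ.1
    (isDegenerateMap_of_isDegenerate (h.resolve_right fun h => h.2)) _)

theorem boundaryExtend_app {Z : MarkedCubicalSet A}
    (g : boundary ∅ n ⟶ (iStar (Set.empty_subset A)).obj Z) {c : CubeCat A} (φ : c ⟶ ⟨n⟩)
    (hφ : φ ∈ (faceUnion A n fun _ _ => True).obj (op c)) {j : Fin n} {ε : Bool}
    (h : ∀ v, φ.1 v j = ε) : (boundaryExtend g).map.app (op c) ⟨φ, hφ⟩ =
      Z.cubes.map φ.op (g.map.app (op ⟨n⟩) (boundarySetCoord j ε)) :=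
  map_boundarySetCoord_eq g φ (mem_faceUnion_iff.1 hφ).choose_spec.choose_spec.2 h

/-- A boundary cube is unchanged by the idempotent of any of its constant coordinates, so it is a
restriction of an `n`-cube of `∂□_∅^n`. Idempotents rather than faces keep the generating cubes in
dimension `n`. -/
theorem bijective_boundaryToIStar_comp (Z : MarkedCubicalSet A) :
    Function.Bijective fun u : boundary A n ⟶ Z =>
      boundaryToIStar (Set.empty_subset A) n ≫ (iStar (Set.empty_subset A)).map u := by
  constructor
  · intro u u' h
    ext1
    ext c φ
    obtain ⟨φ, hφ⟩ := φ
    obtain ⟨j, ε, -, hj⟩ := mem_faceUnion_iff.1 hφ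
    have e : (⟨φ, hφ⟩ : (boundary A n).cubes.obj c) = (boundary A n).cubes.map
        (Quiver.Hom.op (X := c.unop) (Y := ⟨n⟩) φ)
        ((boundaryToIStar (Set.empty_subset A) n).map.app (op ⟨n⟩) (boundarySetCoord j ε)) :=
      Subtype.ext (comp_setCoord hj).symm
    have nat : ∀ u : boundary A n ⟶ Z, u.map.app c ⟨φ, hφ⟩ = Z.cubes.map
        (Quiver.Hom.op (X := c.unop) (Y := ⟨n⟩) φ) (u.map.app (op ⟨n⟩)
          ((boundaryToIStar (Set.empty_subset A) n).map.app (op ⟨n⟩) (boundarySetCoord j ε))) :=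
      fun u => (congrArg (u.map.app c) e).trans (NatTrans.naturality_apply u.map _ _)
    refine (nat u).trans (Eq.trans ?_ (nat u').symm)
    exact congrArg _ (ConcreteCategory.congr_hom (congr_app (congrArg Hom.map h) (op ⟨n⟩))
      (boundarySetCoord j ε))
  · intro g
    refine ⟨boundaryExtend g, ?_⟩
    ext1
    ext c φ
    obtain ⟨φ, hφ⟩ := φ
    obtain ⟨j, ε, -, hj⟩ := mem_faceUnion_iff.1 hφ
    have e : (⟨φ, hφ⟩ : (boundary ∅ n).cubes.obj c) = (boundary ∅ n).cubes.map
        (Quiver.Hom.op (X := c.unop) (Y := ⟨n⟩) φ) (boundarySetCoord j ε) :=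
      Subtype.ext (comp_setCoord (A := ∅) hj).symm
    refine (boundaryExtend_app g _ _ hj).trans ?_
    exact ((congrArg (g.map.app c) e).trans (NatTrans.naturality_apply g.map _ _)).symm

/-! ### Recognising values of `i_!` by their universal property. -/

section Transpose

variable {B : Set Bool} (h : A ⊆ B)

theorem unit_comp_homEquiv_symm {X : MarkedCubicalSet A} {T : MarkedCubicalSet B}
    (k : X ⟶ (iStar h).obj T) :
    (iAdj h).unit.app X ≫ (iStar h).map (((iAdj h).homEquiv X T).symm k) = k := by
  exact ((iAdj h).homEquiv_unit ..).symm.trans (Equiv.apply_symm_apply _ _)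

/-- By Yoneda, since `T` and `i_! X` corepresent the same functor. -/
theorem isIso_homEquiv_symm {X : MarkedCubicalSet A} {T : MarkedCubicalSet B}
    (k : X ⟶ (iStar h).obj T)
    (hk : ∀ Z, Function.Bijective fun u : T ⟶ Z => k ≫ (iStar h).map u) :
    IsIso (((iAdj h).homEquiv X T).symm k) := by
  refine isIso_of_coyoneda_map_bijective _ fun Z => ?_
  refine (((iAdj h).homEquiv X Z).comp_bijective _).1 ?_
  convert hk Z using 1
  ext1 u
  simp [Adjunction.homEquiv_naturality_right]

/-- The comparison isomorphism `i_! X ≅ T` given by a universal map `X ⟶ i^* T`. -/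
noncomputable def transposeIso {X : MarkedCubicalSet A} {T : MarkedCubicalSet B}
    (k : X ⟶ (iStar h).obj T)
    (hk : ∀ Z, Function.Bijective fun u : T ⟶ Z => k ≫ (iStar h).map u) :
    (iShriek h).obj X ≅ T :=
  haveI := isIso_homEquiv_symm h k hk
  asIso (((iAdj h).homEquiv X T).symm k)

theorem unit_comp_transposeIso {X : MarkedCubicalSet A} {T : MarkedCubicalSet B}
    (k : X ⟶ (iStar h).obj T)
    (hk : ∀ Z, Function.Bijective fun u : T ⟶ Z => k ≫ (iStar h).map u) :
    (iAdj h).unit.app X ≫ (iStar h).map (transposeIso h k hk).hom = k :=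
  unit_comp_homEquiv_symm h k

theorem map_comp_transposeIso {X X' : MarkedCubicalSet A} {T T' : MarkedCubicalSet B}
    {k : X ⟶ (iStar h).obj T} {k' : X' ⟶ (iStar h).obj T'}
    (hk : ∀ Z, Function.Bijective fun u : T ⟶ Z => k ≫ (iStar h).map u)
    (hk' : ∀ Z, Function.Bijective fun u : T' ⟶ Z => k' ≫ (iStar h).map u)
    {s : X ⟶ X'} {t : T ⟶ T'} (w : k ≫ (iStar h).map t = s ≫ k') :
    (iShriek h).map s ≫ (transposeIso h k' hk').hom = (transposeIso h k hk).hom ≫ t := by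
  apply ((iAdj h).homEquiv _ _).injective
  rw [Adjunction.homEquiv_naturality_left, Adjunction.homEquiv_naturality_right,
    Adjunction.homEquiv_unit, Adjunction.homEquiv_unit, unit_comp_transposeIso,
    unit_comp_transposeIso, w]

@[ext]
theorem WeakConnectionStructure.ext {h : A ⊆ B} {X Y : MarkedCubicalSet A} {f : X ⟶ Y}
    {G G' : WeakConnectionStructure h f} (e : G.Γ = G'.Γ) : G = G' := by
  cases G
  cases G'
  cases e
  rfl

end Transpose

/-! ### Lifting weak connection structures -/

/-- Comical maps lift against comical fibrations. -/
theorem comical.hasLiftingProperty {P Q X Y : MarkedCubicalSet A} {k : P ⟶ Q} (hk : comical A k)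
    {f : X ⟶ Y} (hf : comicalFibration A f) : HasLiftingProperty k f :=
  -- The class of maps with the left lifting property against comical fibrations is saturated and
  -- contains the generators.
  hk (comicalFibration A).llp ((MorphismProperty.le_llp_iff_le_rlp _ _).2 le_rfl)
    inferInstance inferInstance inferInstance f hf

/-- Under `a : i_! □_∅^n ≅ □_A^n` and `b`, its analogue for boundaries, the given data form a square
from the corner inclusion to `f`; a lift transports back to the wanted structure. -/
theorem exists_weakConnectionStructure {X Y : MarkedCubicalSet ∅} {f : X ⟶ Y}
    (hf : comicalFibration ∅ f) (x : stdCube ∅ n ⟶ X)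
    (Γb : WeakConnectionStructure (Set.empty_subset A) (boundaryι ∅ n ≫ x))
    (Γy : WeakConnectionStructure (Set.empty_subset A) (x ≫ f))
    (e : (Γy.precomp (boundaryι ∅ n)).Γ = (Γb.postcomp f).Γ) :
    ∃ Γx : WeakConnectionStructure (Set.empty_subset A) x,
      Γx.precomp (boundaryι ∅ n) = Γb ∧ Γx.postcomp f = Γy := by
  let h := Set.empty_subset A
  let a := transposeIso h (cubeToIStar h n) bijective_cubeToIStar_comp
  let b := transposeIso h (boundaryToIStar h n) bijective_boundaryToIStar_comp
  have ha : (iAdj h).unit.app (stdCube ∅ n) ≫ (iStar h).map a.hom = cubeToIStar h n :=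
    unit_comp_transposeIso h _ _
  have hb : (iAdj h).unit.app (boundary ∅ n) ≫ (iStar h).map b.hom = boundaryToIStar h n :=
    unit_comp_transposeIso h _ _
  have hab : (iShriek h).map (boundaryι ∅ n) ≫ a.hom = b.hom ≫ boundaryι A n :=
    map_comp_transposeIso h _ _ (boundaryToIStar_comp h n)
  have hbi : boundaryToIStar h n ≫ (iStar h).map b.inv = (iAdj h).unit.app (boundary ∅ n) := by
    rw [← hb, Category.assoc, ← Functor.map_comp, b.hom_inv_id, CategoryTheory.Functor.map_id]
    exact Category.comp_id _
  have hai : cubeToIStar h n ≫ (iStar h).map a.inv = (iAdj h).unit.app (stdCube ∅ n) := by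
    rw [← ha, Category.assoc, ← Functor.map_comp, a.hom_inv_id, CategoryTheory.Functor.map_id]
    exact Category.comp_id _
  have habi : boundaryι A n ≫ a.inv = b.inv ≫ (iShriek h).map (boundaryι ∅ n) := by
    rw [Iso.comp_inv_eq, Category.assoc, hab, b.inv_hom_id_assoc]
  have e' : (iStar h).map ((iShriek h).map (boundaryι ∅ n)) ≫ Γy.Γ = Γb.Γ ≫ f := e
  have w : boundaryι ∅ n ≫ x = boundaryToIStar h n ≫ (iStar h).map b.inv ≫ Γb.Γ := by
    rw [← Category.assoc, hbi, Γb.unit_comp]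
  -- On `□_∅^n` the square commutes because `Γy` is a structure on `x ≫ f`, and on the boundary by
  -- the compatibility `e'`.
  have sq : CommSq (pushout.desc x ((iStar h).map b.inv ≫ Γb.Γ) w) (cornerInclusion h n) f
      ((iStar h).map a.inv ≫ Γy.Γ) := by
    constructor
    apply pushout.hom_ext
    · rw [pushout.inl_desc_assoc, cornerInclusion, pushout.inl_desc_assoc, ← Category.assoc, hai,
        Γy.unit_comp]
    · rw [pushout.inr_desc_assoc, cornerInclusion, pushout.inr_desc_assoc, Category.assoc, ← e',
        ← Category.assoc, ← Functor.map_comp, ← habi, Functor.map_comp, Category.assoc]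
  have := (comical_cornerInclusion A n).hasLiftingProperty hf
  have hl : cubeToIStar h n ≫ sq.lift = x := by
    have := congrArg (pushout.inl _ _ ≫ ·) sq.fac_left
    simpa only [cornerInclusion, pushout.inl_desc_assoc, pushout.inl_desc] using this
  have hr : (iStar h).map (boundaryι A n) ≫ sq.lift = (iStar h).map b.inv ≫ Γb.Γ := by
    have := congrArg (pushout.inr _ _ ≫ ·) sq.fac_left
    simpa only [cornerInclusion, pushout.inr_desc_assoc, pushout.inr_desc] using this
  refine ⟨⟨(iStar h).map a.hom ≫ sq.lift, by rw [← Category.assoc, ha, hl]⟩, ?_, ?_⟩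
  · ext1
    change (iStar h).map ((iShriek h).map (boundaryι ∅ n)) ≫ (iStar h).map a.hom ≫ sq.lift = Γb.Γ
    rw [← Category.assoc, ← Functor.map_comp, hab, Functor.map_comp, Category.assoc, hr,
      ← Category.assoc, ← Functor.map_comp, b.hom_inv_id, CategoryTheory.Functor.map_id,
      Category.id_comp]
  · ext1
    change ((iStar h).map a.hom ≫ sq.lift) ≫ f = Γy.Γ
    rw [Category.assoc, sq.fac_right, ← Category.assoc, ← Functor.map_comp, a.hom_inv_id,
      CategoryTheory.Functor.map_id, Category.id_comp]

end MarkedCubicalSet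

theorem proposition2p15 (A : Set Bool) (n : ℕ) :
    comical ∅ (cornerInclusion (Set.empty_subset A) n) ∧
    ∀ (X Y : MarkedCubicalSet ∅) (f : X ⟶ Y), comicalFibration ∅ f →
      ∀ (x : stdCube ∅ n ⟶ X)
        (Γb : WeakConnectionStructure (Set.empty_subset A) (boundaryι ∅ n ≫ x))
        (Γy : WeakConnectionStructure (Set.empty_subset A) (x ≫ f)),
        (Γy.precomp (boundaryι ∅ n)).Γ = (Γb.postcomp f).Γ →
        ∃ Γx : WeakConnectionStructure (Set.empty_subset A) x,
          Γx.precomp (boundaryι ∅ n) = Γb ∧ Γx.postcomp f = Γy :=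
  ⟨comical_cornerInclusion A n, fun _ _ _ hf x Γb Γy e =>
    exists_weakConnectionStructure hf x Γb Γy e⟩
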